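/- Work over $\mathbb{C}$ and give $\mathrm{SL}(N)=\mathrm{SL}(N,\mathbb{C})$ its Zariski topology; "closed" and "connected" refer to it. A Borel subgroup of $\mathrm{SL}(N)$ is a maximal closed connected solvable subgroup, and a parabolic subgroup is a closed subgroup containing a Borel subgroup. A closed subgroup $H\subset \mathrm{SL}(N)$ is called parabolically connected if $P\cap H$ is connected for every parabolic subgroup $P\subseteq \mathrm{SL}(N)$. Theorem. Let $m,n\ge 0$ be integers. The following subgroups are closed and parabolically connected: (1) $\mathrm{SL}(m)\times\mathrm{SL}(n)\subset\mathrm{SL}(m+n)$ (block-diagonal matrices with both blocks of determinant $1$), for all $m,n$; (2) $\mathrm{S}(\mathrm{GL}(m)\times\mathrm{GL}(n))\subset\mathrm{SL}(m+n)$ (all block-diagonal matrices of determinant $1$ with blocks of sizes $m$ and $n$), for $m\neq n$; (3) $\mathrm{Sp}(2n)\subset\mathrm{SL}(2n)$, for all $n$; (4) $\mathrm{Sp}(2n)\subset\mathrm{SL}(2n+1)$, embedded by $A\mapsto\mathrm{diag}(A,1)$, for all $n$; (5) $\mathrm{Sp}(2n)\times \mathrm{T}^1\subset\mathrm{SL}(2n+1)$,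 i.e. the image of $(A,t)\mapsto\mathrm{diag}(tA,t^{-2n})$ for $A\in\mathrm{Sp}(2n)$, $t\in\mathbb{C}^\times$, for all $n$. In contrast, the following closed subgroups are not parabolically connected: (6) $\mathrm{SO}(n)\subset\mathrm{SL}(n)$ (the matrices preserving the standard symmetric bilinear form), for $n\ge 2$; (7) $\mathrm{S}(\mathrm{GL}(n)\times\mathrm{GL}(n))\subset\mathrm{SL}(2n)$, for $n\ge 1$. Moreover, for every $N\ge0$, a closed subgroup $H\subset\mathrm{SL}(N)$ is parabolically connected if and only if $B\cap H$ is connected for every Borel subgroup $B\subset\mathrm{SL}(N)$. -/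

import Mathlib

open Matrix Topology

namespace ParabolicConn

/-- The group `SL(ι)` of complex `ι × ι` matrices of determinant one; `SL(n)` is the case
where `ι` has `n` elements. -/
abbrev SL (ι : Type) [Fintype ι] [DecidableEq ι] : Type :=
  Matrix.SpecialLinearGroup ι ℂ

section Zariski

variable {ι : Type} [Fintype ι] [DecidableEq ι]

/-- The set of matrices in `SL(ι)` at which all polynomials of `I`, in the matrix entries as
variables, vanish. -/
def zeroSet (I : Set (MvPolynomial (ι × ι) ℂ)) : Set (SL ι) :=
  {g | ∀ p ∈ I, MvPolynomial.eval (fun ij : ι × ι => (g : Matrix ι ι ℂ) ij.1 ij.2) p = 0}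

variable (ι) in
/-- The Zariski topology on `SL(ι)`: closed sets are the sets of common zeros of polynomials in the
matrix entries. -/
@[reducible] def zariski : TopologicalSpace (SL ι) :=
  TopologicalSpace.ofClosed {Z | ∃ I, Z = zeroSet I}
    ⟨{1}, by ext g; simp [zeroSet]⟩
    (by
      intro A hA
      refine ⟨{p | ∃ I, zeroSet I ∈ A ∧ p ∈ I}, ?_⟩
      ext g
      constructor
      · rintro hg p ⟨I, hI, hp⟩
        exact hg _ hI p hp
      · intro hg Z hZ
        obtain ⟨I, rfl⟩ := hA hZ
        exact fun p hp => hg p ⟨I, hZ, hp⟩)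
    (by
      rintro _ ⟨I, rfl⟩ _ ⟨K, rfl⟩
      refine ⟨{r | ∃ p ∈ I, ∃ q ∈ K, r = p * q}, ?_⟩
      ext g
      constructor
      · rintro (hg | hg) r ⟨p, hp, q, hq, rfl⟩
        · rw [map_mul, hg p hp, zero_mul]
        · rw [map_mul, hg q hq, mul_zero]
      · intro hg
        by_contra hcon
        simp only [zeroSet, Set.mem_union, Set.mem_ofPred_eq, not_or, not_forall] at hcon
        obtain ⟨⟨p, hp, hp0⟩, q, hq, hq0⟩ := hcon
        have h := hg _ ⟨p, hp, q, hq, rfl⟩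
        rw [map_mul] at h
        exact (mul_ne_zero hp0 hq0) h)

/-- The subgroup is closed in the Zariski topology. -/
def IsClosedSubgroup (H : Subgroup (SL ι)) : Prop :=
  IsClosed[zariski ι] (H : Set (SL ι))

/-- The subgroup is connected in the Zariski topology. -/
def IsConnectedSubgroup (H : Subgroup (SL ι)) : Prop :=
  @IsConnected (SL ι) (zariski ι) (H : Set (SL ι))

/-- A Borel subgroup of `SL(ι)`: a maximal closed connected solvable subgroup. -/
def IsBorel (B : Subgroup (SL ι)) : Prop :=
  Maximal (fun K : Subgroup (SL ι) =>
    IsClosedSubgroup K ∧ IsConnectedSubgroup K ∧ Group.IsSolvable K) B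

/-- A parabolic subgroup of `SL(ι)`: a closed subgroup that contains a Borel subgroup. -/
def IsParabolic (P : Subgroup (SL ι)) : Prop :=
  IsClosedSubgroup P ∧ ∃ B : Subgroup (SL ι), IsBorel B ∧ B ≤ P

/-- A closed subgroup `H` of `SL(ι)` is parabolically connected if `P ∩ H` is connected for every
parabolic subgroup `P`. (Closedness of `H` is always asserted or assumed separately.) -/
def IsParabolicallyConnected (H : Subgroup (SL ι)) : Prop :=
  ∀ P : Subgroup (SL ι), IsParabolic P → IsConnectedSubgroup (P ⊓ H)

end Zariski

section BlockDiagonal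

variable (α β : Type) [Fintype α] [DecidableEq α] [Fintype β] [DecidableEq β]

/-- The embedding `SL(α) × SL(β) → SL(α ⊕ β)`, `(A, B) ↦ diag(A, B)`. -/
def blockDiagSL : SL α × SL β →* SL (α ⊕ β) where
  toFun x := ⟨fromBlocks (x.1 : Matrix α α ℂ) 0 0 (x.2 : Matrix β β ℂ), by simp⟩
  map_one' := by ext i j; simp
  map_mul' x y := by
    refine Subtype.ext (Eq.trans ?_ (fromBlocks_multiply _ _ _ _ _ _ _ _).symm)
    simp

/-- The homomorphism of multiplicative monoids `(A, B) ↦ diag(A, B)` on matrices. -/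
def blockDiagMatrix : Matrix α α ℂ × Matrix β β ℂ →* Matrix (α ⊕ β) (α ⊕ β) ℂ where
  toFun x := fromBlocks x.1 0 0 x.2
  map_one' := by simp
  map_mul' x y := by simp [fromBlocks_multiply]

/-- The embedding `GL(α) × GL(β) → GL(α ⊕ β)`, `(A, B) ↦ diag(A, B)`. -/
def blockDiagGL : GL α ℂ × GL β ℂ →* GL (α ⊕ β) ℂ :=
  (Units.map (blockDiagMatrix α β)).comp MulEquiv.prodUnits.symm.toMonoidHom

end BlockDiagonal

/-- `SL(m) × SL(n) ⊂ SL(m + n)`. -/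
def SLxSL (m n : ℕ) : Subgroup (SL (Fin m ⊕ Fin n)) :=
  (blockDiagSL (Fin m) (Fin n)).range

/-- `S(GL(m) × GL(n)) ⊂ SL(m + n)`: the elements of `SL(m + n)` that lie in `GL(m) × GL(n)`. -/
def SGLxGL (m n : ℕ) : Subgroup (SL (Fin m ⊕ Fin n)) :=
  (blockDiagGL (Fin m) (Fin n)).range.comap Matrix.SpecialLinearGroup.toGL

/-- `Sp(2n) ⊂ SL(2n)`: the matrices preserving the standard symplectic form. -/
def Sp (n : ℕ) : Subgroup (SL (Fin n ⊕ Fin n)) where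
  carrier := {g | (g : Matrix (Fin n ⊕ Fin n) (Fin n ⊕ Fin n) ℂ) ∈ symplecticGroup (Fin n) ℂ}
  one_mem' := one_mem (symplecticGroup (Fin n) ℂ)
  mul_mem' hg hh := Submonoid.mul_mem (symplecticGroup (Fin n) ℂ) hg hh
  inv_mem' {g} hg := by
    have hk : g.1 * (g⁻¹).1 = 1 := congrArg Subtype.val (mul_inv_cancel g)
    have h : (g⁻¹).1 = ((⟨g.1, hg⟩⁻¹ : symplecticGroup (Fin n) ℂ) :
        Matrix (Fin n ⊕ Fin n) (Fin n ⊕ Fin n) ℂ) := by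
      rw [SymplecticGroup.coe_inv']
      exact (inv_eq_right_inv hk).symm
    change (g⁻¹).1 ∈ symplecticGroup (Fin n) ℂ
    rw [h]
    exact Subtype.property _

/-- The index type of `SL(2n + 1)`, adapted to `ℂ^(2n + 1) = ℂ^(2n) ⊕ ℂ`. -/
abbrev OddIdx (n : ℕ) : Type := (Fin n ⊕ Fin n) ⊕ Fin 1

/-- The embedding `SL(2n) → SL(2n + 1)`, `A ↦ diag(A, 1)`. -/
def embedOdd (n : ℕ) : SL (Fin n ⊕ Fin n) →* SL (OddIdx n) :=
  (blockDiagSL (Fin n ⊕ Fin n) (Fin 1)).comp (MonoidHom.inl _ _)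

/-- `Sp(2n) ⊂ SL(2n + 1)`. -/
def SpOdd (n : ℕ) : Subgroup (SL (OddIdx n)) :=
  (Sp n).map (embedOdd n)

/-- The homomorphism `Sp(2n) × T¹ → SL(2n + 1)`, `(A, t) ↦ diag(t A, t⁻²ⁿ)`. -/
def spTorusHom (n : ℕ) : Sp n × ℂˣ →* SL (OddIdx n) where
  toFun x := ⟨fromBlocks
      ((x.2 : ℂ) • ((x.1 : SL (Fin n ⊕ Fin n)) : Matrix (Fin n ⊕ Fin n) (Fin n ⊕ Fin n) ℂ)) 0 0
      ((((x.2⁻¹ : ℂˣ) : ℂ) ^ (2 * n)) • (1 : Matrix (Fin 1) (Fin 1) ℂ)), by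
    have hdet : det ((x.1 : SL (Fin n ⊕ Fin n)) : Matrix (Fin n ⊕ Fin n) (Fin n ⊕ Fin n) ℂ) = 1 :=
      (x.1 : SL (Fin n ⊕ Fin n)).2
    rw [det_fromBlocks_zero₂₁, det_smul, det_smul, hdet]
    simp [← two_mul]⟩
  map_one' := by
    apply Subtype.ext
    simp
  map_mul' x y := by
    refine Subtype.ext (Eq.trans ?_ (fromBlocks_multiply _ _ _ _ _ _ _ _).symm)
    simp [smul_smul, mul_pow, mul_comm]

/-- `Sp(2n) × T¹ ⊂ SL(2n + 1)`. -/
def SpTorus (n : ℕ) : Subgroup (SL (OddIdx n)) :=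
  (spTorusHom n).range

/-- `SO(n) ⊂ SL(n)`: the matrices preserving the standard symmetric bilinear form. -/
def SO (n : ℕ) : Subgroup (SL (Fin n)) where
  carrier := {g | (g : Matrix (Fin n) (Fin n) ℂ)ᵀ * (g : Matrix (Fin n) (Fin n) ℂ) = 1}
  one_mem' := by
    change (1 : Matrix (Fin n) (Fin n) ℂ)ᵀ * 1 = 1
    simp
  mul_mem' {g h} hg hh := by
    change g.1ᵀ * g.1 = 1 at hg
    change h.1ᵀ * h.1 = 1 at hh
    change (g.1 * h.1)ᵀ * (g.1 * h.1) = 1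
    rw [transpose_mul, Matrix.mul_assoc, ← Matrix.mul_assoc _ g.1 h.1, hg, Matrix.one_mul, hh]
  inv_mem' {g} hg := by
    change g.1ᵀ * g.1 = 1 at hg
    have h1 : g.1 * (g⁻¹).1 = 1 := congrArg Subtype.val (mul_inv_cancel g)
    have h2 : (g⁻¹).1 = g.1ᵀ := (left_inv_eq_right_inv hg h1).symm
    change (g⁻¹).1ᵀ * (g⁻¹).1 = 1
    rw [h2, transpose_transpose, ← h2, h1]

end ParabolicConn

/-!
The Borel subgroups of `SL(ι)` are the conjugates `conjTri b q` of the upper triangular group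
(`isBorel_conjTri`, `IsBorel.exists_eq_conjTri`): by the Lie–Kolchin theorem, in the relative form
`exists_stable_line_mod`, a connected solvable subgroup stabilizes a complete flag.

An element of a parabolic subgroup `P` lies in a Borel subgroup contained in `P`
(`IsParabolic.exists_isBorel_mem`). A subgroup all of whose elements are joined to the identity by
connected subsets is connected (`isConnectedSubgroup_iff`), so that it suffices to consider Borel
subgroups (`isParabolicallyConnected_iff`). By the description of these, `H` is parabolically
connected as soon as every element of `H` that stabilizes a flag `F` is joined to the identity
within the stabilizer of `F` in `H` (`isParabolicallyConnected_of_flags`). The joining sets are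
rational curves `t ↦ M t` with `M` defined off a finite set of parameters (`JoinedToOne.of_curve`).

For block-diagonal groups the stabilizer of `F` in the algebra `Mat(m) × Mat(n)` is again an
algebra, `pairAlg F`, and a segment from `1` to `x` in it is an admissible curve up to the
determinants of the blocks. These are corrected by the tori of the idempotents of rank `(1, 0)`,
`(0, 1)` or `(1, 1)` which `exists_isAtom` finds below each idempotent of `pairAlg F`. If `m ≠ n`,
an idempotent of the first two kinds exists; if none exists, the two blocks of every element have
the same characteristic polynomial (`charpoly_eq_of_no_atoms`).

For the symplectic group the segment is replaced by the Cayley transform, which is available for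
elements without the eigenvalue `-1`. The generalized eigenspace of `-1` is split off by a
selfadjoint idempotent `p` preserving `F`, and `exists_sympAdj_eq_neg` provides an element `X` of the
symplectic Lie algebra with `X² = p` preserving `F`; the one-parameter group that it generates
contains `1 - 2p`, and hence reduces `joinedToOne_symplectic` to the Cayley transform. A flag in
`ℂ^(2n) ⊕ ℂ` amounts to its projection to `ℂ^(2n)` together with a functional `ω(·, z)` on one member
(`exists_diag_mem_flagAlg_iff`). The vector `z` can be respected in all constructions, and `X` can
be chosen to have `z` as an eigenvector, which takes care of the embeddings in odd dimension.

In the two negative cases, a parabolic subgroup `P` is the stabilizer of a line or of the diagonal,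
and a regular function takes exactly the values `±1` on `P ∩ H`.
-/

namespace ParabolicConn

/-! ### Functions with values in a subalgebra: matrix operations -/

section MatrixFunctions

variable {X : Type*} {ι : Type*} [Fintype ι] [DecidableEq ι] (S : Subalgebra ℂ (X → ℂ))

/-- The matrix-valued functions all of whose entries belong to a given algebra of functions. -/
def MatMem {ι κ : Type*} (M : X → Matrix ι κ ℂ) : Prop :=
  ∀ i j, (fun x => M x i j) ∈ S

variable {S}

theorem MatMem.const {ι κ : Type*} (A : Matrix ι κ ℂ) : MatMem S (fun _ => A) :=
  fun i j => S.algebraMap_mem (A i j)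

theorem MatMem.add {ι κ : Type*} {M N : X → Matrix ι κ ℂ} (hM : MatMem S M) (hN : MatMem S N) :
    MatMem S (fun x => M x + N x) :=
  fun i j => S.add_mem (hM i j) (hN i j)

theorem MatMem.sub {ι κ : Type*} {M N : X → Matrix ι κ ℂ} (hM : MatMem S M) (hN : MatMem S N) :
    MatMem S (fun x => M x - N x) :=
  fun i j => S.sub_mem (hM i j) (hN i j)

theorem MatMem.smul {ι κ : Type*} {f : X → ℂ} {M : X → Matrix ι κ ℂ} (hf : f ∈ S)
    (hM : MatMem S M) : MatMem S (fun x => f x • M x) :=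
  fun i j => S.mul_mem hf (hM i j)

theorem MatMem.smul_const {ι κ : Type*} {f : X → ℂ} (hf : f ∈ S) (A : Matrix ι κ ℂ) :
    MatMem S (fun x => f x • A) :=
  MatMem.smul hf (MatMem.const A)

omit [DecidableEq ι] in
theorem MatMem.mul {κ κ' : Type*} {M : X → Matrix κ ι ℂ} {N : X → Matrix ι κ' ℂ}
    (hM : MatMem S M) (hN : MatMem S N) : MatMem S (fun x => M x * N x) := by
  intro i j
  have : (fun x => (M x * N x) i j) = ∑ k, (fun x => M x i k) * (fun x => N x k j) := by
    ext x; simp [Matrix.mul_apply]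
  rw [this]
  exact S.sum_mem fun k _ => S.mul_mem (hM i k) (hN k j)

theorem MatMem.det {M : X → Matrix ι ι ℂ} (hM : MatMem S M) : (fun x => (M x).det) ∈ S := by
  have : (fun x => (M x).det) =
      ∑ σ : Equiv.Perm ι, ((σ.sign : ℤ) : ℂ) • ∏ i, fun x => M x (σ i) i := by
    ext x; simp [Matrix.det_apply']
  rw [this]
  exact S.sum_mem fun σ _ => S.smul_mem (S.prod_mem fun i _ => hM _ _) _

theorem MatMem.adjugate {M : X → Matrix ι ι ℂ} (hM : MatMem S M) :
    MatMem S (fun x => (M x).adjugate) := by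
  intro i j
  simp only [adjugate_apply]
  refine MatMem.det (M := fun x => (M x).updateRow j (Pi.single i 1)) fun k l => ?_
  by_cases h : k = j
  · subst h
    simp only [updateRow_self]
    exact S.algebraMap_mem ((Pi.single i 1 : ι → ℂ) l)
  · simpa [updateRow_apply, h] using hM k l

theorem MatMem.inv {M : X → Matrix ι ι ℂ} (hM : MatMem S M)
    (hd : (fun x => ((M x).det)⁻¹) ∈ S) : MatMem S (fun x => (M x)⁻¹) := by
  have : (fun x => (M x)⁻¹) = fun x => ((M x).det)⁻¹ • (M x).adjugate := by
    ext x; simp [Matrix.inv_def]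
  rw [this]
  exact hM.adjugate.smul hd

theorem MatMem.fromBlocks {α β : Type*} {A : X → Matrix α α ℂ} {D : X → Matrix β β ℂ}
    (hA : MatMem S A) (hD : MatMem S D) :
    MatMem S (fun x => Matrix.fromBlocks (A x) 0 0 (D x)) := by
  rintro (i | i) (j | j)
  · exact hA i j
  · exact S.zero_mem
  · exact S.zero_mem
  · exact hD i j

omit [Fintype ι] [DecidableEq ι] in
theorem MatMem.eval {M : X → Matrix ι ι ℂ} (hM : MatMem S M) (p : MvPolynomial (ι × ι) ℂ) :
    (fun x => MvPolynomial.eval (fun ij : ι × ι => M x ij.1 ij.2) p) ∈ S := by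
  induction p using MvPolynomial.induction_on with
  | C a => simp only [MvPolynomial.eval_C]; exact S.algebraMap_mem a
  | add p q hp hq => simp only [map_add]; exact S.add_mem hp hq
  | mul_X p i hp => simp only [map_mul, MvPolynomial.eval_X]; exact S.mul_mem hp (hM i.1 i.2)

end MatrixFunctions

/-! ### The Zariski topology -/

section ZariskiBasics

variable {ι : Type} [Fintype ι] [DecidableEq ι]

/-- Closedness in the Zariski topology. -/
abbrev ZClosed (Z : Set (SL ι)) : Prop := IsClosed[zariski ι] Z

/-- Preconnectedness in the Zariski topology. -/
abbrev ZPreconnected (Z : Set (SL ι)) : Prop := @IsPreconnected (SL ι) (zariski ι) Z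

variable (ι) in
/-- The algebra of polynomial functions on `SL(ι)`. -/
noncomputable def polyFun : Subalgebra ℂ (SL ι → ℂ) :=
  (MvPolynomial.aeval fun (ij : ι × ι) (g : SL ι) => (g : Matrix ι ι ℂ) ij.1 ij.2).range

theorem aeval_entry_apply (p : MvPolynomial (ι × ι) ℂ) (g : SL ι) :
    MvPolynomial.aeval (fun (ij : ι × ι) (g : SL ι) => (g : Matrix ι ι ℂ) ij.1 ij.2) p g =
      MvPolynomial.eval (fun ij : ι × ι => (g : Matrix ι ι ℂ) ij.1 ij.2) p := by
  induction p using MvPolynomial.induction_on with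
  | C a => simp
  | add p q hp hq => simp [hp, hq]
  | mul_X p i hp => simp [hp]

theorem mem_polyFun {f : SL ι → ℂ} : f ∈ polyFun ι ↔ ∃ p : MvPolynomial (ι × ι) ℂ,
    ∀ g : SL ι, MvPolynomial.eval (fun ij : ι × ι => (g : Matrix ι ι ℂ) ij.1 ij.2) p = f g := by
  constructor
  · rintro ⟨p, rfl⟩
    exact ⟨p, fun g => (aeval_entry_apply p g).symm⟩
  · rintro ⟨p, hp⟩
    exact ⟨p, funext fun g => (aeval_entry_apply p g).trans (hp g)⟩

theorem matMem_coe : MatMem (polyFun ι) (fun g : SL ι => (g : Matrix ι ι ℂ)) := fun i j =>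
  mem_polyFun.2 ⟨MvPolynomial.X (i, j), fun g => by simp⟩

theorem matMem_coe_inv :
    MatMem (polyFun ι) (fun g : SL ι => ((g⁻¹ : SL ι) : Matrix ι ι ℂ)) :=
  matMem_coe.adjugate

theorem zClosed_iff {Z : Set (SL ι)} : ZClosed Z ↔ ∃ I, Z = zeroSet I := by
  constructor
  · rintro ⟨h⟩
    have h' : Zᶜᶜ ∈ {Z | ∃ I, Z = zeroSet (ι := ι) I} := h
    rwa [compl_compl] at h'
  · intro h
    refine @IsClosed.mk _ (zariski ι) _ ?_
    change Zᶜᶜ ∈ {Z | ∃ I, Z = zeroSet (ι := ι) I}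
    rwa [compl_compl]

theorem zClosed_eq {f : SL ι → ℂ} (hf : f ∈ polyFun ι) (c : ℂ) : ZClosed {g | f g = c} := by
  obtain ⟨p, hp⟩ := mem_polyFun.1 hf
  refine zClosed_iff.2 ⟨{p - MvPolynomial.C c}, ?_⟩
  ext g
  simp [zeroSet, hp, sub_eq_zero]

theorem zClosed_iInter {α : Sort*} {Z : α → Set (SL ι)} (h : ∀ a, ZClosed (Z a)) :
    ZClosed (⋂ a, Z a) :=
  @isClosed_iInter _ _ (zariski ι) _ h

theorem zClosed_inter {Z Z' : Set (SL ι)} (h : ZClosed Z) (h' : ZClosed Z') : ZClosed (Z ∩ Z') :=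
  @IsClosed.inter _ _ _ (zariski ι) h h'

theorem zClosed_forall {α : Sort*} {p : α → SL ι → Prop} (h : ∀ a, ZClosed {g | p a g}) :
    ZClosed {g | ∀ a, p a g} := by
  have := zClosed_iInter h
  convert this using 1
  ext g; simp

/-- Equality of two matrices of polynomial functions is a closed condition. -/
theorem zClosed_matEq {α β : Type*} {M N : SL ι → Matrix α β ℂ} (hM : MatMem (polyFun ι) M)
    (hN : MatMem (polyFun ι) N) : ZClosed {g | M g = N g} := by
  have : {g | M g = N g} = {g | ∀ i j, M g i j - N g i j = 0} := by
    ext g; simp [← Matrix.ext_iff, sub_eq_zero]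
  rw [this]
  exact zClosed_forall fun i => zClosed_forall fun j =>
    zClosed_eq ((polyFun ι).sub_mem (hM i j) (hN i j)) 0

/-- A map between special linear groups whose matrix entries are polynomial functions is continuous
for the Zariski topologies. -/
theorem zContinuous {κ : Type} [Fintype κ] [DecidableEq κ] {φ : SL ι → SL κ}
    (h : MatMem (polyFun ι) (fun g => (φ g : Matrix κ κ ℂ))) :
    @Continuous _ _ (zariski ι) (zariski κ) φ := by
  refine (@continuous_iff_isClosed _ _ (zariski ι) (zariski κ) _).2 fun Z hZ => ?_
  obtain ⟨I, rfl⟩ := zClosed_iff.1 hZ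
  have : φ ⁻¹' zeroSet I = {g | ∀ p : I, MvPolynomial.eval
      (fun ij : κ × κ => (φ g : Matrix κ κ ℂ) ij.1 ij.2) p.1 = 0} := by
    ext g; simp [zeroSet]
  rw [this]
  exact zClosed_forall fun p => zClosed_eq (h.eval p.1) 0

theorem zContinuous_mul_left (a : SL ι) :
    @Continuous _ _ (zariski ι) (zariski ι) (fun g => a * g) :=
  zContinuous (by simpa using (MatMem.const (a : Matrix ι ι ℂ)).mul matMem_coe)

theorem ZPreconnected.image {κ : Type} [Fintype κ] [DecidableEq κ] {φ : SL ι → SL κ}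
    {Z : Set (SL ι)} (hZ : ZPreconnected Z) (h : @Continuous _ _ (zariski ι) (zariski κ) φ) :
    ZPreconnected (φ '' Z) :=
  @IsPreconnected.image _ _ (zariski ι) (zariski κ) _ hZ _ (@Continuous.continuousOn _ _
    (zariski ι) (zariski κ) _ _ h)

theorem ZPreconnected.union {Z Z' : Set (SL ι)} (g : SL ι) (hg : g ∈ Z) (hg' : g ∈ Z')
    (h : ZPreconnected Z) (h' : ZPreconnected Z') : ZPreconnected (Z ∪ Z') :=
  @IsPreconnected.union _ (zariski ι) _ _ _ hg hg' h h'

/-- A polynomial function with finitely many values on a preconnected set is constant there. -/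
theorem ZPreconnected.constant {Z : Set (SL ι)} (hZ : ZPreconnected Z) {f : SL ι → ℂ}
    (hf : f ∈ polyFun ι) (hfin : (f '' Z).Finite) {x y : SL ι} (hx : x ∈ Z) (hy : y ∈ Z) :
    f x = f y := by
  by_contra hne
  have h1 : ZClosed {g | f g = f x} := zClosed_eq hf _
  have h2 : ZClosed (⋃ c ∈ (f '' Z) \ {f x}, {g | f g = c}) :=
    @Set.Finite.isClosed_biUnion _ _ (zariski ι) _ _ (hfin.subset Set.sdiff_subset)
      fun c _ => zClosed_eq hf c
  obtain ⟨z, hz, hz1, hz2⟩ := (@isPreconnected_closed_iff _ (zariski ι) _).1 hZ _ _ h1 h2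
    (by
      intro z hz
      by_cases h : f z = f x
      · exact Or.inl h
      · refine Or.inr ?_
        simp only [Set.mem_iUnion]
        exact ⟨f z, ⟨⟨z, hz, rfl⟩, h⟩, rfl⟩)
    ⟨x, hx, rfl⟩
    ⟨y, hy, by
      simp only [Set.mem_iUnion]
      exact ⟨f y, ⟨⟨y, hy, rfl⟩, fun h => hne (Eq.symm h)⟩, rfl⟩⟩
  simp only [Set.mem_iUnion] at hz2
  obtain ⟨c, ⟨_, hc⟩, rfl⟩ := hz2
  exact hc hz1

/-- `x` can be joined to the identity inside `S`: a preconnected subset of `S` contains both. -/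
def JoinedToOne (S : Set (SL ι)) (x : SL ι) : Prop :=
  ∃ C ⊆ S, ZPreconnected C ∧ 1 ∈ C ∧ x ∈ C

theorem JoinedToOne.mono {S T : Set (SL ι)} (h : S ⊆ T) {x : SL ι} (hx : JoinedToOne S x) :
    JoinedToOne T x :=
  let ⟨C, hC, h'⟩ := hx
  ⟨C, hC.trans h, h'⟩

theorem JoinedToOne.mul {H : Subgroup (SL ι)} {x y : SL ι}
    (hx : JoinedToOne (H : Set (SL ι)) x) (hy : JoinedToOne (H : Set (SL ι)) y) :
    JoinedToOne (H : Set (SL ι)) (x * y) := by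
  obtain ⟨C, hCH, hC, h1, hxC⟩ := hx
  obtain ⟨D, hDH, hD, h1', hyD⟩ := hy
  refine ⟨C ∪ (fun g => x * g) '' D, ?_, ?_, Or.inl h1, Or.inr ⟨y, hyD, rfl⟩⟩
  · rintro _ (h | ⟨d, hd, rfl⟩)
    · exact hCH h
    · exact H.mul_mem (hCH hxC) (hDH hd)
  · exact hC.union x hxC ⟨1, h1', mul_one x⟩ (hD.image (zContinuous_mul_left x))

theorem JoinedToOne.inv {H : Subgroup (SL ι)} {x : SL ι}
    (hx : JoinedToOne (H : Set (SL ι)) x) : JoinedToOne (H : Set (SL ι)) x⁻¹ := by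
  obtain ⟨C, hCH, hC, h1, hxC⟩ := hx
  refine ⟨(fun g => x⁻¹ * g) '' C, ?_, hC.image (zContinuous_mul_left _), ⟨x, hxC, by simp⟩,
    ⟨1, h1, by simp⟩⟩
  rintro _ ⟨d, hd, rfl⟩
  exact H.mul_mem (H.inv_mem (hCH hxC)) (hCH hd)

theorem isConnectedSubgroup_iff {H : Subgroup (SL ι)} :
    IsConnectedSubgroup H ↔ ∀ x ∈ H, JoinedToOne (H : Set (SL ι)) x := by
  constructor
  · intro h x hx
    exact ⟨H, subset_rfl, h.2, H.one_mem, hx⟩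
  · intro h
    refine ⟨⟨1, H.one_mem⟩, ?_⟩
    refine @isPreconnected_of_forall _ (zariski ι) _ 1 fun x hx => ?_
    obtain ⟨C, hC, hC', h1, h2⟩ := h x hx
    exact ⟨C, hC, h1, h2, hC'⟩

end ZariskiBasics

/-! ### Rational curves -/

section Curves

/-- The functions `ℂ → ℂ` that on `D` are a quotient of two polynomials, the denominator without
zeros on `D`. -/
def regOn (D : Set ℂ) : Subalgebra ℂ (ℂ → ℂ) where
  carrier := {f | ∃ p q : Polynomial ℂ, ∀ t ∈ D, q.eval t ≠ 0 ∧ f t * q.eval t = p.eval t}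
  mul_mem' := by
    rintro f f' ⟨p, q, h⟩ ⟨p', q', h'⟩
    refine ⟨p * p', q * q', fun t ht => ⟨?_, ?_⟩⟩
    · simpa using ⟨(h t ht).1, (h' t ht).1⟩
    · simp only [Pi.mul_apply, Polynomial.eval_mul, ← (h t ht).2, ← (h' t ht).2]
      ring
  add_mem' := by
    rintro f f' ⟨p, q, h⟩ ⟨p', q', h'⟩
    refine ⟨p * q' + p' * q, q * q', fun t ht => ⟨?_, ?_⟩⟩
    · simpa using ⟨(h t ht).1, (h' t ht).1⟩
    · simp only [Pi.add_apply, Polynomial.eval_add, Polynomial.eval_mul, ← (h t ht).2,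
        ← (h' t ht).2]
      ring
  algebraMap_mem' c := ⟨Polynomial.C c, 1, fun t _ => by simp⟩

variable {D : Set ℂ}

theorem eval_mem_regOn (p : Polynomial ℂ) : (fun t => p.eval t) ∈ regOn D :=
  ⟨p, 1, fun t _ => by simp⟩

theorem id_mem_regOn : (fun t : ℂ => t) ∈ regOn D := by
  simpa using eval_mem_regOn (D := D) Polynomial.X

theorem inv_mem_regOn {f : ℂ → ℂ} (hf : f ∈ regOn D) (h0 : ∀ t ∈ D, f t ≠ 0) :
    (fun t => (f t)⁻¹) ∈ regOn D := by
  obtain ⟨p, q, h⟩ := hf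
  refine ⟨q, p, fun t ht => ⟨?_, ?_⟩⟩
  · rw [← (h t ht).2]
    exact mul_ne_zero (h0 t ht) (h t ht).1
  · rw [← (h t ht).2, ← mul_assoc, inv_mul_cancel₀ (h0 t ht), one_mul]

/-- A regular function on `D` that does not vanish identically has cofinitely many nonzeros. -/
theorem infinite_ne_zero_of_regOn (hD : Dᶜ.Finite) {f : ℂ → ℂ} (hf : f ∈ regOn D)
    (h0 : ∃ t ∈ D, f t ≠ 0) : {t | t ∈ D ∧ f t ≠ 0}ᶜ.Finite := by
  obtain ⟨p, q, h⟩ := hf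
  have hp : p ≠ 0 := by
    rintro rfl
    obtain ⟨t, ht, ht'⟩ := h0
    have := (h t ht).2
    simp [ht', (h t ht).1] at this
  refine (hD.union (p.rootSet_finite ℂ)).subset fun t ht => ?_
  by_cases htD : t ∈ D
  · right
    have : f t = 0 := by
      by_contra h'
      exact ht ⟨htD, h'⟩
    rw [Polynomial.mem_rootSet]
    refine ⟨hp, ?_⟩
    simp [← (h t htD).2, this]
  · exact Or.inl htD

variable {ι : Type} [Fintype ι] [DecidableEq ι]

/-- A rational curve in `SL(ι)`, parametrised by an infinite set of complex numbers, is
preconnected: two polynomials which do not vanish identically on it have a product which does not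
vanish identically on it. -/
theorem zPreconnected_curve (hD : D.Infinite) {M : ℂ → Matrix ι ι ℂ} (hM : MatMem (regOn D) M)
    (hdet : ∀ t ∈ D, (M t).det = 1) :
    ZPreconnected {g : SL ι | ∃ t ∈ D, (g : Matrix ι ι ℂ) = M t} := by
  refine (@isPreconnected_closed_iff _ (zariski ι) _).2 ?_
  intro Z Z' hZ hZ' hcov hne hne'
  obtain ⟨I, rfl⟩ := zClosed_iff.1 hZ
  obtain ⟨I', rfl⟩ := zClosed_iff.1 hZ'
  have hkey : (∀ t ∈ D, ∀ p ∈ I, MvPolynomial.eval (fun ij : ι × ι => M t ij.1 ij.2) p = 0) ∨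
      (∀ t ∈ D, ∀ p ∈ I', MvPolynomial.eval (fun ij : ι × ι => M t ij.1 ij.2) p = 0) := by
    by_contra hcon
    push Not at hcon
    obtain ⟨⟨t, ht, p, hp, hpt⟩, ⟨t', ht', p', hp', hpt'⟩⟩ := hcon
    obtain ⟨a, b, hab⟩ := hM.eval p
    obtain ⟨a', b', hab'⟩ := hM.eval p'
    have hzero : a * a' = 0 := by
      refine Polynomial.eq_zero_of_infinite_isRoot _ (hD.mono fun s hs => ?_)
      change Polynomial.IsRoot _ _
      rw [Polynomial.IsRoot, Polynomial.eval_mul, ← (hab s hs).2, ← (hab' s hs).2]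
      have hs' : (⟨M s, hdet s hs⟩ : SL ι) ∈ {g : SL ι | ∃ t ∈ D, (g : Matrix ι ι ℂ) = M t} :=
        ⟨s, hs, rfl⟩
      rcases hcov hs' with h | h
      · have := h p hp
        simp only at this ⊢
        rw [this]; ring
      · have := h p' hp'
        simp only at this ⊢
        rw [this]; ring
    rcases mul_eq_zero.1 hzero with h | h
    · have := (hab t ht).2
      rw [h, Polynomial.eval_zero] at this
      exact (mul_ne_zero hpt (hab t ht).1) this
    · have := (hab' t' ht').2
      rw [h, Polynomial.eval_zero] at this
      exact (mul_ne_zero hpt' (hab' t' ht').1) this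
  rcases hkey with h | h
  · obtain ⟨g, hg, hg'⟩ := hne'
    refine ⟨g, hg, ?_, hg'⟩
    obtain ⟨t, ht, htg⟩ := hg
    intro p hp
    rw [htg]
    exact h t ht p hp
  · obtain ⟨g, hg, hg'⟩ := hne
    refine ⟨g, hg, hg', ?_⟩
    obtain ⟨t, ht, htg⟩ := hg
    intro p hp
    rw [htg]
    exact h t ht p hp

theorem infinite_of_compl_finite {D : Set ℂ} (hD : Dᶜ.Finite) : D.Infinite := by
  simpa using hD.infinite_compl

/-- A point of a rational curve through the identity is joined to the identity. -/
theorem JoinedToOne.of_curve {S : Set (SL ι)} {x : SL ι} (hD : Dᶜ.Finite)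
    {M : ℂ → Matrix ι ι ℂ} (hM : MatMem (regOn D) M) (hdet : ∀ t ∈ D, (M t).det = 1)
    (hS : ∀ t ∈ D, ∀ g : SL ι, (g : Matrix ι ι ℂ) = M t → g ∈ S)
    {s t : ℂ} (hs : s ∈ D) (hs1 : M s = 1) (ht : t ∈ D) (htx : M t = x) : JoinedToOne S x := by
  refine ⟨{g : SL ι | ∃ t ∈ D, (g : Matrix ι ι ℂ) = M t}, ?_,
    zPreconnected_curve (infinite_of_compl_finite hD) hM hdet, ⟨s, hs, ?_⟩, ⟨t, ht, htx.symm⟩⟩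
  · rintro g ⟨t, ht, h⟩
    exact hS t ht g h
  · simp [hs1]

end Curves

/-! ### The Lie–Kolchin theorem -/

open scoped commutatorElement

section LieKolchin

variable {ι : Type} [Fintype ι] [DecidableEq ι]

theorem MatMem.apply_mulVec {X : Type*} {S : Subalgebra ℂ (X → ℂ)} {M : X → Matrix ι ι ℂ}
    (hM : MatMem S M) (φ : (ι → ℂ) →ₗ[ℂ] ℂ) (v : ι → ℂ) : (fun x => φ (M x *ᵥ v)) ∈ S := by
  have : (fun x => φ (M x *ᵥ v)) =
      ∑ i, ∑ j, (φ (Pi.single i 1) * v j) • fun x => M x i j := by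
    ext x
    rw [LinearMap.pi_apply_eq_sum_univ φ (M x *ᵥ v)]
    simp only [Finset.sum_apply, Pi.smul_apply, smul_eq_mul, mulVec, dotProduct, Finset.sum_mul]
    refine Finset.sum_congr rfl fun i _ => Finset.sum_congr rfl fun j _ => ?_
    rw [show (fun k => if i = k then (1 : ℂ) else 0) = Pi.single i 1 by
      ext k; simp [Pi.single_apply, eq_comm]]
    ring
  rw [this]
  exact S.sum_mem fun i _ => S.sum_mem fun j _ => S.smul_mem (hM i j) _

theorem coe_mul_mulVec (x y : SL ι) (v : ι → ℂ) : (x * y).1 *ᵥ v = x.1 *ᵥ (y.1 *ᵥ v) := by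
  rw [mulVec_mulVec]; rfl

theorem coe_one_mulVec (v : ι → ℂ) : (1 : SL ι).1 *ᵥ v = v :=
  one_mulVec v

theorem inv_mulVec_mulVec (x : SL ι) (v : ι → ℂ) : (x⁻¹).1 *ᵥ (x.1 *ᵥ v) = v := by
  rw [← coe_mul_mulVec, inv_mul_cancel, coe_one_mulVec]

theorem mulVec_inv_mulVec (x : SL ι) (v : ι → ℂ) : x.1 *ᵥ ((x⁻¹).1 *ᵥ v) = v := by
  rw [← coe_mul_mulVec, mul_inv_cancel, coe_one_mulVec]

/-- The subspace `W` is stable under every element of `K`. -/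
def IsStable (K : Set (SL ι)) (W : Submodule ℂ (ι → ℂ)) : Prop :=
  ∀ g ∈ K, ∀ v ∈ W, g.1 *ᵥ v ∈ W

theorem mem_of_mulVec_mem {A : Matrix ι ι ℂ} (hA : A.det ≠ 0) {W : Submodule ℂ (ι → ℂ)}
    (hW : ∀ v ∈ W, A *ᵥ v ∈ W) {v : ι → ℂ} (hv : A *ᵥ v ∈ W) : v ∈ W := by
  have hinj : Function.Injective (A.mulVec) :=
    mulVec_injective_iff_isUnit.2 ((isUnit_iff_isUnit_det A).2 hA.isUnit)
  let f : W →ₗ[ℂ] W := (mulVecLin A).restrict hW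
  have hf : Function.Injective f := fun x y hxy => Subtype.ext (hinj (congrArg Subtype.val hxy))
  obtain ⟨w, hw⟩ := (LinearMap.injective_iff_surjective.1 hf) ⟨_, hv⟩
  have : A *ᵥ w.1 = A *ᵥ v := congrArg Subtype.val hw
  rw [← hinj this]
  exact w.2

omit [DecidableEq ι] in
/-- On a proper quotient of stable subspaces a matrix has an eigenvector. -/
theorem exists_eigenvector_mod (A : Matrix ι ι ℂ) {W W' : Submodule ℂ (ι → ℂ)} (h : W < W')
    (hW : ∀ v ∈ W, A *ᵥ v ∈ W) (hW' : ∀ v ∈ W', A *ᵥ v ∈ W') :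
    ∃ c : ℂ, ∃ v ∈ W', v ∉ W ∧ A *ᵥ v - c • v ∈ W := by
  let f : Module.End ℂ W' := (mulVecLin A).restrict hW'
  let U : Submodule ℂ W' := W.comap W'.subtype
  have hU : U ≤ U.comap f := fun v hv => hW _ hv
  have : Nontrivial (W' ⧸ U) := by
    rw [Submodule.Quotient.nontrivial_iff]
    intro hU
    obtain ⟨v, hv, hv'⟩ := SetLike.exists_of_lt h
    have : (⟨v, hv⟩ : W') ∈ U := hU ▸ Submodule.mem_top
    exact hv' this
  obtain ⟨c, hc⟩ := Module.End.exists_eigenvalue (U.mapQ U f hU)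
  obtain ⟨x, hx⟩ := hc.exists_hasEigenvector
  obtain ⟨v, rfl⟩ := U.mkQ_surjective x
  refine ⟨c, v.1, v.2, fun hv => hx.2 ?_, ?_⟩
  · rw [Submodule.mkQ_apply, Submodule.Quotient.mk_eq_zero]
    exact hv
  · have h1 := hx.apply_eq_smul
    rw [Submodule.mkQ_apply, Submodule.mapQ_apply, ← Submodule.Quotient.mk_smul,
      Submodule.Quotient.eq] at h1
    exact h1

theorem finite_eigenvalues_mod (A : Matrix ι ι ℂ) (W : Submodule ℂ (ι → ℂ))
    (hW : ∀ v ∈ W, A *ᵥ v ∈ W) : {c : ℂ | ∃ v, v ∉ W ∧ A *ᵥ v - c • v ∈ W}.Finite := by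
  refine (A.charpoly.rootSet_finite ℂ).subset ?_
  rintro c ⟨v, hv, hvc⟩
  rw [Polynomial.mem_rootSet]
  refine ⟨A.charpoly_monic.ne_zero, ?_⟩
  rw [Polynomial.coe_aeval_eq_eval, eval_charpoly]
  by_contra hdet
  refine hv (mem_of_mulVec_mem hdet (fun w hw => ?_) ?_)
  · simp only [sub_mulVec, scalar_apply, ← smul_one_eq_diagonal, smul_mulVec, one_mulVec]
    exact W.sub_mem (W.smul_mem c hw) (hW w hw)
  · simp only [sub_mulVec, scalar_apply, ← smul_one_eq_diagonal, smul_mulVec, one_mulVec]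
    rw [← neg_sub]
    exact W.neg_mem hvc

omit [DecidableEq ι] in
theorem exists_functional {W : Submodule ℂ (ι → ℂ)} {v : ι → ℂ} (hv : v ∉ W) :
    ∃ φ : (ι → ℂ) →ₗ[ℂ] ℂ, (∀ w ∈ W, φ w = 0) ∧ φ v = 1 := by
  obtain ⟨f, hf, hfW⟩ := Submodule.exists_dual_map_eq_bot_of_notMem hv inferInstance
  refine ⟨(f v)⁻¹ • f, fun w hw => ?_, ?_⟩
  · have : f w ∈ W.map f := ⟨w, hw, rfl⟩
    rw [hfW, Submodule.mem_bot] at this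
    simp [this]
  · simp [inv_mul_cancel₀ hf]

/-- If a connected group acts on `W' / W` in such a way that commutators act by scalars, then it
acts commutatively: the scalar by which `⁅x, y⁆` acts permutes up to conjugation the finitely many
eigenvalues of `y`, so it does not depend on `x`. -/
theorem commute_mod_of_scalar {D : Subgroup (SL ι)} (hD : ZPreconnected (D : Set (SL ι)))
    {W W' : Submodule ℂ (ι → ℂ)} (hlt : W < W') (hW : IsStable D W) (hW' : IsStable D W')
    (hsc : ∀ x ∈ D, ∀ y ∈ D, ∃ c : ℂ, ∀ v ∈ W', ⁅x, y⁆.1 *ᵥ v - c • v ∈ W)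
    {x y : SL ι} (hx : x ∈ D) (hy : y ∈ D) {v : ι → ℂ} (hv : v ∈ W') :
    x.1 *ᵥ (y.1 *ᵥ v) - y.1 *ᵥ (x.1 *ᵥ v) ∈ W := by
  obtain ⟨v₀, hv₀, hv₀'⟩ := SetLike.exists_of_lt hlt
  obtain ⟨φ, hφ, hφ1⟩ := exists_functional hv₀'
  have hpoly : (fun x : SL ι => φ (⁅x, y⁆.1 *ᵥ v₀)) ∈ polyFun ι := by
    refine MatMem.apply_mulVec (M := fun x : SL ι => ⁅x, y⁆.1) ?_ φ v₀
    exact ((matMem_coe.mul (MatMem.const y.1)).mul matMem_coe_inv).mul (MatMem.const (y⁻¹).1)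
  have hc : ∀ x ∈ D, ∀ v ∈ W', ⁅x, y⁆.1 *ᵥ v - φ (⁅x, y⁆.1 *ᵥ v₀) • v ∈ W := by
    intro x hx v hv
    obtain ⟨c, hc⟩ := hsc x hx y hy
    have h1 := hφ _ (hc v₀ hv₀)
    rw [map_sub, map_smul, hφ1, smul_eq_mul, mul_one, sub_eq_zero] at h1
    rw [h1]
    exact hc v hv
  obtain ⟨l, u, hu, huW, hul⟩ := exists_eigenvector_mod y.1 hlt (hW y hy) (hW' y hy)
  have hl : l ≠ 0 := by
    rintro rfl
    rw [zero_smul, sub_zero] at hul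
    exact huW (mem_of_mulVec_mem (by rw [y.2]; exact one_ne_zero) (hW y hy) hul)
  have hfin : ((fun x : SL ι => φ (⁅x, y⁆.1 *ᵥ v₀)) '' (D : Set (SL ι))).Finite := by
    refine ((finite_eigenvalues_mod y.1 W (hW y hy)).image fun c => l⁻¹ * c).subset ?_
    rintro _ ⟨x, hx, rfl⟩
    refine ⟨φ (⁅x, y⁆.1 *ᵥ v₀) * l, ⟨(x⁻¹).1 *ᵥ u, ?_, ?_⟩, ?_⟩
    · intro h
      refine huW ?_
      rw [← mulVec_inv_mulVec x u]
      exact hW x hx _ h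
    · set c := φ (⁅x, y⁆.1 *ᵥ v₀) with hcdef
      have h1 : ⁅x, y⁆.1 *ᵥ (y.1 *ᵥ u) - c • (y.1 *ᵥ u) ∈ W := hc x hx _ (hW' y hy u hu)
      have h2 : ⁅x, y⁆.1 *ᵥ (y.1 *ᵥ u) = x.1 *ᵥ (y.1 *ᵥ ((x⁻¹).1 *ᵥ u)) := by
        have e : ⁅x, y⁆ * y = x * (y * x⁻¹) := by
          rw [commutatorElement_def]; group
        rw [← coe_mul_mulVec, e, coe_mul_mulVec, coe_mul_mulVec]
      rw [h2] at h1
      have h3 : x.1 *ᵥ (y.1 *ᵥ ((x⁻¹).1 *ᵥ u)) - (c * l) • u ∈ W := by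
        have := W.add_mem h1 (W.smul_mem c hul)
        convert this using 1
        rw [smul_sub, smul_smul]
        abel
      have h4 := hW _ (D.inv_mem hx) _ h3
      rw [mulVec_sub, inv_mulVec_mulVec, mulVec_smul] at h4
      exact h4
    · field_simp
  have h1 : φ (⁅x, y⁆.1 *ᵥ v₀) = 1 := by
    rw [hD.constant hpoly hfin hx D.one_mem]
    have : ⁅(1 : SL ι), y⁆ = 1 := by simp
    simp only [this, coe_one_mulVec, hφ1]
  have h2 := hc x hx _ (hW' y hy _ (hW' x hx v hv))
  rw [h1, one_smul] at h2
  have e : ⁅x, y⁆ * (y * x) = x * y := by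
    rw [commutatorElement_def]; group
  rwa [← coe_mul_mulVec y x v, ← coe_mul_mulVec, e, coe_mul_mulVec, coe_mul_mulVec] at h2

/-- A group acting commutatively on `W' / W` has an eigenvector there. -/
theorem exists_common_eigenvector_mod {D : Subgroup (SL ι)} {W W' : Submodule ℂ (ι → ℂ)}
    (hlt : W < W') (hW : IsStable D W) (hW' : IsStable D W')
    (hcomm : ∀ x ∈ D, ∀ y ∈ D, ∀ v ∈ W', x.1 *ᵥ (y.1 *ᵥ v) - y.1 *ᵥ (x.1 *ᵥ v) ∈ W) :
    ∃ v ∈ W', v ∉ W ∧ ∀ x ∈ D, ∃ c : ℂ, x.1 *ᵥ v - c • v ∈ W := by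
  -- a minimal stable subspace strictly between `W` and `W'`
  obtain ⟨Y, ⟨hWY, hYW', hY⟩, hmin⟩ := wellFounded_lt.has_min
    {Y : Submodule ℂ (ι → ℂ) | W < Y ∧ Y ≤ W' ∧ IsStable D Y} ⟨W', hlt, le_rfl, hW'⟩
  obtain ⟨v, hv, hvW⟩ := SetLike.exists_of_lt hWY
  refine ⟨v, hYW' hv, hvW, fun x hx => ?_⟩
  obtain ⟨c, u, hu, huW, huc⟩ := exists_eigenvector_mod x.1 hWY (hW x hx) (hY x hx)
  refine ⟨c, ?_⟩
  let Z : Submodule ℂ (ι → ℂ) := Y ⊓ W.comap (mulVecLin x.1 - c • LinearMap.id)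
  have hZmem : ∀ z, z ∈ Z ↔ z ∈ Y ∧ x.1 *ᵥ z - c • z ∈ W := fun z => Iff.rfl
  have hWZ : W < Z := by
    refine SetLike.lt_iff_le_and_exists.2 ⟨fun w hw => (hZmem w).2 ⟨hWY.le hw,
      W.sub_mem (hW x hx w hw) (W.smul_mem c hw)⟩, u, (hZmem u).2 ⟨hu, huc⟩, huW⟩
  have hZ : IsStable D Z := by
    intro g hg z hz
    rw [hZmem] at hz ⊢
    refine ⟨hY g hg z hz.1, ?_⟩
    have h1 := hcomm x hx g hg z (hYW' hz.1)
    have h2 := hW g hg _ hz.2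
    rw [mulVec_sub, mulVec_smul] at h2
    have := W.add_mem h1 h2
    rwa [sub_add_sub_cancel] at this
  have hZY : Z = Y := by
    by_contra hne
    exact hmin Z ⟨hWZ, inf_le_left.trans hYW', hZ⟩ (lt_of_le_of_ne inf_le_left hne)
  rw [← hZY, hZmem] at hv
  exact hv.2

/-- The derived series of a subgroup, as subgroups of the ambient group. -/
def derivedSub (K : Subgroup (SL ι)) : ℕ → Subgroup (SL ι)
  | 0 => K
  | n + 1 => ⁅derivedSub K n, derivedSub K n⁆

theorem derivedSub_eq (K : Subgroup (SL ι)) (n : ℕ) :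
    derivedSub K n = (derivedSeries K n).map K.subtype := by
  induction n with
  | zero => simp [derivedSub, ← MonoidHom.range_eq_map]
  | succ n ih => rw [derivedSub, ih, derivedSeries_succ, Subgroup.map_commutator]

theorem derivedSub_le (K : Subgroup (SL ι)) (n : ℕ) : derivedSub K n ≤ K := by
  rw [derivedSub_eq]
  exact Subgroup.map_subtype_le _

theorem derivedSub_conj (K : Subgroup (SL ι)) (n : ℕ) {g x : SL ι} (hg : g ∈ K)
    (hx : x ∈ derivedSub K n) : g⁻¹ * x * g ∈ derivedSub K n := by
  rw [derivedSub_eq] at hx ⊢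
  obtain ⟨x, hx, rfl⟩ := hx
  have := (derivedSeries_normal K n).conj_mem x hx (⟨g, hg⟩⁻¹)
  exact ⟨_, this, by simp⟩

theorem derivedSub_zPreconnected {K : Subgroup (SL ι)} (hK : IsConnectedSubgroup K) (n : ℕ) :
    IsConnectedSubgroup (derivedSub K n) := by
  induction n with
  | zero => exact hK
  | succ n ih =>
    rw [isConnectedSubgroup_iff]
    intro x hx
    rw [derivedSub, Subgroup.commutator_def] at hx
    induction hx using Subgroup.closure_induction with
    | mem x hx =>
      obtain ⟨a, ha, b, hb, rfl⟩ := hx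
      refine ⟨(fun a => ⁅a, b⁆) '' (derivedSub K n : Set (SL ι)), ?_, ZPreconnected.image ih.2 (zContinuous ?_),
        ⟨1, (derivedSub K n).one_mem, by simp⟩, ⟨a, ha, rfl⟩⟩
      · rintro _ ⟨a, ha, rfl⟩
        exact Subgroup.commutator_mem_commutator ha hb
      · exact ((matMem_coe.mul (MatMem.const b.1)).mul matMem_coe_inv).mul
          (MatMem.const (b⁻¹).1)
    | one => exact ⟨{1}, by simp,
        @isPreconnected_singleton _ (zariski ι) 1, rfl, rfl⟩
    | mul x y _ _ hx hy => exact hx.mul hy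
    | inv x _ hx => exact hx.inv

/-- **Lie–Kolchin**, one step: between two stable subspaces of a connected solvable group there is
a stable subspace containing the smaller one with codimension one. -/
theorem exists_stable_line_mod {K : Subgroup (SL ι)} (hK : IsConnectedSubgroup K)
    [hsol : Group.IsSolvable K] {W W' : Submodule ℂ (ι → ℂ)} (hlt : W < W')
    (hW : IsStable K W) (hW' : IsStable K W') :
    ∃ v ∈ W', v ∉ W ∧ ∀ g ∈ K, ∃ c : ℂ, g.1 *ᵥ v - c • v ∈ W := by
  -- a minimal stable subspace strictly between `W` and `W'`
  obtain ⟨Y, ⟨hWY, hYW', hY⟩, hmin⟩ := wellFounded_lt.has_min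
    {Y : Submodule ℂ (ι → ℂ) | W < Y ∧ Y ≤ W' ∧ IsStable K Y} ⟨W', hlt, le_rfl, hW'⟩
  -- every term of the derived series acts on `Y / W` by scalars
  have hdesc : ∀ n, (∀ x ∈ derivedSub K n, ∃ c : ℂ, ∀ v ∈ Y, x.1 *ᵥ v - c • v ∈ W) →
      ∀ x ∈ K, ∃ c : ℂ, ∀ v ∈ Y, x.1 *ᵥ v - c • v ∈ W := by
    intro n
    induction n with
    | zero => exact fun h => h
    | succ n ih =>
      intro hn
      refine ih fun x hx => ?_
      set D := derivedSub K n with hDdef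
      have hDK : D ≤ K := derivedSub_le K n
      have hDW : IsStable D W := fun g hg => hW g (hDK hg)
      have hDY : IsStable D Y := fun g hg => hY g (hDK hg)
      have hDc : IsConnectedSubgroup D := derivedSub_zPreconnected hK n
      have hcomm : ∀ x ∈ D, ∀ y ∈ D, ∀ v ∈ Y, x.1 *ᵥ (y.1 *ᵥ v) - y.1 *ᵥ (x.1 *ᵥ v) ∈ W :=
        fun x hx y hy v hv => commute_mod_of_scalar hDc.2 hWY hDW hDY
          (fun x hx y hy => hn _ (Subgroup.commutator_mem_commutator hx hy)) hx hy hv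
      obtain ⟨v, hv, hvW, heig⟩ := exists_common_eigenvector_mod hWY hDW hDY hcomm
      obtain ⟨φ, hφ, hφ1⟩ := exists_functional hvW
      have hc : ∀ x ∈ D, x.1 *ᵥ v - φ (x.1 *ᵥ v) • v ∈ W := by
        intro x hx
        obtain ⟨c, hc⟩ := heig x hx
        have h1 := hφ _ hc
        rw [map_sub, map_smul, hφ1, smul_eq_mul, mul_one, sub_eq_zero] at h1
        rwa [h1]
      -- by connectedness the weight is invariant under conjugation
      have hinv : ∀ x ∈ D, ∀ g ∈ K, φ ((g⁻¹ * x * g).1 *ᵥ v) = φ (x.1 *ᵥ v) := by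
        intro x hx g hg
        have hpoly : (fun g : SL ι => φ ((g⁻¹ * x * g).1 *ᵥ v)) ∈ polyFun ι := by
          refine MatMem.apply_mulVec (M := fun g : SL ι => (g⁻¹ * x * g).1) ?_ φ v
          exact (matMem_coe_inv.mul (MatMem.const x.1)).mul matMem_coe
        have hfin : ((fun g : SL ι => φ ((g⁻¹ * x * g).1 *ᵥ v)) '' (K : Set (SL ι))).Finite := by
          refine (finite_eigenvalues_mod x.1 W (hDW x hx)).subset ?_
          rintro _ ⟨g, hg, rfl⟩
          refine ⟨g.1 *ᵥ v, fun h => hvW ?_, ?_⟩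
          · rw [← inv_mulVec_mulVec g v]
            exact hW _ (K.inv_mem hg) _ h
          · have := hW g hg _ (hc _ (derivedSub_conj K n hg hx))
            rw [mulVec_sub, mulVec_smul, ← coe_mul_mulVec, ← mul_assoc, ← mul_assoc,
              mul_inv_cancel, one_mul, coe_mul_mulVec] at this
            exact this
        have := ZPreconnected.constant hK.2 hpoly hfin hg K.one_mem
        simpa using this
      -- hence the weight space is stable under `K`, and equals `Y` by minimality
      let Z : Submodule ℂ (ι → ℂ) :=
        Y ⊓ ⨅ x : D, W.comap (mulVecLin x.1.1 - φ (x.1.1 *ᵥ v) • LinearMap.id)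
      have hZmem : ∀ z, z ∈ Z ↔ z ∈ Y ∧ ∀ x ∈ D, x.1 *ᵥ z - φ (x.1 *ᵥ v) • z ∈ W := by
        intro z
        simp only [Z, Submodule.mem_inf, Submodule.mem_iInf, Subtype.forall]
        exact Iff.rfl
      have hWZ : W < Z := by
        refine SetLike.lt_iff_le_and_exists.2 ⟨fun w hw => (hZmem w).2 ⟨hWY.le hw, fun x hx =>
          W.sub_mem (hDW x hx w hw) (W.smul_mem _ hw)⟩, v, (hZmem v).2 ⟨hv, hc⟩, hvW⟩
      have hZ : IsStable K Z := by
        intro g hg z hz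
        rw [hZmem] at hz ⊢
        refine ⟨hY g hg z hz.1, fun x hx => ?_⟩
        have := hW g hg _ (hz.2 _ (derivedSub_conj K n hg hx))
        rw [hinv x hx g hg, mulVec_sub, mulVec_smul, ← coe_mul_mulVec, ← mul_assoc, ← mul_assoc,
          mul_inv_cancel, one_mul, coe_mul_mulVec] at this
        exact this
      have hZY : Z = Y := by
        by_contra hne
        exact hmin Z ⟨hWZ, inf_le_left.trans hYW', hZ⟩ (lt_of_le_of_ne inf_le_left hne)
      refine ⟨φ (x.1 *ᵥ v), fun u hu => ?_⟩
      rw [← hZY, hZmem] at hu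
      exact hu.2 x hx
  obtain ⟨n, hn⟩ := hsol.solvable
  have hscal := hdesc n (by
    intro x hx
    rw [derivedSub_eq, hn, Subgroup.map_bot, Subgroup.mem_bot] at hx
    exact ⟨1, fun v _ => by simp [hx]⟩)
  obtain ⟨v, hv, hvW⟩ := SetLike.exists_of_lt hWY
  exact ⟨v, hYW' hv, hvW, fun g hg => (hscal g hg).imp fun c hc => hc v hv⟩

end LieKolchin

/-! ### Groups of units of matrix algebras -/

section AlgebraGroups

variable {ι : Type} [Fintype ι] [DecidableEq ι]

theorem det_one_add_vecMulVec (u v : ι → ℂ) : (1 + vecMulVec u v).det = 1 + v ⬝ᵥ u := by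
  rw [vecMulVec_eq Unit, det_one_add_replicateCol_mul_replicateRow]

omit [DecidableEq ι] in
theorem rankOne_mulVec (u v w : ι → ℂ) : vecMulVec u v *ᵥ w = (v ⬝ᵥ w) • u := by
  rw [vecMulVec_mulVec, op_smul_eq_smul]

/-- A finite-dimensional algebra of matrices contains the inverses of its invertible elements. -/
theorem inv_mem_subalgebra (𝔅 : Subalgebra ℂ (Matrix ι ι ℂ)) {a : Matrix ι ι ℂ} (ha : a ∈ 𝔅)
    (hdet : a.det ≠ 0) : a⁻¹ ∈ 𝔅 := by
  have hu : IsUnit a.det := hdet.isUnit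
  let f : 𝔅 →ₗ[ℂ] 𝔅 := LinearMap.mulLeft ℂ ⟨a, ha⟩
  have hf : Function.Injective f := by
    intro x y hxy
    have h1 : a * x.1 = a * y.1 := congrArg Subtype.val hxy
    have h2 := congrArg (fun m => a⁻¹ * m) h1
    simp only [nonsing_inv_mul_cancel_left _ _ hu] at h2
    exact Subtype.ext h2
  obtain ⟨b, hb⟩ := (LinearMap.injective_iff_surjective.1 hf) 1
  have h1 : a * b.1 = 1 := congrArg Subtype.val hb
  rw [inv_eq_right_inv h1]
  exact b.2

/-- The group of elements of `SL(ι)` lying in a given algebra of matrices. -/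
def algGroup (𝔅 : Subalgebra ℂ (Matrix ι ι ℂ)) : Subgroup (SL ι) where
  carrier := {g | g.1 ∈ 𝔅}
  one_mem' := 𝔅.one_mem
  mul_mem' hg hh := 𝔅.mul_mem hg hh
  inv_mem' {g} hg := by
    have h : (g⁻¹).1 = (g.1)⁻¹ :=
      (inv_eq_right_inv (congrArg Subtype.val (mul_inv_cancel g))).symm
    change (g⁻¹).1 ∈ 𝔅
    rw [h]
    exact inv_mem_subalgebra 𝔅 hg (by rw [g.2]; exact one_ne_zero)

theorem mem_algGroup {𝔅 : Subalgebra ℂ (Matrix ι ι ℂ)} {g : SL ι} : g ∈ algGroup 𝔅 ↔ g.1 ∈ 𝔅 :=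
  Iff.rfl

theorem MatMem.linear {X : Type*} {S : Subalgebra ℂ (X → ℂ)} {M : X → Matrix ι ι ℂ}
    (hM : MatMem S M) (φ : Matrix ι ι ℂ →ₗ[ℂ] ℂ) : (fun x => φ (M x)) ∈ S := by
  have : (fun x => φ (M x)) = ∑ i, ∑ j, φ (Matrix.single i j 1) • fun x => M x i j := by
    ext x
    conv_lhs => rw [matrix_eq_sum_single (M x)]
    simp only [map_sum, Finset.sum_apply, Pi.smul_apply, smul_eq_mul]
    refine Finset.sum_congr rfl fun i _ => Finset.sum_congr rfl fun j _ => ?_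
    rw [show Matrix.single i j (M x i j) = M x i j • Matrix.single i j (1 : ℂ) by simp, map_smul,
      smul_eq_mul, mul_comm]
  rw [this]
  exact S.sum_mem fun i _ => S.sum_mem fun j _ => S.smul_mem (hM i j) _

/-- Membership of the matrix in a linear subspace is a closed condition. -/
theorem zClosed_mem_submodule (U : Submodule ℂ (Matrix ι ι ℂ)) : ZClosed {g : SL ι | g.1 ∈ U} := by
  have : {g : SL ι | g.1 ∈ U} =
      {g : SL ι | ∀ φ : {φ : Matrix ι ι ℂ →ₗ[ℂ] ℂ // ∀ u ∈ U, φ u = 0}, φ.1 g.1 = 0} := by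
    ext g
    constructor
    · exact fun hg φ => φ.2 _ hg
    · intro h
      by_contra hg
      obtain ⟨f, hf, hfU⟩ := Submodule.exists_dual_map_eq_bot_of_notMem hg inferInstance
      refine hf (h ⟨f, fun u hu => ?_⟩)
      have : f u ∈ U.map f := ⟨u, hu, rfl⟩
      rwa [hfU, Submodule.mem_bot] at this
  rw [this]
  exact zClosed_forall fun φ => zClosed_eq (matMem_coe.linear φ.1) 0

theorem isClosedSubgroup_algGroup (𝔅 : Subalgebra ℂ (Matrix ι ι ℂ)) :
    IsClosedSubgroup (algGroup 𝔅) :=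
  zClosed_mem_submodule (Subalgebra.toSubmodule 𝔅)

/-- The segment from `1` to a matrix `h`. -/
def segment (h : Matrix ι ι ℂ) (t : ℂ) : Matrix ι ι ℂ := 1 + t • (h - 1)

omit [Fintype ι] in
@[simp] theorem segment_zero (h : Matrix ι ι ℂ) : segment h 0 = 1 := by simp [segment]

omit [Fintype ι] in
@[simp] theorem segment_one (h : Matrix ι ι ℂ) : segment h 1 = h := by simp [segment]

omit [Fintype ι] in
theorem matMem_segment (D : Set ℂ) (h : Matrix ι ι ℂ) : MatMem (regOn D) (segment h) :=
  (MatMem.const 1).add (MatMem.smul_const id_mem_regOn _)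

theorem segment_mem {𝔅 : Subalgebra ℂ (Matrix ι ι ℂ)} {h : Matrix ι ι ℂ} (hh : h ∈ 𝔅) (t : ℂ) :
    segment h t ∈ 𝔅 :=
  𝔅.add_mem 𝔅.one_mem (𝔅.smul_mem (𝔅.sub_mem hh 𝔅.one_mem) t)

theorem finite_det_segment_eq_zero (h : Matrix ι ι ℂ) :
    {t | (segment h t).det ≠ 0}ᶜ.Finite := by
  have := infinite_ne_zero_of_regOn (D := Set.univ) (by simp) (matMem_segment Set.univ h).det
    ⟨0, trivial, by simp⟩
  simpa using this

/-- If an algebra of matrices contains an idempotent of rank one, then its group of elements of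
determinant one is connected: the segment from `1` to an element can be corrected by the
one-parameter group attached to the idempotent so that it stays in `SL(ι)`. -/
theorem joinedToOne_algGroup (𝔅 : Subalgebra ℂ (Matrix ι ι ℂ)) {u v : ι → ℂ} (huv : v ⬝ᵥ u = 1)
    (he : vecMulVec u v ∈ 𝔅) {x : SL ι} (hx : x ∈ algGroup 𝔅) :
    JoinedToOne (algGroup 𝔅 : Set (SL ι)) x := by
  set D : Set ℂ := {t | (segment x.1 t).det ≠ 0} with hD
  have hreg : (fun t => ((segment x.1 t).det)⁻¹) ∈ regOn D :=
    inv_mem_regOn (matMem_segment D x.1).det fun t ht => ht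
  refine JoinedToOne.of_curve (D := D) (finite_det_segment_eq_zero x.1)
    (M := fun t => segment x.1 t * (1 + ((segment x.1 t).det⁻¹ - 1) • vecMulVec u v))
    ((matMem_segment D x.1).mul ((MatMem.const 1).add (MatMem.smul_const
      ((regOn D).sub_mem hreg (regOn D).one_mem) _))) ?_ ?_ (s := 0) (t := 1) ?_ ?_ ?_ ?_
  · intro t ht
    rw [det_mul, ← smul_vecMulVec, det_one_add_vecMulVec, dotProduct_smul, huv, smul_eq_mul,
      mul_one, add_sub_cancel, mul_inv_cancel₀ ht]
  · intro t _ g hg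
    change g.1 ∈ 𝔅
    rw [hg]
    exact 𝔅.mul_mem (segment_mem hx t) (𝔅.add_mem 𝔅.one_mem (𝔅.smul_mem he _))
  · simp [hD]
  · simp
  · simp [hD, x.2]
  · simp [x.2]

end AlgebraGroups

/-! ### Flags -/

section Flags

variable {ι : Type} [Fintype ι] [DecidableEq ι]

/-- The algebra of matrices preserving every member of a family of subspaces. -/
def flagAlg {α : Type*} (F : α → Submodule ℂ (ι → ℂ)) : Subalgebra ℂ (Matrix ι ι ℂ) where
  carrier := {a | ∀ k, ∀ x ∈ F k, a *ᵥ x ∈ F k}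
  mul_mem' ha hb k x hx := by
    rw [← mulVec_mulVec]
    exact ha k _ (hb k x hx)
  add_mem' ha hb k x hx := by
    rw [add_mulVec]
    exact (F k).add_mem (ha k x hx) (hb k x hx)
  algebraMap_mem' c k x hx := by
    rw [Algebra.algebraMap_eq_smul_one, smul_mulVec, one_mulVec]
    exact (F k).smul_mem c hx

theorem mem_flagAlg {α : Type*} {F : α → Submodule ℂ (ι → ℂ)} {a : Matrix ι ι ℂ} :
    a ∈ flagAlg F ↔ ∀ k, ∀ x ∈ F k, a *ᵥ x ∈ F k := Iff.rfl

variable {N : ℕ} (b : ι ≃ Fin N)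

/-- The coordinate flag for the ordering `b` of the coordinates: the vectors whose coordinates from
the `k`-th on vanish. -/
def coordFlag (k : ℕ) : Submodule ℂ (ι → ℂ) where
  carrier := {x | ∀ i, k ≤ (b i : ℕ) → x i = 0}
  zero_mem' _ _ := rfl
  add_mem' hx hy i hi := by simp [hx i hi, hy i hi]
  smul_mem' c x hx i hi := by simp [hx i hi]

omit [Fintype ι] [DecidableEq ι] in
theorem mem_coordFlag {k : ℕ} {x : ι → ℂ} :
    x ∈ coordFlag b k ↔ ∀ i, k ≤ (b i : ℕ) → x i = 0 := Iff.rfl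

omit [Fintype ι] [DecidableEq ι] in
theorem coordFlag_mono : Monotone (coordFlag b) := fun _ _ h _ hx i hi => hx i (h.trans hi)

omit [Fintype ι] [DecidableEq ι] in
theorem coordFlag_zero : coordFlag b 0 = ⊥ := by
  ext x
  simp only [mem_coordFlag, zero_le, true_implies, Submodule.mem_bot]
  exact ⟨fun h => funext h, fun h i => by simp [h]⟩

omit [Fintype ι] [DecidableEq ι] in
theorem coordFlag_top : coordFlag b N = ⊤ := by
  ext x
  simp only [mem_coordFlag, Submodule.mem_top, iff_true]
  exact fun i hi => absurd (b i).2 (not_lt.2 hi)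

omit [Fintype ι] in
theorem single_mem_coordFlag {i : ι} {k : ℕ} (h : (b i : ℕ) < k) :
    (Pi.single i 1 : ι → ℂ) ∈ coordFlag b k := by
  intro j hj
  rw [Pi.single_apply, if_neg]
  rintro rfl
  omega

/-- The upper triangular matrices of determinant one, for the ordering `b` of the coordinates. -/
def upperTri : Subgroup (SL ι) := algGroup (flagAlg (coordFlag b))

theorem mem_flagAlg_coordFlag {a : Matrix ι ι ℂ} :
    a ∈ flagAlg (coordFlag b) ↔ ∀ i j, b j < b i → a i j = 0 := by
  constructor
  · intro h i j hij
    have := h (b j + 1) _ (single_mem_coordFlag b (i := j) (by omega)) i (by omega)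
    simpa using this
  · intro h k x hx i hi
    refine Finset.sum_eq_zero fun j _ => ?_
    by_cases hj : b j < b i
    · simp [h i j hj]
    · have : x j = 0 := hx j (by omega)
      simp [this]

theorem isConnectedSubgroup_upperTri : IsConnectedSubgroup (upperTri b) := by
  rw [isConnectedSubgroup_iff]
  intro x hx
  rcases isEmpty_or_nonempty ι with hι | ⟨⟨i⟩⟩
  · refine ⟨{1}, by simp, @isPreconnected_singleton _ (zariski ι) 1, rfl, ?_⟩
    exact Subtype.ext (by ext i; exact hι.elim i)
  · refine joinedToOne_algGroup _ (u := Pi.single i 1) (v := Pi.single i 1) (by simp) ?_ hx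
    rw [mem_flagAlg_coordFlag]
    intro j k hjk
    rw [vecMulVec_apply, Pi.single_apply, Pi.single_apply]
    split_ifs with h1 h2
    · subst h1; subst h2; omega
    all_goals simp

/-- The matrices with zeros below the `k`-th superdiagonal. -/
def IsShifted (k : ℕ) (a : Matrix ι ι ℂ) : Prop := ∀ i j, (b j : ℕ) < b i + k → a i j = 0

variable {b}

omit [DecidableEq ι] in
theorem IsShifted.mul {k l : ℕ} {a c : Matrix ι ι ℂ} (ha : IsShifted b k a)
    (hc : IsShifted b l c) : IsShifted b (k + l) (a * c) := by
  intro i j hij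
  rw [mul_apply]
  refine Finset.sum_eq_zero fun m _ => ?_
  by_cases h : (b m : ℕ) < b i + k
  · simp [ha i m h]
  · rw [hc m j (by omega), mul_zero]

omit [Fintype ι] [DecidableEq ι] in
theorem IsShifted.add {k : ℕ} {a c : Matrix ι ι ℂ} (ha : IsShifted b k a)
    (hc : IsShifted b k c) : IsShifted b k (a + c) := fun i j h => by
  simp [ha i j h, hc i j h]

omit [Fintype ι] [DecidableEq ι] in
theorem IsShifted.neg {k : ℕ} {a : Matrix ι ι ℂ} (ha : IsShifted b k a) :
    IsShifted b k (-a) := fun i j h => by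
  simp [ha i j h]

omit [Fintype ι] [DecidableEq ι] in
theorem IsShifted.sub {k : ℕ} {a c : Matrix ι ι ℂ} (ha : IsShifted b k a)
    (hc : IsShifted b k c) : IsShifted b k (a - c) := fun i j h => by
  simp [ha i j h, hc i j h]

omit [Fintype ι] [DecidableEq ι] in
theorem IsShifted.mono {k l : ℕ} (h : k ≤ l) {a : Matrix ι ι ℂ} (ha : IsShifted b l a) :
    IsShifted b k a := fun i j hij => ha i j (by omega)

theorem isShifted_of_mem_upperTri {g : SL ι} (hg : g ∈ upperTri b) : IsShifted b 0 g.1 :=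
  fun i j h => (mem_flagAlg_coordFlag b).1 hg i j (by rw [Fin.lt_def]; omega)

theorem isShifted_commutator {g h : SL ι} (hg : g ∈ upperTri b) (hh : h ∈ upperTri b) :
    IsShifted b 1 (g.1 * h.1 - h.1 * g.1) := by
  have hd : ∀ {g h : SL ι}, g ∈ upperTri b → h ∈ upperTri b → ∀ i, (g.1 * h.1) i i =
      g.1 i i * h.1 i i := by
    intro g h hg hh i
    rw [mul_apply]
    refine Finset.sum_eq_single_of_mem i (Finset.mem_univ _) fun m _ hm => ?_
    rcases lt_trichotomy (b m) (b i) with hlt | heq | hlt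
    · simp [(mem_flagAlg_coordFlag b).1 hg i m hlt]
    · exact absurd (b.injective heq) hm
    · simp [(mem_flagAlg_coordFlag b).1 hh m i hlt]
  intro i j hij
  rcases eq_or_ne i j with rfl | hne
  · rw [Matrix.sub_apply, hd hg hh, hd hh hg, mul_comm, sub_self]
  · have hlt : (b j : ℕ) < b i + 0 := by
      have : (b j : ℕ) ≠ b i := fun h => hne (b.injective (Fin.ext h)).symm
      omega
    have h1 := (isShifted_of_mem_upperTri hg).mul (isShifted_of_mem_upperTri hh)
    have h2 := (isShifted_of_mem_upperTri hh).mul (isShifted_of_mem_upperTri hg)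
    exact (h1.sub h2) i j (by omega)

open scoped commutatorElement in
theorem commutator_coe_sub_one (g h : SL ι) :
    (⁅g, h⁆).1 - 1 = (g.1 * h.1 - h.1 * g.1) * ((g⁻¹).1 * (h⁻¹).1) := by
  have e : (h.1 * g.1) * ((g⁻¹).1 * (h⁻¹).1) = 1 := by
    have : (h * g) * (g⁻¹ * h⁻¹) = 1 := by group
    exact congrArg Subtype.val this
  rw [sub_mul, e]
  congr 1
  have : ⁅g, h⁆ = (g * h) * (g⁻¹ * h⁻¹) := by rw [commutatorElement_def]; group
  exact congrArg Subtype.val this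

open scoped commutatorElement in
/-- The `n`-th derived group of the upper triangular group is contained in the `n`-th step of the
filtration by superdiagonals. -/
theorem isShifted_derivedSub (n : ℕ) : ∀ x ∈ derivedSub (upperTri b) (n + 1),
    IsShifted b (n + 1) (x.1 - 1) := by
  have hgen : ∀ n : ℕ, (∀ x ∈ derivedSub (upperTri b) n, ∀ y ∈ derivedSub (upperTri b) n,
      IsShifted b (n + 1) (x.1 * y.1 - y.1 * x.1)) → ∀ x ∈ derivedSub (upperTri b) (n + 1),
      IsShifted b (n + 1) (x.1 - 1) := by
    intro n hn x hx
    rw [derivedSub, Subgroup.commutator_def] at hx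
    have hle : ∀ {x}, x ∈ Subgroup.closure {g | ∃ g₁ ∈ derivedSub (upperTri b) n,
        ∃ g₂ ∈ derivedSub (upperTri b) n, ⁅g₁, g₂⁆ = g} → x ∈ upperTri b := by
      intro x hx
      rw [← Subgroup.commutator_def] at hx
      exact derivedSub_le _ (n + 1) hx
    induction hx using Subgroup.closure_induction with
    | mem x hx =>
      obtain ⟨y, hy, z, hz, rfl⟩ := hx
      rw [commutator_coe_sub_one]
      have hy' := isShifted_of_mem_upperTri ((upperTri b).inv_mem (derivedSub_le _ n hy))
      have hz' := isShifted_of_mem_upperTri ((upperTri b).inv_mem (derivedSub_le _ n hz))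
      exact (hn y hy z hz).mul (hy'.mul hz')
    | one =>
      have : (1 : SL ι).1 - 1 = 0 := sub_self _
      rw [this]
      exact fun _ _ _ => rfl
    | mul x y hx hy hx' hy' =>
      have : (x * y).1 - 1 = (x.1 - 1) * y.1 + (y.1 - 1) := by
        rw [sub_mul, one_mul, sub_add_sub_cancel]; rfl
      rw [this]
      exact (hx'.mul (isShifted_of_mem_upperTri (hle hy))).add hy'
    | inv x hx hx' =>
      have : (x⁻¹).1 - 1 = -((x.1 - 1) * (x⁻¹).1) := by
        rw [sub_mul, one_mul, neg_sub]
        congr 1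
        exact (congrArg Subtype.val (mul_inv_cancel x)).symm
      rw [this]
      exact (hx'.mul (isShifted_of_mem_upperTri ((upperTri b).inv_mem (hle hx)))).neg
  induction n with
  | zero => exact hgen 0 fun x hx y hy => isShifted_commutator hx hy
  | succ n ih =>
    refine hgen (n + 1) fun x hx y hy => ?_
    have : x.1 * y.1 - y.1 * x.1 = (x.1 - 1) * (y.1 - 1) - (y.1 - 1) * (x.1 - 1) := by
      noncomm_ring
    rw [this]
    exact (((ih x hx).mul (ih y hy)).sub ((ih y hy).mul (ih x hx))).mono (by omega)

variable (b)

theorem isSolvable_upperTri : Group.IsSolvable (upperTri b) := by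
  refine ⟨N + 1, ?_⟩
  rw [eq_bot_iff]
  intro x hx
  have h1 : x.1 ∈ derivedSub (upperTri b) (N + 1) := by
    rw [derivedSub_eq]
    exact ⟨x, hx, rfl⟩
  have h2 := isShifted_derivedSub N x.1 h1
  rw [Subgroup.mem_bot]
  refine Subtype.ext (Subtype.ext ?_)
  rw [← sub_eq_zero]
  ext i j
  exact h2 i j (by omega)

/-- The conjugate `q · B · q⁻¹` of the upper triangular group. -/
def conjTri (q : SL ι) : Subgroup (SL ι) := (upperTri b).map (MulAut.conj q).toMonoidHom

theorem mem_conjTri {q g : SL ι} : g ∈ conjTri b q ↔ q⁻¹ * g * q ∈ upperTri b := by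
  constructor
  · rintro ⟨x, hx, rfl⟩
    simpa [mul_assoc] using hx
  · exact fun h => ⟨_, h, by simp [mul_assoc]⟩

/-- A conjugate of the upper triangular group is the stabilizer of the translated flag. -/
theorem mem_conjTri_iff_flag {q g : SL ι} :
    g ∈ conjTri b q ↔ g.1 ∈ flagAlg (fun k => (coordFlag b k).map (mulVecLin q.1)) := by
  rw [mem_conjTri]
  constructor
  · rintro h k _ ⟨x, hx, rfl⟩
    refine ⟨_, h k x hx, ?_⟩
    simp only [mulVecLin_apply]
    rw [coe_mul_mulVec, coe_mul_mulVec, mulVec_inv_mulVec]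
  · intro h k x hx
    obtain ⟨y, hy, hyx⟩ := h k _ ⟨x, hx, rfl⟩
    simp only [mulVecLin_apply] at hyx
    rw [coe_mul_mulVec, coe_mul_mulVec, ← hyx, inv_mulVec_mulVec]
    exact hy

theorem conjTri_eq_algGroup (q : SL ι) :
    conjTri b q = algGroup (flagAlg (fun k => (coordFlag b k).map (mulVecLin q.1))) := by
  ext g
  exact mem_conjTri_iff_flag b

theorem conjTri_spec (q : SL ι) : IsClosedSubgroup (conjTri b q) ∧
    IsConnectedSubgroup (conjTri b q) ∧ Group.IsSolvable (conjTri b q) := by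
  refine ⟨?_, ?_, ?_⟩
  · rw [conjTri_eq_algGroup]
    exact isClosedSubgroup_algGroup _
  · refine ⟨⟨1, Subgroup.one_mem _⟩, ?_⟩
    rw [conjTri, Subgroup.coe_map]
    refine ZPreconnected.image (isConnectedSubgroup_upperTri b).2 (zContinuous ?_)
    exact ((MatMem.const q.1).mul matMem_coe).mul (MatMem.const (q⁻¹).1)
  · have := isSolvable_upperTri b
    exact Group.isSolvable_of_surjective
      ((MulAut.conj q).toMonoidHom.subgroupMap_surjective (upperTri b))

end Flags

/-! ### Borel subgroups -/

section Borel

variable {ι : Type} [Fintype ι] [DecidableEq ι] {N : ℕ} (b : ι ≃ Fin N)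

/-- The transvection `1 + u ⊗ φ`, for a functional `φ` vanishing on `u`. -/
def transv (u φ : ι → ℂ) (h : φ ⬝ᵥ u = 0) : SL ι :=
  ⟨1 + vecMulVec u φ, by rw [det_one_add_vecMulVec, h, add_zero]⟩

theorem transv_mulVec (u φ : ι → ℂ) (h : φ ⬝ᵥ u = 0) (x : ι → ℂ) :
    (transv u φ h).1 *ᵥ x = x + (φ ⬝ᵥ x) • u := by
  rw [transv, add_mulVec, one_mulVec, rankOne_mulVec]

/-- The elementary transvections `1 + t E_{ij}` all belong to `P`, or `i = j`. -/
def ElemIn (P : Subgroup (SL ι)) (i j : ι) : Prop :=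
  i = j ∨ ∀ (t : ℂ) (g : SL ι), g.1 = 1 + Matrix.single i j t → g ∈ P

theorem transv_column_mem {P : Subgroup (SL ι)} {j : ι} (w : ι → ℂ)
    (hw : ∀ i, w i ≠ 0 → ElemIn P i j) (h : Pi.single j 1 ⬝ᵥ w = 0) :
    transv w (Pi.single j 1) h ∈ P := by
  have key : ∀ s : Finset ι, ∀ h : Pi.single j 1 ⬝ᵥ (fun i => if i ∈ s then w i else 0) = 0,
      transv (fun i => if i ∈ s then w i else 0) (Pi.single j 1) h ∈ P := by
    intro s
    induction s using Finset.induction_on with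
    | empty =>
      intro h
      convert P.one_mem
      refine Subtype.ext ?_
      ext k l
      simp [transv, vecMulVec_apply]
    | insert a s ha ih =>
      intro h'
      have hwj : w j = 0 := by simpa using h
      have hs : Pi.single j 1 ⬝ᵥ (fun i => if i ∈ s then w i else 0) = 0 := by simp [hwj]
      by_cases hwa : w a = 0
      · convert ih hs using 3 with i
        by_cases hi : i = a
        · subst hi; simp [hwa]
        · simp [hi]
      · have haj : a ≠ j := by rintro rfl; exact hwa hwj
        have h1 : Pi.single j 1 ⬝ᵥ (Pi.single a (w a) : ι → ℂ) = 0 := by simp [haj.symm]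
        have h2 : transv (Pi.single a (w a)) (Pi.single j 1) h1 ∈ P := by
          refine ((hw a hwa).resolve_left haj) (w a) _ ?_
          rw [transv]
          ext k l
          by_cases hk : a = k
          · by_cases hl : j = l
            · subst hk; subst hl; simp [vecMulVec_apply]
            · simp [vecMulVec_apply, Ne.symm hl, hl]
          · simp [vecMulVec_apply, Ne.symm hk, hk]
        convert P.mul_mem h2 (ih hs) using 1
        refine Subtype.ext ?_
        change 1 + vecMulVec _ _ = (1 + vecMulVec _ _) * (1 + vecMulVec _ _)
        rw [add_mul, one_mul, mul_add, mul_one, vecMulVec_mul_vecMulVec, hs, zero_smul,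
          vecMulVec_zero, add_zero, add_assoc, ← add_vecMulVec]
        congr 2
        ext i
        by_cases hi : i = a
        · subst hi; simp [ha]
        · simp [hi]
  have := key Finset.univ (by simpa using h)
  simpa using this

/-- If `j` is the `k`-th coordinate and the other coordinates on which `v ∉ F_k` is supported are
linked to `j` by transvections in `P`, then some element of `P` fixes `F_k` and moves the `j`-th
basis vector to a multiple of `v` modulo `F_k`. -/
theorem exists_mover {P : Subgroup (SL ι)} {j : ι} {v : ι → ℂ} (hv : v ∉ coordFlag b (b j))
    (hS : ∀ i, v i ≠ 0 → b i < b j ∨ ElemIn P i j ∧ ElemIn P j i) :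
    ∃ τ ∈ P, (∀ u ∈ coordFlag b (b j), τ.1 *ᵥ u = u) ∧
      ∃ c : ℂ, c ≠ 0 ∧ τ.1 *ᵥ Pi.single j 1 - c • v ∈ coordFlag b (b j) := by
  -- the case in which the `j`-th coordinate of `v` does not vanish
  have main : ∀ v : ι → ℂ, v j ≠ 0 →
      (∀ i, v i ≠ 0 → b i < b j ∨ ElemIn P i j ∧ ElemIn P j i) →
      ∃ τ ∈ P, (∀ u ∈ coordFlag b (b j), τ.1 *ᵥ u = u) ∧
      ∃ c : ℂ, c ≠ 0 ∧ τ.1 *ᵥ Pi.single j 1 - c • v ∈ coordFlag b (b j) := by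
    intro v hvj hS
    let w : ι → ℂ := fun i => if b j < b i then (v j)⁻¹ * v i else 0
    have hwj : w j = 0 := by simp [w]
    have hw0 : Pi.single j 1 ⬝ᵥ w = 0 := by simp [hwj]
    refine ⟨transv w (Pi.single j 1) hw0, transv_column_mem w (fun i hi => ?_) hw0, ?_,
      (v j)⁻¹, inv_ne_zero hvj, ?_⟩
    · have h1 : b j < b i ∧ v i ≠ 0 := by
        by_contra hcon
        refine hi ?_
        by_cases h : b j < b i
        · have : v i = 0 := by
            by_contra h'
            exact hcon ⟨h, h'⟩
          simp [w, this]
        · simp [w, h]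
      exact ((hS i h1.2).resolve_left (not_lt.2 h1.1.le)).1
    · intro u hu
      rw [transv_mulVec]
      have : u j = 0 := hu j le_rfl
      simp [this]
    · intro i hi
      rw [transv_mulVec]
      rcases eq_or_lt_of_le hi with h | h
      · have : i = j := b.injective (Fin.ext h.symm)
        subst this
        simp [hwj, inv_mul_cancel₀ hvj]
      · have hij : i ≠ j := by rintro rfl; exact lt_irrefl _ h
        have h' : b j < b i := h
        simp [w, h', hij]
  by_cases hvj : v j ≠ 0
  · exact main v hvj hS
  push Not at hvj
  -- otherwise a transvection first makes that coordinate nonzero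
  obtain ⟨m, hm, hvm⟩ : ∃ m, (b j : ℕ) ≤ b m ∧ v m ≠ 0 := by
    by_contra hcon
    push Not at hcon
    exact hv hcon
  have hjm : j ≠ m := by rintro rfl; exact hvm hvj
  have hRm := (hS m hvm).resolve_left (by rw [Fin.lt_def]; omega)
  have h0 : Pi.single m 1 ⬝ᵥ (Pi.single j 1 : ι → ℂ) = 0 := by simp [hjm.symm]
  set x := transv (Pi.single j 1) (Pi.single m 1) h0 with hx
  have hxP : x ∈ P := transv_column_mem _ (fun i hi => by
    have : i = j := by
      by_contra h
      exact hi (by simp [h])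
    rw [this]; exact hRm.2) h0
  have hxv : x.1 *ᵥ v = v + v m • Pi.single j 1 := by
    rw [hx, transv_mulVec]; simp
  have hxfix : ∀ u ∈ coordFlag b (b j), x.1 *ᵥ u = u := by
    intro u hu
    rw [hx, transv_mulVec]
    have : u m = 0 := hu m hm
    simp [this]
  have hxfix' : ∀ u ∈ coordFlag b (b j), (x⁻¹).1 *ᵥ u = u := by
    intro u hu
    conv_lhs => rw [← hxfix u hu]
    exact inv_mulVec_mulVec x u
  obtain ⟨τ, hτ, hfix, c, hc, hτc⟩ := main (x.1 *ᵥ v) (by rw [hxv]; simp [hvj, hvm]) (by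
    intro i hi
    by_cases hij : i = j
    · subst hij; exact Or.inr ⟨Or.inl rfl, Or.inl rfl⟩
    · refine hS i ?_
      rw [hxv] at hi
      simpa [hij] using hi)
  refine ⟨x⁻¹ * τ, P.mul_mem (P.inv_mem hxP) hτ, fun u hu => ?_, c, hc, ?_⟩
  · rw [coe_mul_mulVec, hfix u hu, hxfix' u hu]
  · have h1 := hxfix' _ hτc
    rw [mulVec_sub, mulVec_smul, inv_mulVec_mulVec, ← coe_mul_mulVec] at h1
    rw [h1]
    exact hτc

omit [Fintype ι] in
theorem mem_coordFlag_succ {j : ι} {x : ι → ℂ} (hx : x ∈ coordFlag b (b j + 1)) :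
    x - x j • Pi.single j 1 ∈ coordFlag b (b j) := by
  intro i hi
  rcases eq_or_lt_of_le hi with h | h
  · have : i = j := b.injective (Fin.ext h.symm)
    subst this
    simp
  · have hij : i ≠ j := by rintro rfl; exact lt_irrefl _ h
    simp [hij, hx i h]

/-- Triangularisation inside a group `P`: if each partial flag stable under a conjugate of `K` by
an element of `P` has an extension by a line, the line being linked to the next coordinate
line by transvections in `P`, then an element of `P` conjugates `K` into triangular form. -/
theorem exists_conj_upperTri {P : Subgroup (SL ι)} (K : Set (SL ι))
    (H : ∀ q ∈ P, ∀ j : ι, (∀ k ≤ (b j : ℕ), ∀ g ∈ K, ∀ x ∈ coordFlag b k,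
        (q⁻¹ * g * q).1 *ᵥ x ∈ coordFlag b k) →
      ∃ v, v ∉ coordFlag b (b j) ∧
        (∀ i, v i ≠ 0 → b i < b j ∨ ElemIn P i j ∧ ElemIn P j i) ∧
        ∀ g ∈ K, ∃ c : ℂ, (q⁻¹ * g * q).1 *ᵥ v - c • v ∈ coordFlag b (b j)) :
    ∃ q ∈ P, ∀ g ∈ K, q⁻¹ * g * q ∈ upperTri b := by
  have key : ∀ n ≤ N, ∃ q ∈ P, ∀ k ≤ n, ∀ g ∈ K, ∀ x ∈ coordFlag b k,
      (q⁻¹ * g * q).1 *ᵥ x ∈ coordFlag b k := by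
    intro n
    induction n with
    | zero =>
      intro _
      refine ⟨1, P.one_mem, fun k hk g _ x hx => ?_⟩
      obtain rfl : k = 0 := by omega
      rw [coordFlag_zero, Submodule.mem_bot] at hx ⊢
      rw [hx, mulVec_zero]
    | succ n ih =>
      intro hn
      obtain ⟨q, hqP, hq⟩ := ih (by omega)
      obtain ⟨j, hj⟩ : ∃ j, (b j : ℕ) = n := ⟨b.symm ⟨n, by omega⟩, by simp⟩
      subst hj
      obtain ⟨v, hv, hS, hvK⟩ := H q hqP j hq
      obtain ⟨τ, hτ, hfix, c, hc, hτc⟩ := exists_mover b hv hS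
      have hfix' : ∀ u ∈ coordFlag b (b j), (τ⁻¹).1 *ᵥ u = u := by
        intro u hu
        conv_lhs => rw [← hfix u hu]
        exact inv_mulVec_mulVec τ u
      have hlow : ∀ k ≤ (b j : ℕ), ∀ g ∈ K, ∀ x ∈ coordFlag b k,
          ((q * τ)⁻¹ * g * (q * τ)).1 *ᵥ x ∈ coordFlag b k := by
        intro k hk g hg x hx
        have e : (q * τ)⁻¹ * g * (q * τ) = τ⁻¹ * ((q⁻¹ * g * q) * τ) := by group
        rw [e, coe_mul_mulVec, coe_mul_mulVec, hfix x (coordFlag_mono b hk hx), hfix']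
        · exact hq k hk g hg x hx
        · exact coordFlag_mono b hk (hq k hk g hg x hx)
      refine ⟨q * τ, P.mul_mem hqP hτ, fun k hk g hg x hx => ?_⟩
      rcases Nat.lt_or_ge k (b j + 1) with h | h
      · exact hlow k (by omega) g hg x hx
      obtain rfl : k = b j + 1 := le_antisymm hk h
      have hle := coordFlag_mono b (Nat.le_succ (b j : ℕ))
      -- it suffices to treat the last basis vector
      suffices h1 : ((q * τ)⁻¹ * g * (q * τ)).1 *ᵥ Pi.single j 1 ∈ coordFlag b (b j + 1) by
        have h2 := hle (hlow _ le_rfl g hg _ (mem_coordFlag_succ b hx))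
        have h3 := (coordFlag b (b j + 1)).add_mem h2
          ((coordFlag b (b j + 1)).smul_mem (x j) h1)
        rwa [mulVec_sub, mulVec_smul, sub_add_cancel] at h3
      obtain ⟨d, hd⟩ := hvK g hg
      have e : (q * τ)⁻¹ * g * (q * τ) = τ⁻¹ * ((q⁻¹ * g * q) * τ) := by group
      set g' := q⁻¹ * g * q with hg'
      set w := τ.1 *ᵥ Pi.single j 1 with hw
      have h1 : g'.1 *ᵥ w - d • w ∈ coordFlag b (b j) := by
        have a1 := hq _ le_rfl g hg _ hτc
        have a2 := (coordFlag b (b j)).smul_mem c hd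
        have a3 := (coordFlag b (b j)).smul_mem d hτc
        have a4 := (coordFlag b (b j)).sub_mem ((coordFlag b (b j)).add_mem a1 a2) a3
        convert a4 using 1
        rw [mulVec_sub, mulVec_smul, smul_sub, smul_sub, smul_comm c d]
        abel
      have h2 := hfix' _ h1
      rw [mulVec_sub, mulVec_smul, hw, inv_mulVec_mulVec] at h2
      rw [e, coe_mul_mulVec, coe_mul_mulVec]
      have h3 : (τ⁻¹).1 *ᵥ (g'.1 *ᵥ w) = d • Pi.single j 1 + (g'.1 *ᵥ w - d • w) := by
        rw [← h2]; abel
      rw [← hw, h3]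
      exact (coordFlag b (b j + 1)).add_mem ((coordFlag b (b j + 1)).smul_mem d
        (single_mem_coordFlag b (Nat.lt_succ_self _))) (hle h1)
  obtain ⟨q, hqP, hq⟩ := key N le_rfl
  refine ⟨q, hqP, fun g hg k x hx => ?_⟩
  rcases le_or_gt k N with h | h
  · exact hq k h g hg x hx
  · have : coordFlag b k = ⊤ := top_le_iff.1 (by
      rw [← coordFlag_top b]; exact coordFlag_mono b h.le)
    rw [this]
    trivial

/-- **Lie–Kolchin**: a connected solvable subgroup of `SL(ι)` is conjugate to a group of upper
triangular matrices. -/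
theorem exists_le_conjTri {K : Subgroup (SL ι)} (hK : IsConnectedSubgroup K)
    (hsol : Group.IsSolvable K) : ∃ q, K ≤ conjTri b q := by
  obtain ⟨q, -, hq⟩ := exists_conj_upperTri b (P := ⊤) (K : Set (SL ι)) (by
    intro q _ j hst
    -- the flag translated by `q` is stable under `K`
    have hst' : IsStable (K : Set (SL ι)) ((coordFlag b (b j)).map (mulVecLin q.1)) := by
      rintro g hg _ ⟨x, hx, rfl⟩
      refine ⟨_, hst _ le_rfl g hg x hx, ?_⟩
      simp only [mulVecLin_apply]
      rw [coe_mul_mulVec, coe_mul_mulVec, mulVec_inv_mulVec]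
    have hlt : (coordFlag b (b j)).map (mulVecLin q.1) < ⊤ := by
      rw [lt_top_iff_ne_top]
      intro htop
      have : q.1 *ᵥ Pi.single j 1 ∈ (coordFlag b (b j)).map (mulVecLin q.1) := htop ▸ trivial
      obtain ⟨x, hx, hxe⟩ := this
      have h1 : x = Pi.single j 1 := by
        rw [← inv_mulVec_mulVec q x, ← inv_mulVec_mulVec q (Pi.single j 1)]
        exact congrArg _ hxe
      have h2 := hx j le_rfl
      rw [h1] at h2
      simp at h2
    obtain ⟨v, -, hvW, hv⟩ := exists_stable_line_mod hK hlt hst' (fun _ _ _ _ => trivial)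
    refine ⟨(q⁻¹).1 *ᵥ v, fun h => hvW ⟨_, h, ?_⟩, fun i _ => Or.inr
      ⟨Or.inr fun _ _ _ => trivial, Or.inr fun _ _ _ => trivial⟩, fun g hg => ?_⟩
    · exact mulVec_inv_mulVec q v
    · obtain ⟨c, x, hx, hxc⟩ := hv g hg
      refine ⟨c, ?_⟩
      have : (q⁻¹ * g * q).1 *ᵥ ((q⁻¹).1 *ᵥ v) - c • ((q⁻¹).1 *ᵥ v) = x := by
        rw [coe_mul_mulVec, coe_mul_mulVec, mulVec_inv_mulVec, ← mulVec_smul, ← mulVec_sub,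
          ← hxc]
        exact inv_mulVec_mulVec q x
      rw [this]
      exact hx)
  exact ⟨q, fun g hg => (mem_conjTri b).2 (hq g hg)⟩

/-- Triangular matrices are, up to a scalar matrix, multiples of triangular matrices of determinant
one. -/
theorem exists_decomp_upperTri [Nonempty ι] {a : Matrix ι ι ℂ} (ha : a ∈ flagAlg (coordFlag b)) :
    ∃ (c d : ℂ) (u : SL ι), u ∈ upperTri b ∧ a = d • u.1 - c • 1 := by
  obtain ⟨c, hc⟩ : ∃ c : ℂ, (a + c • 1).det ≠ 0 := by
    by_contra hcon
    push Not at hcon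
    have : (-a).charpoly = 0 := by
      refine Polynomial.eq_zero_of_infinite_isRoot _ (Set.infinite_univ.mono fun c _ => ?_)
      change Polynomial.IsRoot _ _
      rw [Polynomial.IsRoot, eval_charpoly, sub_neg_eq_add, add_comm, scalar_apply,
        ← smul_one_eq_diagonal]
      exact hcon c
    exact (-a).charpoly_monic.ne_zero this
  obtain ⟨d, hd⟩ := IsAlgClosed.exists_pow_nat_eq (a + c • 1).det (Fintype.card_pos (α := ι))
  have hd0 : d ≠ 0 := by
    rintro rfl
    rw [zero_pow Fintype.card_ne_zero] at hd
    exact hc hd.symm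
  refine ⟨c, d, ⟨d⁻¹ • (a + c • 1), ?_⟩, ?_, ?_⟩
  · rw [det_smul, inv_pow, hd, inv_mul_cancel₀ hc]
  · exact (flagAlg (coordFlag b)).smul_mem ((flagAlg (coordFlag b)).add_mem ha
      ((flagAlg (coordFlag b)).smul_mem (one_mem _) c)) _
  · rw [smul_smul, mul_inv_cancel₀ hd0, one_smul, add_sub_cancel_right]

/-- Distinct conjugates of the triangular group are not contained in each other. -/
theorem conjTri_le_upperTri {q : SL ι} (h : upperTri b ≤ conjTri b q) :
    conjTri b q ≤ upperTri b := by
  rcases isEmpty_or_nonempty ι with hι | hι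
  · intro g _
    have : g = 1 := Subtype.ext (by ext i; exact hι.elim i)
    rw [this]
    exact one_mem _
  -- conjugation by `q⁻¹` maps the algebra of triangular matrices injectively into itself
  have hmap : ∀ a ∈ flagAlg (coordFlag b), (q⁻¹).1 * a * q.1 ∈ flagAlg (coordFlag b) := by
    intro a ha
    obtain ⟨c, d, u, hu, rfl⟩ := exists_decomp_upperTri b ha
    have h1 : (q⁻¹).1 * (d • u.1 - c • 1) * q.1 = d • (q⁻¹ * u * q).1 - c • 1 := by
      have h2 : (q⁻¹).1 * q.1 = 1 := congrArg Subtype.val (inv_mul_cancel q)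
      rw [mul_sub, sub_mul, mul_smul_comm, smul_mul_assoc, mul_smul_comm, smul_mul_assoc, mul_one,
        h2]
      rfl
    rw [h1]
    exact (flagAlg (coordFlag b)).sub_mem ((flagAlg (coordFlag b)).smul_mem
      ((mem_conjTri b).1 (h hu)) d) ((flagAlg (coordFlag b)).smul_mem (one_mem _) c)
  let f : flagAlg (coordFlag b) →ₗ[ℂ] flagAlg (coordFlag b) :=
    { toFun := fun a => ⟨_, hmap a.1 a.2⟩
      map_add' := fun a c => Subtype.ext (by simp [mul_add, add_mul])
      map_smul' := fun c a => Subtype.ext (by simp) }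
  have hq1 : q.1 * (q⁻¹).1 = 1 := congrArg Subtype.val (mul_inv_cancel q)
  have hback : ∀ a : Matrix ι ι ℂ, q.1 * ((q⁻¹).1 * a * q.1) * (q⁻¹).1 = a := by
    intro a
    calc q.1 * ((q⁻¹).1 * a * q.1) * (q⁻¹).1 = (q.1 * (q⁻¹).1) * a * (q.1 * (q⁻¹).1) := by
          simp only [mul_assoc]
      _ = a := by rw [hq1, one_mul, mul_one]
  have hf : Function.Injective f := by
    intro x y hxy
    have h1 : (q⁻¹).1 * x.1 * q.1 = (q⁻¹).1 * y.1 * q.1 := congrArg Subtype.val hxy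
    refine Subtype.ext ?_
    rw [← hback x.1, h1, hback]
  intro g hg
  obtain ⟨a, ha⟩ := (LinearMap.injective_iff_surjective.1 hf) ⟨_, (mem_conjTri b).1 hg⟩
  have h1 : (q⁻¹).1 * a.1 * q.1 = (q⁻¹).1 * g.1 * q.1 := congrArg Subtype.val ha
  have h2 : a.1 = g.1 := by rw [← hback a.1, h1, hback]
  rw [upperTri, mem_algGroup, ← h2]
  exact a.2

theorem conjTri_le_of_le {q q' : SL ι} (h : conjTri b q ≤ conjTri b q') :
    conjTri b q' ≤ conjTri b q := by
  have h1 : conjTri b (q⁻¹ * q') ≤ upperTri b := by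
    refine conjTri_le_upperTri b fun g hg => ?_
    have h2 := h (show q * g * q⁻¹ ∈ conjTri b q by
      rw [mem_conjTri]; simpa [mul_assoc] using hg)
    rw [mem_conjTri] at h2 ⊢
    convert h2 using 1
    group
  intro g hg
  rw [mem_conjTri] at hg ⊢
  refine h1 ?_
  rw [mem_conjTri]
  convert hg using 1
  group

theorem isBorel_conjTri (q : SL ι) : IsBorel (conjTri b q) := by
  refine ⟨conjTri_spec b q, fun K hK hle => ?_⟩
  obtain ⟨q', hq'⟩ := exists_le_conjTri b hK.2.1 hK.2.2
  exact hq'.trans (conjTri_le_of_le b (hle.trans hq'))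

theorem IsBorel.exists_eq_conjTri {B : Subgroup (SL ι)} (hB : IsBorel B) :
    ∃ q, B = conjTri b q := by
  obtain ⟨q, hq⟩ := exists_le_conjTri b hB.prop.2.1 hB.prop.2.2
  exact ⟨q, le_antisymm hq (hB.2 (conjTri_spec b q) hq)⟩

end Borel

/-! ### Parabolic subgroups -/

section Parabolic

variable {ι : Type} [Fintype ι] [DecidableEq ι] {N : ℕ} {b : ι ≃ Fin N}

/-- A polynomial curve lying in a closed set except possibly at `0` lies in it at `0` as well. -/
theorem mem_of_curve_zero {Z : Set (SL ι)} (hZ : ZClosed Z) {M : ℂ → Matrix ι ι ℂ}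
    (hM : MatMem (regOn Set.univ) M) (hdet : ∀ s, (M s).det = 1)
    (h : ∀ s ≠ 0, (⟨M s, hdet s⟩ : SL ι) ∈ Z) : (⟨M 0, hdet 0⟩ : SL ι) ∈ Z := by
  obtain ⟨I, rfl⟩ := zClosed_iff.1 hZ
  intro p hp
  by_contra hne
  have h1 := infinite_ne_zero_of_regOn (D := Set.univ) (by simp) (hM.eval p) ⟨0, trivial, hne⟩
  refine (infinite_of_compl_finite h1) ((Set.finite_singleton (0 : ℂ)).subset ?_)
  rintro s ⟨-, hs⟩
  by_contra hs0
  exact hs (h s hs0 p hp)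

theorem ElemIn.of_le {P : Subgroup (SL ι)} (hP : upperTri b ≤ P) {i j : ι} (h : b i ≤ b j) :
    ElemIn P i j := by
  rcases eq_or_ne i j with rfl | hij
  · exact Or.inl rfl
  refine Or.inr fun t g hg => hP ?_
  rw [upperTri, mem_algGroup, mem_flagAlg_coordFlag, hg]
  intro k l hkl
  have hkl' : k ≠ l := by rintro rfl; exact lt_irrefl _ hkl
  rw [Matrix.add_apply, one_apply_ne hkl', zero_add, Matrix.single_apply, if_neg]
  rintro ⟨rfl, rfl⟩
  exact absurd h (not_le.2 hkl)

theorem ElemIn.trans {P : Subgroup (SL ι)} {i j k : ι} (h : ElemIn P i j) (h' : ElemIn P j k) :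
    ElemIn P i k := by
  rcases eq_or_ne i j with rfl | hij
  · exact h'
  rcases eq_or_ne j k with rfl | hjk
  · exact h
  rcases eq_or_ne i k with rfl | hik
  · exact Or.inl rfl
  refine Or.inr fun t g hg => ?_
  let x : SL ι := SpecialLinearGroup.transvection hij t
  let y : SL ι := SpecialLinearGroup.transvection hjk 1
  have hx : x ∈ P := h.resolve_left hij t x rfl
  have hy : y ∈ P := h'.resolve_left hjk 1 y rfl
  have key : g * (y * x) = x * y := by
    refine Subtype.ext ?_
    change g.1 * ((1 + Matrix.single j k 1) * (1 + Matrix.single i j t)) =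
      (1 + Matrix.single i j t) * (1 + Matrix.single j k 1)
    rw [hg]
    simp [mul_add, add_mul, hik.symm, hjk.symm]
    abel
  rw [eq_mul_inv_of_mul_eq key]
  exact P.mul_mem (P.mul_mem hx hy) (P.inv_mem (P.mul_mem hy hx))

/-- A diagonal matrix of determinant one, with entries `s⁻¹` and `s` in two places. -/
noncomputable def diagPair (a j : ι) (haj : a ≠ j) (s : ℂ) (hs : s ≠ 0) : SL ι :=
  ⟨diagonal (Function.update (Function.update 1 a s⁻¹) j s), by
    rw [det_diagonal, Finset.prod_update_of_mem (Finset.mem_univ _),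
      Finset.prod_update_of_mem (by simp [haj])]
    simp [hs]⟩

theorem diagonal_mem_upperTri {g : SL ι} {d : ι → ℂ} (h : g.1 = diagonal d) : g ∈ upperTri b := by
  rw [upperTri, mem_algGroup, mem_flagAlg_coordFlag, h]
  intro i j hij
  exact diagonal_apply_ne _ (by rintro rfl; exact lt_irrefl _ hij)

/-- If a closed group containing the diagonal matrices contains the transvections `1 + t v ⊗ y`,
then it contains the elementary transvections `1 + t E_{aj}` with `v_a ≠ 0` and `y_j ≠ 0`: these
are limits of conjugates by diagonal matrices. -/
theorem elemIn_of_transv {P : Subgroup (SL ι)} (hc : IsClosedSubgroup P) (hP : upperTri b ≤ P)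
    {v y : ι → ℂ} (hyv : y ⬝ᵥ v = 0)
    (h : ∀ t : ℂ, ∀ g : SL ι, g.1 = 1 + t • vecMulVec v y → g ∈ P) {a j : ι} (ha : v a ≠ 0)
    (hj : y j ≠ 0) : ElemIn P a j := by
  rcases eq_or_ne a j with rfl | haj
  · exact Or.inl rfl
  refine Or.inr fun t g hg => ?_
  -- exponents chosen so that the rescaled transvection has only its `(a, j)` entry at `s = 0`
  let α : ι → ℕ := fun i => if i = a then 0 else if i = j then 2 else 1
  let β : ι → ℕ := fun i => if i = a then 2 else if i = j then 0 else 1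
  have hαβ : ∀ i, α i + β i = 2 := by
    intro i
    simp only [α, β]
    split_ifs <;> rfl
  let t' : ℂ := t * (v a)⁻¹ * (y j)⁻¹
  let V : ℂ → ι → ℂ := fun s i => v i * s ^ α i
  let Y : ℂ → ι → ℂ := fun s i => y i * s ^ β i
  have hYV : ∀ s, Y s ⬝ᵥ V s = 0 := by
    intro s
    have : Y s ⬝ᵥ V s = s ^ 2 * (y ⬝ᵥ v) := by
      simp only [dotProduct, Finset.mul_sum, Y, V]
      refine Finset.sum_congr rfl fun i _ => ?_
      rw [← hαβ i]; ring
    rw [this, hyv, mul_zero]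
  have hM : MatMem (regOn Set.univ) (fun s => 1 + t' • vecMulVec (V s) (Y s)) := by
    refine (MatMem.const 1).add (MatMem.smul (Subalgebra.algebraMap_mem _ t') fun i k => ?_)
    refine Subalgebra.mul_mem _ (Subalgebra.mul_mem _ (Subalgebra.algebraMap_mem _ (v i)) ?_)
      (Subalgebra.mul_mem _ (Subalgebra.algebraMap_mem _ (y k)) ?_)
    · exact Subalgebra.pow_mem _ id_mem_regOn _
    · exact Subalgebra.pow_mem _ id_mem_regOn _
  have hdet : ∀ s, (1 + t' • vecMulVec (V s) (Y s)).det = 1 := by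
    intro s
    rw [← smul_vecMulVec, det_one_add_vecMulVec, dotProduct_smul, hYV, smul_zero, add_zero]
  have hlim := mem_of_curve_zero hc hM hdet (by
    intro s hs
    let d := diagPair a j haj s hs
    let δ : ι → ℂ := Function.update (Function.update 1 a s⁻¹) j s
    have hd : d ∈ P := hP (diagonal_mem_upperTri rfl)
    have hδα : ∀ i, δ i * s = s ^ α i := by
      intro i
      by_cases hi : i = j
      · subst hi; simp [δ, α, haj.symm, pow_two]
      · by_cases hi' : i = a
        · subst hi'; simp [δ, α, haj, hs]
        · simp [δ, α, hi, hi']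
    have hδβ : ∀ i, s ^ β i * δ i = s := by
      intro i
      by_cases hi : i = j
      · subst hi; simp [δ, β, haj.symm]
      · by_cases hi' : i = a
        · subst hi'; simp [δ, β, haj, pow_two, hs]
        · simp [δ, β, hi, hi']
    have hdet' : (1 + (t' * s ^ 2) • vecMulVec v y).det = 1 := by
      rw [← smul_vecMulVec, det_one_add_vecMulVec, dotProduct_smul, hyv, smul_zero, add_zero]
    let x : SL ι := ⟨_, hdet'⟩
    let x' : SL ι := ⟨_, hdet s⟩
    have h1 : x ∈ P := h _ _ rfl
    have key : x' * d = d * x := by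
      refine Subtype.ext ?_
      change (1 + t' • vecMulVec (V s) (Y s)) * diagonal δ =
        diagonal δ * (1 + (t' * s ^ 2) • vecMulVec v y)
      ext i k
      simp only [mul_diagonal, diagonal_mul, Matrix.add_apply, Matrix.smul_apply, vecMulVec_apply,
        smul_eq_mul, V, Y]
      have h2 : (1 : Matrix ι ι ℂ) i k * δ k = δ i * (1 : Matrix ι ι ℂ) i k := by
        by_cases hik : i = k
        · subst hik; ring
        · simp [hik]
      linear_combination h2 + t' * v i * y k * s ^ α i * hδβ k - t' * v i * y k * s * hδα i
    change x' ∈ P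
    rw [eq_mul_inv_of_mul_eq key]
    exact P.mul_mem (P.mul_mem hd h1) (P.inv_mem hd))
  suffices he : g = ⟨1 + t' • vecMulVec (V 0) (Y 0), hdet 0⟩ by
    rw [he]
    exact hlim
  refine Subtype.ext ?_
  rw [hg]
  congr 1
  ext i k
  simp only [Matrix.single_apply, Matrix.smul_apply, vecMulVec_apply, V, Y, smul_eq_mul]
  by_cases hi : a = i
  · by_cases hk : j = k
    · subst hi; subst hk
      simp [α, β, t', haj.symm]
      field_simp
    · have : β k ≠ 0 := by
        simp only [β]
        split_ifs <;> simp_all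
      simp [hk, this]
  · have : α i ≠ 0 := by
      simp only [α]
      split_ifs <;> simp_all
    simp [hi, this]

/-- If an element of `P` does not preserve the coordinate subspace of an initial segment `S`, then
`P` contains an elementary transvection which does not preserve it either. -/
theorem exists_elemIn {P : Subgroup (SL ι)} (hc : IsClosedSubgroup P) (hP : upperTri b ≤ P)
    (S : Set ι) (hS : ∀ i j, b i ≤ b j → j ∈ S → i ∈ S) {p : SL ι} (hp : p ∈ P) {a c : ι}
    (ha : a ∉ S) (hcS : c ∈ S) (hac : p.1 a c ≠ 0) : ∃ j ∈ S, ElemIn P a j := by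
  let FS : Submodule ℂ (ι → ℂ) :=
    { carrier := {x | ∀ i ∉ S, x i = 0}
      zero_mem' := fun _ _ => rfl
      add_mem' := fun hx hy i hi => by simp [hx i hi, hy i hi]
      smul_mem' := fun r x hx i hi => by simp [hx i hi] }
  let Y := (coordFlag b (b c + 1)).map (mulVecLin p.1)
  have hinj : Function.Injective (mulVecLin p.1) := fun x y hxy => by
    rw [← inv_mulVec_mulVec p x, ← inv_mulVec_mulVec p y]
    exact congrArg _ hxy
  have hle : coordFlag b (b c + 1) ≤ FS := by
    intro x hx i hi
    refine hx i ?_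
    by_contra hlt
    exact hi (hS i c (by rw [Fin.le_def]; omega) hcS)
  set v := p.1 *ᵥ Pi.single c 1 with hv
  have hvY : v ∈ Y := ⟨_, single_mem_coordFlag b (Nat.lt_succ_self _), rfl⟩
  have hva : v a ≠ 0 := by rw [hv]; simpa using hac
  have hnot : ¬ FS ≤ Y := by
    intro hFY
    have heq : FS = Y := by
      refine Submodule.eq_of_le_of_finrank_le hFY ?_
      rw [← (Submodule.equivMapOfInjective _ hinj _).finrank_eq]
      exact Submodule.finrank_mono hle
    rw [← heq] at hvY
    exact hva (hvY a ha)
  obtain ⟨u, huS, huY⟩ := SetLike.not_le_iff_exists.1 hnot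
  obtain ⟨ψ, hψY, hψu⟩ := exists_functional huY
  let y : ι → ℂ := fun i => ψ (Pi.single i 1)
  have hy : ∀ x, y ⬝ᵥ x = ψ x := by
    intro x
    rw [LinearMap.pi_apply_eq_sum_univ ψ x]
    refine Finset.sum_congr rfl fun i _ => ?_
    rw [smul_eq_mul, mul_comm]
    congr 1
    exact congrArg ψ (by ext k; simp [Pi.single_apply, eq_comm])
  obtain ⟨j, hjS, hyj⟩ : ∃ j ∈ S, y j ≠ 0 := by
    by_contra hcon
    push Not at hcon
    have : y ⬝ᵥ u = 0 := Finset.sum_eq_zero fun i _ => by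
      by_cases hi : i ∈ S
      · simp [hcon i hi]
      · simp [huS i hi]
    rw [hy, hψu] at this
    exact one_ne_zero this
  refine ⟨j, hjS, elemIn_of_transv hc hP (v := v) (y := y) (by rw [hy]; exact hψY v hvY)
    (fun t g hg => ?_) hva hyj⟩
  -- the transvection is conjugate by `p` to a triangular one
  have hz : ∀ l, b l ≤ b c → (y ᵥ* p.1) l = 0 := by
    intro l hl
    have : (y ᵥ* p.1) l = y ⬝ᵥ (p.1 *ᵥ Pi.single l 1) := by
      rw [dotProduct_mulVec]; simp
    rw [this, hy]
    exact hψY _ ⟨_, single_mem_coordFlag b (by rw [Fin.le_def] at hl; omega), rfl⟩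
  have hx0 : (y ᵥ* p.1) ⬝ᵥ (t • Pi.single c 1) = 0 := by
    rw [dotProduct_smul]; simp [hz c le_rfl]
  have hx : transv (t • Pi.single c 1) (y ᵥ* p.1) hx0 ∈ P := by
    refine hP ?_
    rw [upperTri, mem_algGroup, mem_flagAlg_coordFlag]
    intro i l hil
    have hne : i ≠ l := by rintro rfl; exact lt_irrefl _ hil
    change (1 + vecMulVec _ _ : Matrix ι ι ℂ) i l = 0
    rw [Matrix.add_apply, one_apply_ne hne, zero_add, vecMulVec_apply]
    by_cases hi : i = c
    · subst hi; rw [hz l hil.le, mul_zero]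
    · simp [hi]
  have key : g * p = p * transv (t • Pi.single c 1) (y ᵥ* p.1) hx0 := by
    refine Subtype.ext ?_
    change g.1 * p.1 = p.1 * (1 + vecMulVec _ _)
    rw [hg, add_mul, one_mul, mul_add, mul_one, mul_vecMulVec, smul_mul_assoc, vecMulVec_mul,
      mulVec_smul, smul_vecMulVec]
  rw [eq_mul_inv_of_mul_eq key]
  exact P.mul_mem (P.mul_mem hp hx) (P.inv_mem hp)

theorem elemIn_of_entry_ne_zero {P : Subgroup (SL ι)} (hc : IsClosedSubgroup P)
    (hP : upperTri b ≤ P) {p : SL ι} (hp : p ∈ P) {a c : ι} (hac : p.1 a c ≠ 0) :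
    ElemIn P a c := by
  by_contra ha
  obtain ⟨j, hj, haj⟩ := exists_elemIn hc hP {i | ElemIn P i c}
    (fun i j hij hj => (ElemIn.of_le hP hij).trans hj) hp ha (Or.inl rfl) hac
  exact ha (haj.trans hj)

/-- Each element of a closed group containing the triangular group is triangularisable within
that group. -/
theorem exists_conj_mem_upperTri {P : Subgroup (SL ι)} (hc : IsClosedSubgroup P)
    (hP : upperTri b ≤ P) {h : SL ι} (hh : h ∈ P) : ∃ q ∈ P, q⁻¹ * h * q ∈ upperTri b := by
  obtain ⟨q, hq, hqK⟩ := exists_conj_upperTri b (P := P) {h} (by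
    intro q hq j hst
    have hst' := hst _ le_rfl h rfl
    have hh' : q⁻¹ * h * q ∈ P := P.mul_mem (P.mul_mem (P.inv_mem hq) hh) hq
    let FS : Submodule ℂ (ι → ℂ) :=
      { carrier := {x | ∀ i, ¬ ElemIn P i j → x i = 0}
        zero_mem' := fun _ _ => rfl
        add_mem' := fun hx hy i hi => by simp [hx i hi, hy i hi]
        smul_mem' := fun r x hx i hi => by simp [hx i hi] }
    have hlt : coordFlag b (b j) < FS := by
      refine SetLike.lt_iff_le_and_exists.2 ⟨fun x hx i hi => hx i ?_, Pi.single j 1, ?_, ?_⟩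
      · by_contra hlt
        exact hi (ElemIn.of_le hP (by rw [Fin.le_def]; omega))
      · intro i hi
        have : i ≠ j := by rintro rfl; exact hi (Or.inl rfl)
        simp [this]
      · intro h1
        simpa using h1 j le_rfl
    have hFS : ∀ x ∈ FS, (q⁻¹ * h * q).1 *ᵥ x ∈ FS := by
      intro x hx i hi
      refine Finset.sum_eq_zero fun m _ => ?_
      by_contra hne
      have h1 : (q⁻¹ * h * q).1 i m ≠ 0 := left_ne_zero_of_mul hne
      have h2 : ElemIn P m j := by
        by_contra h3
        exact right_ne_zero_of_mul hne (hx m h3)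
      exact hi ((elemIn_of_entry_ne_zero hc hP hh' h1).trans h2)
    obtain ⟨c, v, hvS, hv, hvc⟩ := exists_eigenvector_mod _ hlt hst' hFS
    refine ⟨v, hv, fun i hi => ?_, fun g hg => ?_⟩
    · rcases lt_or_ge (b i) (b j) with h1 | h1
      · exact Or.inl h1
      · refine Or.inr ⟨?_, ElemIn.of_le hP h1⟩
        by_contra h2
        exact hi (hvS i h2)
    · rw [Set.mem_singleton_iff] at hg
      subst hg
      exact ⟨c, hvc⟩)
  exact ⟨q, hq, hqK h rfl⟩

/-- Every element of a parabolic subgroup lies in a Borel subgroup contained in it. -/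
theorem IsParabolic.exists_isBorel_mem {P : Subgroup (SL ι)} (hP : IsParabolic P) {h : SL ι}
    (hh : h ∈ P) : ∃ B, IsBorel B ∧ B ≤ P ∧ h ∈ B := by
  let b : ι ≃ Fin (Fintype.card ι) := Fintype.equivFin ι
  obtain ⟨hc, B, hB, hBP⟩ := hP
  obtain ⟨q₀, rfl⟩ := hB.exists_eq_conjTri b
  let P' : Subgroup (SL ι) := P.comap (MulAut.conj q₀).toMonoidHom
  have hmem : ∀ g, g ∈ P' ↔ q₀ * g * q₀⁻¹ ∈ P := fun g => Iff.rfl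
  have hc' : IsClosedSubgroup P' := by
    refine (@continuous_iff_isClosed _ _ (zariski ι) (zariski ι) (fun g => q₀ * g * q₀⁻¹)).1
      (zContinuous ?_) _ hc
    exact ((MatMem.const q₀.1).mul matMem_coe).mul (MatMem.const (q₀⁻¹).1)
  have hP' : upperTri b ≤ P' := by
    intro g hg
    refine hBP ?_
    rw [mem_conjTri]
    convert hg using 1
    simp [mul_assoc]
  obtain ⟨q, hq, hqh⟩ := exists_conj_mem_upperTri hc' hP' (h := q₀⁻¹ * h * q₀) (by
    rw [hmem]; simpa [mul_assoc] using hh)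
  refine ⟨conjTri b (q₀ * q), isBorel_conjTri b _, fun g hg => ?_, ?_⟩
  · rw [mem_conjTri] at hg
    have h1 := P'.mul_mem (P'.mul_mem hq (hP' hg)) (P'.inv_mem hq)
    rw [hmem] at h1
    convert h1 using 1
    group
  · rw [mem_conjTri]
    convert hqh using 1
    group

theorem isParabolicallyConnected_iff (H : Subgroup (SL ι)) :
    IsParabolicallyConnected H ↔ ∀ B, IsBorel B → IsConnectedSubgroup (B ⊓ H) := by
  constructor
  · exact fun h B hB => h B ⟨hB.prop.1, B, hB, le_rfl⟩
  · intro h P hP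
    rw [isConnectedSubgroup_iff]
    rintro x ⟨hxP, hxH⟩
    obtain ⟨B, hB, hBP, hxB⟩ := hP.exists_isBorel_mem hxP
    refine (isConnectedSubgroup_iff.1 (h B hB) x ⟨hxB, hxH⟩).mono ?_
    exact fun g hg => ⟨hBP hg.1, hg.2⟩

/-- Parabolic connectedness can be tested on stabilizers of flags. -/
theorem isParabolicallyConnected_of_flags {H : Subgroup (SL ι)}
    (h : ∀ (F : ℕ → Submodule ℂ (ι → ℂ)) (N : ℕ), Monotone F → F 0 = ⊥ → F N = ⊤ →
      ∀ x ∈ algGroup (flagAlg F) ⊓ H,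
        JoinedToOne ((algGroup (flagAlg F) ⊓ H : Subgroup (SL ι)) : Set (SL ι)) x) :
    IsParabolicallyConnected H := by
  rw [isParabolicallyConnected_iff]
  intro B hB
  obtain ⟨q, rfl⟩ := hB.exists_eq_conjTri (Fintype.equivFin ι)
  rw [isConnectedSubgroup_iff, conjTri_eq_algGroup]
  refine h _ (Fintype.card ι) (fun i j hij => Submodule.map_mono (coordFlag_mono _ hij)) ?_ ?_
  · simp only [coordFlag_zero, Submodule.map_bot]
  · simp only [coordFlag_top, Submodule.map_top]
    rw [LinearMap.range_eq_top]
    exact fun x => ⟨_, mulVec_inv_mulVec q x⟩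

end Parabolic

/-! ### Idempotents -/

section Idempotents

open Polynomial

/-- Fitting's lemma for polynomials: for `χ ≠ 0` and a number `c` there is a polynomial `f` which is
an idempotent modulo `χ` and cuts out the generalised eigenspace for `c`. -/
theorem exists_spectral_polynomial {χ : ℂ[X]} (hχ : χ ≠ 0) (c : ℂ) :
    ∃ (f u : ℂ[X]) (k : ℕ), k ≠ 0 ∧ χ ∣ (X - C c) ^ k * f ∧ 1 - f = u * (X - C c) ^ k := by
  obtain ⟨r, hr, hrc⟩ := exists_eq_pow_rootMultiplicity_mul_and_not_dvd χ hχ c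
  have hcop : IsCoprime ((X - C c) ^ (χ.rootMultiplicity c + 1)) r :=
    (((irreducible_X_sub_C c).coprime_iff_not_dvd).2 hrc).pow_left
  obtain ⟨u, w, huw⟩ := hcop
  refine ⟨w * r, u, χ.rootMultiplicity c + 1, Nat.succ_ne_zero _, ⟨(X - C c) * w, ?_⟩, ?_⟩
  · conv_rhs => rw [hr]
    ring
  · rw [← huw]; ring

theorem aeval_spectral_idem {R : Type*} [Ring R] [Algebra ℂ R] {a : R} {χ f u : ℂ[X]} {c : ℂ}
    {k : ℕ} (ha : aeval a χ = 0) (h : χ ∣ (X - C c) ^ k * f) (h' : 1 - f = u * (X - C c) ^ k) :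
    aeval a f * aeval a f = aeval a f := by
  have h1 : f - f * f = ((X - C c) ^ k * f) * u := by
    rw [← mul_one_sub, h']; ring
  have h2 : aeval a (f - f * f) = 0 := by
    obtain ⟨s, hs⟩ := h
    rw [h1, hs, map_mul, map_mul, ha, zero_mul, zero_mul]
  rw [map_sub, map_mul, sub_eq_zero] at h2
  exact h2.symm

variable {ι : Type} [Fintype ι] [DecidableEq ι]

/-- The trace of a spectral idempotent is the multiplicity of the eigenvalue. -/
theorem trace_spectral {A : Matrix ι ι ℂ} {χ f u : ℂ[X]} {c : ℂ} {k : ℕ} (ha : aeval A χ = 0)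
    (hk : k ≠ 0) (h : χ ∣ (X - C c) ^ k * f) (h' : 1 - f = u * (X - C c) ^ k) :
    (aeval A f).trace = (A.charpoly.rootMultiplicity c : ℂ) := by
  set π := aeval A f with hπ
  have hidem : π * π = π := aeval_spectral_idem ha h h'
  have hpow : ∀ (n : ℕ) (x : ι → ℂ),
      ((toLin' A - algebraMap ℂ (Module.End ℂ (ι → ℂ)) c) ^ n) x = ((A - c • 1) ^ n) *ᵥ x := by
    intro n x
    have : toLin' A - algebraMap ℂ (Module.End ℂ (ι → ℂ)) c = toLin' (A - c • 1) := by
      rw [map_sub, map_smul, toLin'_one, Algebra.algebraMap_eq_smul_one]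
      rfl
    rw [this, ← toLin'_pow, toLin'_apply]
  have hX : ∀ n : ℕ, aeval A ((X - C c) ^ n) = (A - c • 1) ^ n := by
    intro n
    simp [Algebra.algebraMap_eq_smul_one]
  have hproj : LinearMap.IsProj (Module.End.maxGenEigenspace (toLin' A) c) (toLin' π) := by
    constructor
    · intro x
      rw [Module.End.mem_maxGenEigenspace]
      refine ⟨k, ?_⟩
      rw [← Algebra.algebraMap_eq_smul_one, hpow, toLin'_apply, mulVec_mulVec, ← hX, hπ, ← map_mul]
      obtain ⟨s, hs⟩ := h
      rw [hs, map_mul, ha, zero_mul, zero_mulVec]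
    · intro x hx
      rw [Module.End.mem_maxGenEigenspace] at hx
      obtain ⟨n, hn⟩ := hx
      rw [← Algebra.algebraMap_eq_smul_one, hpow] at hn
      have h1 : ∀ n : ℕ, (1 - π) ^ (n + 1) = 1 - π := by
        intro n
        have hi : IsIdempotentElem (1 - π) := IsIdempotentElem.one_sub hidem
        exact hi.pow_succ_eq n
      have h2 : (1 - π) ^ (n + 1) = aeval A (u ^ (n + 1) * (X - C c) ^ (k * (n + 1) - n)) *
          (A - c • 1) ^ n := by
        rw [← hX, ← map_mul]
        have : (1 - π) = aeval A (1 - f) := by simp [hπ]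
        rw [this, ← map_pow, h', mul_pow, ← pow_mul, mul_assoc, ← pow_add, Nat.sub_add_cancel]
        calc n ≤ 1 * (n + 1) := by omega
          _ ≤ k * (n + 1) := Nat.mul_le_mul_right _ (Nat.one_le_iff_ne_zero.2 hk)
      have h3 : (1 - π) *ᵥ x = 0 := by
        rw [← h1 n, h2, ← mulVec_mulVec, hn, mulVec_zero]
      rw [toLin'_apply]
      rw [sub_mulVec, one_mulVec, sub_eq_zero] at h3
      exact h3.symm
  have h1 := hproj.trace
  rw [trace_toLin'_eq] at h1
  rw [h1, LinearMap.finrank_maxGenEigenspace_eq, ← charpoly_toLin']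

/-- Subtracting a nonzero subidempotent lowers the rank. -/
theorem rank_sub_lt {p e : Matrix ι ι ℂ} (hpe : p * e = e) (hep : e * p = e)
    (hee : e * e = e) (he : e ≠ 0) : (p - e).rank < p.rank := by
  have h1 : (p - e) = p * (1 - e) := by rw [mul_sub, mul_one, hpe]
  obtain ⟨x, hx⟩ : ∃ x, e *ᵥ x ≠ 0 := by
    by_contra hcon
    push Not at hcon
    exact he (Matrix.ext_of_mulVec_single fun i => by rw [hcon, zero_mulVec])
  refine Submodule.finrank_lt_finrank_of_lt (SetLike.lt_iff_le_and_exists.2 ⟨?_, e *ᵥ x, ?_, ?_⟩)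
  · rintro _ ⟨y, rfl⟩
    refine ⟨(1 - e) *ᵥ y, ?_⟩
    simp only [mulVecLin_apply]
    rw [mulVec_mulVec, ← h1]
  · refine ⟨e *ᵥ x, ?_⟩
    rw [mulVecLin_apply, mulVec_mulVec, hpe]
  · rintro ⟨y, hy⟩
    rw [mulVecLin_apply] at hy
    refine hx ?_
    have h2 : e *ᵥ (e *ᵥ x) = 0 := by
      rw [← hy, mulVec_mulVec, mul_sub, hep, hee, sub_self, zero_mulVec]
    rwa [mulVec_mulVec, hee] at h2

end Idempotents

/-! ### Block-diagonal matrices preserving a flag -/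

section Pairs

variable {α β : Type} [Fintype α] [DecidableEq α] [Fintype β] [DecidableEq β]

/-- The pairs `(A, D)` such that `diag(A, D)` preserves the subspaces `F`. -/
def pairAlg (F : ℕ → Submodule ℂ (α ⊕ β → ℂ)) :
    Subalgebra ℂ (Matrix α α ℂ × Matrix β β ℂ) where
  carrier := {x | fromBlocks x.1 0 0 x.2 ∈ flagAlg F}
  mul_mem' {x y} hx hy := by
    have := (flagAlg F).mul_mem hx hy
    rw [fromBlocks_multiply] at this
    simpa using this
  add_mem' {x y} hx hy := by
    have := (flagAlg F).add_mem hx hy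
    rw [fromBlocks_add] at this
    simpa using this
  algebraMap_mem' c := by
    have := (flagAlg F).algebraMap_mem c
    convert this using 1
    rw [Algebra.algebraMap_eq_smul_one, Algebra.algebraMap_eq_smul_one, ← fromBlocks_one,
      fromBlocks_smul]
    simp

theorem mem_pairAlg {F : ℕ → Submodule ℂ (α ⊕ β → ℂ)} {x : Matrix α α ℂ × Matrix β β ℂ} :
    x ∈ pairAlg F ↔ ∀ k, ∀ u ∈ F k,
      Sum.elim (x.1 *ᵥ (u ∘ Sum.inl)) (x.2 *ᵥ (u ∘ Sum.inr)) ∈ F k := by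
  change fromBlocks x.1 0 0 x.2 ∈ flagAlg F ↔ _
  rw [mem_flagAlg]
  simp [fromBlocks_mulVec]

/-- The idempotents of rank one. -/
def IsRankOneIdem {ι : Type} [Fintype ι] (e : Matrix ι ι ℂ) : Prop :=
  ∃ u v : ι → ℂ, v ⬝ᵥ u = 1 ∧ e = vecMulVec u v

theorem IsRankOneIdem.mul_self {ι : Type} [Fintype ι] {e : Matrix ι ι ℂ} (h : IsRankOneIdem e) :
    e * e = e := by
  obtain ⟨u, v, huv, rfl⟩ := h
  rw [vecMulVec_mul_vecMulVec, huv, one_smul]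

theorem IsRankOneIdem.trace {ι : Type} [Fintype ι] {e : Matrix ι ι ℂ} (h : IsRankOneIdem e) :
    e.trace = 1 := by
  obtain ⟨u, v, huv, rfl⟩ := h
  rw [trace_vecMulVec, dotProduct_comm, huv]

theorem IsRankOneIdem.ne_zero {ι : Type} [Fintype ι] {e : Matrix ι ι ℂ} (h : IsRankOneIdem e) :
    e ≠ 0 := by
  rintro rfl
  simpa using h.trace

theorem IsRankOneIdem.det {ι : Type} [Fintype ι] [DecidableEq ι] {e : Matrix ι ι ℂ}
    (h : IsRankOneIdem e) (s : ℂ) : (1 + (s - 1) • e).det = s := by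
  obtain ⟨u, v, huv, rfl⟩ := h
  rw [← smul_vecMulVec, det_one_add_vecMulVec, dotProduct_smul, huv, smul_eq_mul, mul_one,
    add_sub_cancel]

/-- A pair of idempotents, not both zero, each of rank at most one. -/
def IsAtom (e : Matrix α α ℂ × Matrix β β ℂ) : Prop :=
  (IsRankOneIdem e.1 ∧ e.2 = 0) ∨ (e.1 = 0 ∧ IsRankOneIdem e.2) ∨
    (IsRankOneIdem e.1 ∧ IsRankOneIdem e.2)

variable {F : ℕ → Submodule ℂ (α ⊕ β → ℂ)} {N : ℕ}

theorem exists_dotProduct_functional {ι : Type} [Fintype ι] [DecidableEq ι]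
    {W : Submodule ℂ (ι → ℂ)} {v : ι → ℂ} (hv : v ∉ W) :
    ∃ y : ι → ℂ, (∀ w ∈ W, y ⬝ᵥ w = 0) ∧ y ⬝ᵥ v = 1 := by
  obtain ⟨ψ, hψW, hψv⟩ := exists_functional hv
  have hy : ∀ x, (fun i => ψ (Pi.single i 1)) ⬝ᵥ x = ψ x := by
    intro x
    rw [LinearMap.pi_apply_eq_sum_univ ψ x]
    refine Finset.sum_congr rfl fun i _ => ?_
    rw [smul_eq_mul, mul_comm]
    congr 1
    exact congrArg ψ (by ext k; simp [Pi.single_apply, eq_comm])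
  exact ⟨_, fun w hw => by rw [hy, hψW w hw], by rw [hy, hψv]⟩

/-- Each nonzero idempotent of the algebra of block-diagonal matrices preserving a flag dominates
an idempotent with blocks of rank at most one: the relative position of a flag and a
decomposition into two summands is a sum of pieces whose components have dimension at most one. -/
theorem exists_isAtom (hmono : Monotone F) (hN : F N = ⊤)
    {p : Matrix α α ℂ × Matrix β β ℂ} (hp : p ∈ pairAlg F) (hpp : p * p = p) (hp0 : p ≠ 0) :
    ∃ e ∈ pairAlg F, p * e = e ∧ e * p = e ∧ IsAtom e := by
  obtain ⟨p₁, p₂⟩ := p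
  have hpp₁ : p₁ * p₁ = p₁ := congrArg Prod.fst hpp
  have hpp₂ : p₂ * p₂ = p₂ := congrArg Prod.snd hpp
  rw [mem_pairAlg] at hp
  simp only at hp
  have hfix₁ : ∀ x, p₁ *ᵥ (p₁ *ᵥ x) = p₁ *ᵥ x := fun x => by rw [mulVec_mulVec, hpp₁]
  have hfix₂ : ∀ x, p₂ *ᵥ (p₂ *ᵥ x) = p₂ *ᵥ x := fun x => by rw [mulVec_mulVec, hpp₂]
  -- the first member of the flag not killed by `p`
  have hex : ∃ i, ∃ u ∈ F i, p₁ *ᵥ (u ∘ Sum.inl) ≠ 0 ∨ p₂ *ᵥ (u ∘ Sum.inr) ≠ 0 := by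
    by_contra hcon
    push Not at hcon
    refine hp0 (Prod.ext ?_ ?_)
    · refine Matrix.ext_of_mulVec_single fun i => ?_
      have := (hcon N (Sum.elim (Pi.single i 1) 0) (by rw [hN]; trivial)).1
      rw [Sum.elim_comp_inl] at this
      rw [this]; exact (zero_mulVec _).symm
    · refine Matrix.ext_of_mulVec_single fun i => ?_
      have := (hcon N (Sum.elim 0 (Pi.single i 1)) (by rw [hN]; trivial)).2
      rw [Sum.elim_comp_inr] at this
      rw [this]; exact (zero_mulVec _).symm
  classical
  let i := Nat.find hex
  obtain ⟨u, huF, hu⟩ := Nat.find_spec hex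
  have hmin : ∀ j < i, ∀ u ∈ F j, p₁ *ᵥ (u ∘ Sum.inl) = 0 ∧ p₂ *ᵥ (u ∘ Sum.inr) = 0 := by
    intro j hj u hu
    have := Nat.find_min hex hj
    push Not at this
    exact this u hu
  have hvecmul₁ : ∀ x : α → ℂ, (x ᵥ* p₁) ᵥ* p₁ = x ᵥ* p₁ := fun x => by
    rw [vecMul_vecMul, hpp₁]
  have hvecmul₂ : ∀ x : β → ℂ, (x ᵥ* p₂) ᵥ* p₂ = x ᵥ* p₂ := fun x => by
    rw [vecMul_vecMul, hpp₂]
  by_cases hA : ∃ v : α → ℂ, v ≠ 0 ∧ p₁ *ᵥ v = v ∧ Sum.elim v 0 ∈ F i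
  · obtain ⟨v, hv0, hv, hvF⟩ := hA
    obtain ⟨y, -, hy⟩ := exists_dotProduct_functional (W := ⊥) (v := v) (by simpa using hv0)
    have hyv : (y ᵥ* p₁) ⬝ᵥ v = 1 := by rw [← dotProduct_mulVec, hv, hy]
    refine ⟨(vecMulVec v (y ᵥ* p₁), 0), ?_, ?_, ?_, Or.inl ⟨⟨v, _, hyv, rfl⟩, rfl⟩⟩
    · rw [mem_pairAlg]
      intro j w hw
      simp only [rankOne_mulVec, zero_mulVec]
      rcases lt_or_ge j i with hj | hj
      · rw [← dotProduct_mulVec, (hmin j hj w hw).1]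
        simp [(F j).zero_mem]
      · have := (F j).smul_mem ((y ᵥ* p₁) ⬝ᵥ (w ∘ Sum.inl)) (hmono hj hvF)
        convert this using 1
        ext (l | l) <;> simp
    · refine Prod.ext ?_ (mul_zero _)
      change p₁ * vecMulVec _ _ = vecMulVec _ _
      rw [mul_vecMulVec, hv]
    · refine Prod.ext ?_ (zero_mul _)
      change vecMulVec _ _ * p₁ = vecMulVec _ _
      rw [vecMulVec_mul, hvecmul₁]
  by_cases hB : ∃ v : β → ℂ, v ≠ 0 ∧ p₂ *ᵥ v = v ∧ Sum.elim (0 : α → ℂ) v ∈ F i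
  · obtain ⟨v, hv0, hv, hvF⟩ := hB
    obtain ⟨y, -, hy⟩ := exists_dotProduct_functional (W := ⊥) (v := v) (by simpa using hv0)
    have hyv : (y ᵥ* p₂) ⬝ᵥ v = 1 := by rw [← dotProduct_mulVec, hv, hy]
    refine ⟨(0, vecMulVec v (y ᵥ* p₂)), ?_, ?_, ?_, Or.inr (Or.inl ⟨rfl, v, _, hyv, rfl⟩)⟩
    · rw [mem_pairAlg]
      intro j w hw
      simp only [rankOne_mulVec, zero_mulVec]
      rcases lt_or_ge j i with hj | hj
      · rw [← dotProduct_mulVec, (hmin j hj w hw).2]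
        simp [(F j).zero_mem]
      · have := (F j).smul_mem ((y ᵥ* p₂) ⬝ᵥ (w ∘ Sum.inr)) (hmono hj hvF)
        convert this using 1
        ext (l | l) <;> simp
    · refine Prod.ext (mul_zero _) ?_
      change p₂ * vecMulVec _ _ = vecMulVec _ _
      rw [mul_vecMulVec, hv]
    · refine Prod.ext (zero_mul _) ?_
      change vecMulVec _ _ * p₂ = vecMulVec _ _
      rw [vecMulVec_mul, hvecmul₂]
  -- the remaining case: `v = v₁ + v₂` enters the flag before `v₁` and `v₂`
  set v₁ := p₁ *ᵥ (u ∘ Sum.inl) with hv₁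
  set v₂ := p₂ *ᵥ (u ∘ Sum.inr) with hv₂
  have hvF : Sum.elim v₁ v₂ ∈ F i := hp i u huF
  have hv₁0 : v₁ ≠ 0 := by
    intro h0
    rw [h0] at hvF hu
    exact hB ⟨v₂, hu.resolve_left (fun h => h rfl), hfix₂ _, hvF⟩
  have hv₂0 : v₂ ≠ 0 := by
    intro h0
    rw [h0] at hvF
    exact hA ⟨v₁, hv₁0, hfix₁ _, hvF⟩
  have hex' : ∃ k, Sum.elim v₁ 0 ∈ F k := ⟨N, by rw [hN]; trivial⟩
  let k := Nat.find hex'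
  have hkF : Sum.elim v₁ 0 ∈ F k := Nat.find_spec hex'
  have hik : i < k := by
    by_contra hcon
    exact hA ⟨v₁, hv₁0, hfix₁ _, hmono (not_lt.1 hcon) hkF⟩
  have hk1 : Sum.elim v₁ 0 ∉ F (k - 1) := Nat.find_min hex' (show k - 1 < k by omega)
  obtain ⟨y, hyF, hy⟩ := exists_dotProduct_functional hk1
  have hsplit : ∀ w : α ⊕ β → ℂ,
      y ⬝ᵥ w = (y ∘ Sum.inl) ⬝ᵥ (w ∘ Sum.inl) + (y ∘ Sum.inr) ⬝ᵥ (w ∘ Sum.inr) := by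
    intro w
    simp [dotProduct, Fintype.sum_sum_type]
  have hy₁ : (y ∘ Sum.inl) ⬝ᵥ v₁ = 1 := by
    rw [hsplit] at hy
    simpa using hy
  have hy₂ : (y ∘ Sum.inr) ⬝ᵥ v₂ = -1 := by
    have := hyF _ (hmono (show i ≤ k - 1 by omega) hvF)
    rw [hsplit] at this
    simp only [Sum.elim_comp_inl, Sum.elim_comp_inr, hy₁] at this
    linear_combination this
  have hφ₁ : ((y ∘ Sum.inl) ᵥ* p₁) ⬝ᵥ v₁ = 1 := by
    rw [← dotProduct_mulVec, hv₁, hfix₁, ← hv₁, hy₁]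
  have hφ₂ : (-((y ∘ Sum.inr) ᵥ* p₂)) ⬝ᵥ v₂ = 1 := by
    rw [neg_dotProduct, ← dotProduct_mulVec, hv₂, hfix₂, ← hv₂, hy₂, neg_neg]
  refine ⟨(vecMulVec v₁ ((y ∘ Sum.inl) ᵥ* p₁), vecMulVec v₂ (-((y ∘ Sum.inr) ᵥ* p₂))), ?_, ?_, ?_,
    Or.inr (Or.inr ⟨⟨v₁, _, hφ₁, rfl⟩, v₂, _, hφ₂, rfl⟩)⟩
  · rw [mem_pairAlg]
    intro j w hw
    simp only [rankOne_mulVec, neg_dotProduct, ← dotProduct_mulVec]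
    rcases lt_or_ge j i with hj | hj
    · rw [(hmin j hj w hw).1, (hmin j hj w hw).2]
      simp [(F j).zero_mem]
    rcases lt_or_ge j k with hjk | hjk
    · -- here the two coefficients agree
      have h1 := hyF _ (hmono (show j ≤ k - 1 by omega) (hp j w hw))
      rw [hsplit] at h1
      simp only [Sum.elim_comp_inl, Sum.elim_comp_inr] at h1
      rw [← eq_neg_iff_add_eq_zero] at h1
      rw [← h1]
      have := (F j).smul_mem ((y ∘ Sum.inl) ⬝ᵥ p₁ *ᵥ (w ∘ Sum.inl)) (hmono hj hvF)
      convert this using 1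
      ext (l | l) <;> simp
    · have h1 := hmono hjk hkF
      have h2 := (F j).sub_mem (hmono hj hvF) h1
      have := (F j).add_mem ((F j).smul_mem ((y ∘ Sum.inl) ⬝ᵥ p₁ *ᵥ (w ∘ Sum.inl)) h1)
        ((F j).smul_mem (-((y ∘ Sum.inr) ⬝ᵥ p₂ *ᵥ (w ∘ Sum.inr))) h2)
      convert this using 1
      ext (l | l) <;> simp
  · refine Prod.ext ?_ ?_
    · change p₁ * vecMulVec _ _ = vecMulVec _ _
      rw [mul_vecMulVec, hv₁, hfix₁]
    · change p₂ * vecMulVec _ _ = vecMulVec _ _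
      rw [mul_vecMulVec, hv₂, hfix₂]
  · refine Prod.ext ?_ ?_
    · change vecMulVec _ _ * p₁ = vecMulVec _ _
      rw [vecMulVec_mul, hvecmul₁]
    · change vecMulVec _ _ * p₂ = vecMulVec _ _
      rw [vecMulVec_mul, neg_vecMul, hvecmul₂]

/-- Decomposing an idempotent into atoms and counting them by type. -/
theorem exists_atom_count (hmono : Monotone F) (hN : F N = ⊤)
    {p : Matrix α α ℂ × Matrix β β ℂ} (hp : p ∈ pairAlg F) (hpp : p * p = p) :
    ∃ na nb nc : ℕ, p.1.trace = (na + nc : ℕ) ∧ p.2.trace = (nb + nc : ℕ) ∧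
      (na ≠ 0 → ∃ e ∈ pairAlg F, IsRankOneIdem e.1 ∧ e.2 = 0) ∧
      (nb ≠ 0 → ∃ e ∈ pairAlg F, e.1 = 0 ∧ IsRankOneIdem e.2) ∧
      (nc ≠ 0 → ∃ e ∈ pairAlg F, IsRankOneIdem e.1 ∧ IsRankOneIdem e.2) := by
  induction hr : p.1.rank + p.2.rank using Nat.strong_induction_on generalizing p with
  | _ r ih =>
    by_cases hp0 : p = 0
    · subst hp0
      exact ⟨0, 0, 0, by simp, by simp, by simp, by simp, by simp⟩
    obtain ⟨e, he, hpe, hep, hat⟩ := exists_isAtom hmono hN hp hpp hp0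
    have hee : e * e = e := by
      rcases hat with ⟨h1, h2⟩ | ⟨h1, h2⟩ | ⟨h1, h2⟩
      · exact Prod.ext h1.mul_self (by simp [h2])
      · exact Prod.ext (by simp [h1]) h2.mul_self
      · exact Prod.ext h1.mul_self h2.mul_self
    have hq : (p - e) * (p - e) = p - e := by
      rw [sub_mul, mul_sub, mul_sub, hpp, hpe, hep, hee, sub_self, sub_zero]
    have hlt₁ : e.1 ≠ 0 → (p - e).1.rank < p.1.rank := fun h0 =>
      rank_sub_lt (congrArg Prod.fst hpe) (congrArg Prod.fst hep) (congrArg Prod.fst hee) h0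
    have hlt₂ : e.2 ≠ 0 → (p - e).2.rank < p.2.rank := fun h0 =>
      rank_sub_lt (congrArg Prod.snd hpe) (congrArg Prod.snd hep) (congrArg Prod.snd hee) h0
    have heq₁ : e.1 = 0 → (p - e).1.rank = p.1.rank := fun h0 => by simp [h0]
    have heq₂ : e.2 = 0 → (p - e).2.rank = p.2.rank := fun h0 => by simp [h0]
    have ht₁ : (p - e).1.trace = p.1.trace - e.1.trace := trace_sub _ _
    have ht₂ : (p - e).2.trace = p.2.trace - e.2.trace := trace_sub _ _
    rcases hat with ⟨h1, h2⟩ | ⟨h1, h2⟩ | ⟨h1, h2⟩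
    · obtain ⟨na, nb, nc, ha, hb, hA, hB, hC⟩ := ih _ (by
        have := hlt₁ h1.ne_zero; have := heq₂ h2; omega) (sub_mem hp he) hq rfl
      refine ⟨na + 1, nb, nc, ?_, ?_, fun _ => ⟨e, he, h1, h2⟩, hB, hC⟩
      · rw [ht₁, h1.trace] at ha
        push_cast at ha ⊢
        linear_combination ha
      · rw [ht₂, h2, trace_zero, sub_zero] at hb
        exact hb
    · obtain ⟨na, nb, nc, ha, hb, hA, hB, hC⟩ := ih _ (by
        have := hlt₂ h2.ne_zero; have := heq₁ h1; omega) (sub_mem hp he) hq rfl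
      refine ⟨na, nb + 1, nc, ?_, ?_, hA, fun _ => ⟨e, he, h1, h2⟩, hC⟩
      · rw [ht₁, h1, trace_zero, sub_zero] at ha
        exact ha
      · rw [ht₂, h2.trace] at hb
        push_cast at hb ⊢
        linear_combination hb
    · obtain ⟨na, nb, nc, ha, hb, hA, hB, hC⟩ := ih _ (by
        have := hlt₁ h1.ne_zero; have := hlt₂ h2.ne_zero; omega) (sub_mem hp he) hq rfl
      refine ⟨na, nb, nc + 1, ?_, ?_, hA, hB, fun _ => ⟨e, he, h1, h2⟩⟩
      · rw [ht₁, h1.trace] at ha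
        push_cast at ha ⊢
        linear_combination ha
      · rw [ht₂, h2.trace] at hb
        push_cast at hb ⊢
        linear_combination hb

theorem aeval_prod_mk (f : Polynomial ℂ) (A : Matrix α α ℂ) (D : Matrix β β ℂ) :
    Polynomial.aeval (A, D) f = (Polynomial.aeval A f, Polynomial.aeval D f) :=
  Prod.ext (Polynomial.aeval_algHom_apply (AlgHom.fst ℂ _ _) (A, D) f).symm
    (Polynomial.aeval_algHom_apply (AlgHom.snd ℂ _ _) (A, D) f).symm

/-- If all atoms have both components nonzero, then the two blocks of an element of the algebra
have the same eigenvalues with the same multiplicities. -/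
theorem charpoly_eq_of_no_atoms (hmono : Monotone F) (hN : F N = ⊤)
    (hA : ¬ ∃ e ∈ pairAlg F, IsRankOneIdem e.1 ∧ e.2 = 0)
    (hB : ¬ ∃ e ∈ pairAlg F, e.1 = 0 ∧ IsRankOneIdem e.2)
    {A : Matrix α α ℂ} {D : Matrix β β ℂ} (h : (A, D) ∈ pairAlg F) : A.charpoly = D.charpoly := by
  have hroots : A.charpoly.roots = D.charpoly.roots := by
    ext c
    rw [Polynomial.count_roots, Polynomial.count_roots]
    obtain ⟨f, u, k, hk, hf, hfu⟩ := exists_spectral_polynomial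
      (mul_ne_zero A.charpoly_monic.ne_zero D.charpoly_monic.ne_zero) c
    have hA0 : Polynomial.aeval A (A.charpoly * D.charpoly) = 0 := by
      rw [map_mul, aeval_self_charpoly, zero_mul]
    have hD0 : Polynomial.aeval D (A.charpoly * D.charpoly) = 0 := by
      rw [map_mul, aeval_self_charpoly, mul_zero]
    have hmem : Polynomial.aeval (A, D) f ∈ pairAlg F := 
      Algebra.adjoin_le (Set.singleton_subset_iff.2 h)
        (Polynomial.aeval_mem_adjoin_singleton ℂ _)
    rw [aeval_prod_mk] at hmem
    obtain ⟨na, nb, nc, h1, h2, h3, h4, -⟩ := exists_atom_count hmono hN hmem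
      (Prod.ext (aeval_spectral_idem hA0 hf hfu) (aeval_spectral_idem hD0 hf hfu))
    have hna : na = 0 := by
      by_contra h0
      exact hA (h3 h0)
    have hnb : nb = 0 := by
      by_contra h0
      exact hB (h4 h0)
    simp only at h1 h2
    rw [trace_spectral hA0 hk hf hfu] at h1
    rw [trace_spectral hD0 hk hf hfu] at h2
    have h1' := Nat.cast_injective h1
    have h2' := Nat.cast_injective h2
    rw [h1', h2', hna, hnb]
  rw [(IsAlgClosed.splits A.charpoly).eq_prod_roots_of_monic A.charpoly_monic,
    (IsAlgClosed.splits D.charpoly).eq_prod_roots_of_monic D.charpoly_monic, hroots]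

end Pairs

/-! ### The subgroups of block-diagonal matrices -/

section BlockGroups

theorem mem_SLxSL {m n : ℕ} {g : SL (Fin m ⊕ Fin n)} :
    g ∈ SLxSL m n ↔ ∃ (A : Matrix (Fin m) (Fin m) ℂ) (D : Matrix (Fin n) (Fin n) ℂ),
      A.det = 1 ∧ D.det = 1 ∧ g.1 = fromBlocks A 0 0 D := by
  constructor
  · rintro ⟨x, rfl⟩
    exact ⟨x.1.1, x.2.1, x.1.2, x.2.2, rfl⟩
  · rintro ⟨A, D, hA, hD, h⟩
    exact ⟨(⟨A, hA⟩, ⟨D, hD⟩), Subtype.ext h.symm⟩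

theorem mem_SGLxGL {m n : ℕ} {g : SL (Fin m ⊕ Fin n)} :
    g ∈ SGLxGL m n ↔ ∃ (A : Matrix (Fin m) (Fin m) ℂ) (D : Matrix (Fin n) (Fin n) ℂ),
      g.1 = fromBlocks A 0 0 D := by
  constructor
  · rintro ⟨x, hx⟩
    exact ⟨x.1.1, x.2.1, (congrArg Units.val hx).symm⟩
  · rintro ⟨A, D, h⟩
    have hdet : A.det * D.det = 1 := by
      rw [← det_fromBlocks_zero₂₁ A 0 D, ← h, g.2]
    have hA : A.det ≠ 0 := left_ne_zero_of_mul_eq_one hdet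
    have hD : D.det ≠ 0 := right_ne_zero_of_mul_eq_one hdet
    exact ⟨(GeneralLinearGroup.mkOfDetNeZero A hA, GeneralLinearGroup.mkOfDetNeZero D hD),
      Units.ext h.symm⟩

variable {α β : Type} [Fintype α] [DecidableEq α] [Fintype β] [DecidableEq β]

variable (α β) in
/-- The algebra of block-diagonal matrices. -/
def blockAlg : Subalgebra ℂ (Matrix (α ⊕ β) (α ⊕ β) ℂ) where
  carrier := {a | ∃ (A : Matrix α α ℂ) (D : Matrix β β ℂ), a = fromBlocks A 0 0 D}
  mul_mem' := by
    rintro _ _ ⟨A, D, rfl⟩ ⟨A', D', rfl⟩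
    exact ⟨A * A', D * D', by simp [fromBlocks_multiply]⟩
  add_mem' := by
    rintro _ _ ⟨A, D, rfl⟩ ⟨A', D', rfl⟩
    exact ⟨A + A', D + D', by simp [fromBlocks_add]⟩
  algebraMap_mem' c := ⟨c • 1, c • 1, by
    rw [Algebra.algebraMap_eq_smul_one, ← fromBlocks_one, fromBlocks_smul]
    simp⟩

theorem mem_blockAlg {a : Matrix (α ⊕ β) (α ⊕ β) ℂ} : a ∈ blockAlg α β ↔
    ∃ (A : Matrix α α ℂ) (D : Matrix β β ℂ), a = fromBlocks A 0 0 D := Iff.rfl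

theorem SGLxGL_eq (m n : ℕ) : SGLxGL m n = algGroup (blockAlg (Fin m) (Fin n)) := by
  ext g
  rw [mem_SGLxGL, mem_algGroup, mem_blockAlg]

theorem isClosedSubgroup_SGLxGL (m n : ℕ) : IsClosedSubgroup (SGLxGL m n) := by
  rw [SGLxGL_eq]
  exact isClosedSubgroup_algGroup _

theorem matMem_toBlocks₁₁ : MatMem (polyFun (α ⊕ β)) (fun g : SL (α ⊕ β) => g.1.toBlocks₁₁) :=
  fun i j => matMem_coe (Sum.inl i) (Sum.inl j)

theorem matMem_toBlocks₂₂ : MatMem (polyFun (α ⊕ β)) (fun g : SL (α ⊕ β) => g.1.toBlocks₂₂) :=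
  fun i j => matMem_coe (Sum.inr i) (Sum.inr j)

theorem isClosedSubgroup_SLxSL (m n : ℕ) : IsClosedSubgroup (SLxSL m n) := by
  have : (SLxSL m n : Set (SL (Fin m ⊕ Fin n))) =
      (SGLxGL m n : Set (SL (Fin m ⊕ Fin n))) ∩ {g | (g.1.toBlocks₁₁).det = 1} := by
    ext g
    simp only [SetLike.mem_coe, Set.mem_inter_iff, Set.mem_ofPred_eq]
    rw [mem_SLxSL, mem_SGLxGL]
    constructor
    · rintro ⟨A, D, hA, hD, h⟩
      exact ⟨⟨A, D, h⟩, by rw [h, toBlocks_fromBlocks₁₁, hA]⟩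
    · rintro ⟨⟨A, D, h⟩, hA⟩
      rw [h, toBlocks_fromBlocks₁₁] at hA
      refine ⟨A, D, hA, ?_, h⟩
      have := g.2
      rwa [h, det_fromBlocks_zero₂₁, hA, one_mul] at this
  rw [IsClosedSubgroup, this]
  exact zClosed_inter (isClosedSubgroup_SGLxGL m n) (zClosed_eq matMem_toBlocks₁₁.det 1)

/-- For `m ≠ n` an atom of type `(1, 0)` or `(0, 1)` occurs, and the rank one idempotent that it
provides makes the stabilizer of the flag connected. -/
theorem isParabolicallyConnected_SGLxGL {m n : ℕ} (hmn : m ≠ n) :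
    IsParabolicallyConnected (SGLxGL m n) := by
  refine isParabolicallyConnected_of_flags fun F N hmono _ hN x hx => ?_
  have heq : algGroup (flagAlg F) ⊓ SGLxGL m n =
      algGroup (flagAlg F ⊓ blockAlg (Fin m) (Fin n)) := by
    rw [SGLxGL_eq]; rfl
  rw [heq] at hx ⊢
  obtain ⟨na, nb, nc, ha, hb, hA, hB, -⟩ := exists_atom_count (α := Fin m) (β := Fin n) hmono hN
    (pairAlg F).one_mem (one_mul 1)
  have ha' : m = na + nc := by
    have : ((m : ℕ) : ℂ) = (na + nc : ℕ) := by simpa using ha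
    exact_mod_cast this
  have hb' : n = nb + nc := by
    have : ((n : ℕ) : ℂ) = (nb + nc : ℕ) := by simpa using hb
    exact_mod_cast this
  by_cases hna : na = 0
  · obtain ⟨⟨e₁, e₂⟩, he, h1, u, v, huv, h2⟩ := hB (by omega)
    simp only at h1 h2
    subst h1; subst h2
    have h3 : vecMulVec (Sum.elim 0 u) (Sum.elim 0 v) =
        fromBlocks (0 : Matrix (Fin m) (Fin m) ℂ) 0 0 (vecMulVec u v) := by
      ext (i | i) (j | j) <;> simp [vecMulVec_apply]
    refine joinedToOne_algGroup (flagAlg F ⊓ blockAlg (Fin m) (Fin n)) (u := Sum.elim 0 u)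
      (v := Sum.elim 0 v) (by simpa using huv)
      (Algebra.mem_inf.2 ⟨?_, mem_blockAlg.2 ⟨_, _, h3⟩⟩) hx
    rw [h3]
    exact he
  · obtain ⟨⟨e₁, e₂⟩, he, ⟨u, v, huv, h1⟩, h2⟩ := hA hna
    simp only at h1 h2
    subst h1; subst h2
    have h3 : vecMulVec (Sum.elim u 0) (Sum.elim v 0) =
        fromBlocks (vecMulVec u v) 0 0 (0 : Matrix (Fin n) (Fin n) ℂ) := by
      ext (i | i) (j | j) <;> simp [vecMulVec_apply]
    refine joinedToOne_algGroup (flagAlg F ⊓ blockAlg (Fin m) (Fin n)) (u := Sum.elim u 0)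
      (v := Sum.elim v 0) (by simpa using huv)
      (Algebra.mem_inf.2 ⟨?_, mem_blockAlg.2 ⟨_, _, h3⟩⟩) hx
    rw [h3]
    exact he

/-- Joining an element of `SL(m) × SL(n)` to the identity inside the stabilizer of a flag, given
one-parameter groups which correct the determinants of the two blocks along a segment. -/
theorem joinedToOne_SLxSL {m n : ℕ} {F : ℕ → Submodule ℂ (Fin m ⊕ Fin n → ℂ)}
    {A : Matrix (Fin m) (Fin m) ℂ} {D : Matrix (Fin n) (Fin n) ℂ} (hAD : (A, D) ∈ pairAlg F)
    (hA : A.det = 1) (hD : D.det = 1) {x : SL (Fin m ⊕ Fin n)} (hx : x.1 = fromBlocks A 0 0 D)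
    {S : Set ℂ}
    (hS : S = {t | (segment A t).det ≠ 0 ∧ (segment D t).det ≠ 0})
    {e e' : Matrix (Fin m) (Fin m) ℂ × Matrix (Fin n) (Fin n) ℂ} (he : e ∈ pairAlg F)
    (he' : e' ∈ pairAlg F) {a a' : ℂ → ℂ} (ha : a ∈ regOn S) (ha' : a' ∈ regOn S)
    (ha0 : a 0 = 1) (ha1 : a 1 = 1) (ha'0 : a' 0 = 1) (ha'1 : a' 1 = 1)
    (h₁ : ∀ t ∈ S, (segment A t).det *
      ((1 + (a t - 1) • e.1).det * (1 + (a' t - 1) • e'.1).det) = 1)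
    (h₂ : ∀ t ∈ S, (segment D t).det *
      ((1 + (a t - 1) • e.2).det * (1 + (a' t - 1) • e'.2).det) = 1) :
    JoinedToOne ((algGroup (flagAlg F) ⊓ SLxSL m n : Subgroup _) : Set (SL (Fin m ⊕ Fin n))) x := by
  have hfin : Sᶜ.Finite := by
    rw [hS, Set.ofPred_and, Set.compl_inter]
    exact (finite_det_segment_eq_zero A).union (finite_det_segment_eq_zero D)
  have hreg : ∀ {κ : Type} [Fintype κ] [DecidableEq κ] (B e e' : Matrix κ κ ℂ),
      MatMem (regOn S) fun t => segment B t * ((1 + (a t - 1) • e) * (1 + (a' t - 1) • e')) :=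
    fun B e e' => (matMem_segment S B).mul
      (((MatMem.const 1).add (MatMem.smul_const ((regOn S).sub_mem ha (regOn S).one_mem) e)).mul
        ((MatMem.const 1).add (MatMem.smul_const ((regOn S).sub_mem ha' (regOn S).one_mem) e')))
  refine JoinedToOne.of_curve hfin (M := fun t => fromBlocks
    (segment A t * ((1 + (a t - 1) • e.1) * (1 + (a' t - 1) • e'.1))) 0 0
    (segment D t * ((1 + (a t - 1) • e.2) * (1 + (a' t - 1) • e'.2))))
    (MatMem.fromBlocks (hreg A e.1 e'.1) (hreg D e.2 e'.2)) ?_ ?_ (s := 0) (t := 1) ?_ ?_ ?_ ?_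
  · intro t ht
    rw [det_fromBlocks_zero₂₁, det_mul, det_mul, det_mul, det_mul, h₁ t ht, h₂ t ht, one_mul]
  · intro t ht g hg
    refine ⟨?_, mem_SLxSL.2 ⟨_, _, ?_, ?_, hg⟩⟩
    · change g.1 ∈ flagAlg F
      rw [hg]
      have hseg : (segment A t, segment D t) ∈ pairAlg F :=
        Subalgebra.add_mem _ (Subalgebra.one_mem _)
          (Subalgebra.smul_mem _ (Subalgebra.sub_mem _ hAD (Subalgebra.one_mem _)) t)
      have := (Subalgebra.mul_mem _ hseg (Subalgebra.mul_mem _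
        (Subalgebra.add_mem _ (Subalgebra.one_mem _) (Subalgebra.smul_mem _ he (a t - 1)))
        (Subalgebra.add_mem _ (Subalgebra.one_mem _) (Subalgebra.smul_mem _ he' (a' t - 1)))))
      exact this
    · rw [det_mul, det_mul, h₁ t ht]
    · rw [det_mul, det_mul, h₂ t ht]
  · simp [hS]
  · simp [ha0, ha'0]
  · simp [hS, hA, hD]
  · simp [ha1, ha'1, hx]

/-- Whichever types of atoms occur, their one-parameter groups correct the determinants of both
blocks; if all atoms have type `(1, 1)`, the two determinants coincide. -/
theorem isParabolicallyConnected_SLxSL (m n : ℕ) : IsParabolicallyConnected (SLxSL m n) := by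
  refine isParabolicallyConnected_of_flags fun F N hmono _ hN x hx => ?_
  obtain ⟨hxF, hxS⟩ := hx
  obtain ⟨A, D, hA, hD, hx⟩ := mem_SLxSL.1 hxS
  have hAD : (A, D) ∈ pairAlg F := by
    have hxF' : x.1 ∈ flagAlg F := hxF
    rwa [hx] at hxF'
  obtain ⟨na, nb, nc, ha, hb, hcA, hcB, hcC⟩ := exists_atom_count (α := Fin m) (β := Fin n) hmono hN
    (pairAlg F).one_mem (one_mul 1)
  have ha' : m = na + nc := by
    have : ((m : ℕ) : ℂ) = (na + nc : ℕ) := by simpa using ha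
    exact_mod_cast this
  have hb' : n = nb + nc := by
    have : ((n : ℕ) : ℂ) = (nb + nc : ℕ) := by simpa using hb
    exact_mod_cast this
  set S : Set ℂ := {t | (segment A t).det ≠ 0 ∧ (segment D t).det ≠ 0} with hS
  have hd₁ : (fun t => (segment A t).det) ∈ regOn S := (matMem_segment S A).det
  have hd₂ : (fun t => (segment D t).det) ∈ regOn S := (matMem_segment S D).det
  have hi₁ : (fun t => ((segment A t).det)⁻¹) ∈ regOn S := inv_mem_regOn hd₁ fun t ht => ht.1
  have hi₂ : (fun t => ((segment D t).det)⁻¹) ∈ regOn S := inv_mem_regOn hd₂ fun t ht => ht.2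
  by_cases hexA : ∃ e ∈ pairAlg F, IsRankOneIdem e.1 ∧ e.2 = 0
  · obtain ⟨e, he, he₁, he₂⟩ := hexA
    by_cases hexB : ∃ e ∈ pairAlg F, e.1 = 0 ∧ IsRankOneIdem e.2
    · obtain ⟨e', he', he'₁, he'₂⟩ := hexB
      refine joinedToOne_SLxSL hAD hA hD hx hS he he' hi₁ hi₂ (by simp) (by simp [hA]) (by simp)
        (by simp [hD]) (fun t ht => ?_) (fun t ht => ?_)
      · rw [he₁.det, he'₁, smul_zero, add_zero, det_one, mul_one, mul_inv_cancel₀ ht.1]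
      · rw [he₂, he'₂.det, smul_zero, add_zero, det_one, one_mul, mul_inv_cancel₀ ht.2]
    by_cases hnc : nc = 0
    · have hn : n = 0 := by
        have : nb = 0 := by
          by_contra h
          exact hexB (hcB h)
        omega
      subst hn
      refine joinedToOne_SLxSL hAD hA hD hx hS he he hi₁ (regOn S).one_mem (by simp)
        (by simp [hA]) rfl rfl (fun t ht => ?_) (fun t ht => ?_)
      · rw [he₁.det, Pi.one_apply, sub_self, zero_smul, add_zero, det_one, mul_one,
          mul_inv_cancel₀ ht.1]
      · simp
    · obtain ⟨e', he', he'₁, he'₂⟩ := hcC hnc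
      refine joinedToOne_SLxSL hAD hA hD hx hS he he' ((regOn S).mul_mem hi₁ hd₂) hi₂ (by simp)
        (by simp [hA, hD]) (by simp) (by simp [hD]) (fun t ht => ?_) (fun t ht => ?_)
      · rw [he₁.det, he'₁.det]
        have := ht.1
        have := ht.2
        simp only [Pi.mul_apply]
        field_simp
      · rw [he₂, he'₂.det, smul_zero, add_zero, det_one, one_mul, mul_inv_cancel₀ ht.2]
  have hna : na = 0 := by
    by_contra h
    exact hexA (hcA h)
  by_cases hexB : ∃ e ∈ pairAlg F, e.1 = 0 ∧ IsRankOneIdem e.2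
  · obtain ⟨e, he, he₁, he₂⟩ := hexB
    by_cases hnc : nc = 0
    · have hm : m = 0 := by omega
      subst hm
      refine joinedToOne_SLxSL hAD hA hD hx hS he he hi₂ (regOn S).one_mem (by simp)
        (by simp [hD]) rfl rfl (fun t ht => ?_) (fun t ht => ?_)
      · simp
      · rw [he₂.det, Pi.one_apply, sub_self, zero_smul, add_zero, det_one, mul_one,
          mul_inv_cancel₀ ht.2]
    · obtain ⟨e', he', he'₁, he'₂⟩ := hcC hnc
      refine joinedToOne_SLxSL hAD hA hD hx hS he he' ((regOn S).mul_mem hi₂ hd₁) hi₁ (by simp)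
        (by simp [hA, hD]) (by simp) (by simp [hA]) (fun t ht => ?_) (fun t ht => ?_)
      · rw [he₁, he'₁.det, smul_zero, add_zero, det_one, one_mul, mul_inv_cancel₀ ht.1]
      · rw [he₂.det, he'₂.det]
        have := ht.1
        have := ht.2
        simp only [Pi.mul_apply]
        field_simp
  have hnb : nb = 0 := by
    by_contra h
    exact hexB (hcB h)
  by_cases hnc : nc = 0
  · have hm : m = 0 := by omega
    have hn : n = 0 := by omega
    subst hm; subst hn
    exact joinedToOne_SLxSL hAD hA hD hx hS (zero_mem _) (zero_mem _) (regOn S).one_mem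
      (regOn S).one_mem rfl rfl rfl rfl (fun t ht => by simp) (fun t ht => by simp)
  · obtain ⟨e, he, he₁, he₂⟩ := hcC hnc
    have hdet : ∀ t, (segment A t).det = (segment D t).det := by
      intro t
      have hseg : (segment A t, segment D t) ∈ pairAlg F :=
        Subalgebra.add_mem _ (Subalgebra.one_mem _)
          (Subalgebra.smul_mem _ (Subalgebra.sub_mem _ hAD (Subalgebra.one_mem _)) t)
      rw [det_eq_sign_charpoly_coeff, det_eq_sign_charpoly_coeff,
        ← charpoly_natDegree_eq_dim (segment A t), ← charpoly_natDegree_eq_dim (segment D t),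
        charpoly_eq_of_no_atoms hmono hN hexA hexB hseg]
    refine joinedToOne_SLxSL hAD hA hD hx hS he he hi₁ (regOn S).one_mem (by simp)
      (by simp [hA]) rfl rfl (fun t ht => ?_) (fun t ht => ?_)
    · rw [he₁.det, Pi.one_apply, sub_self, zero_smul, add_zero, det_one, mul_one,
        mul_inv_cancel₀ ht.1]
    · rw [he₂.det, Pi.one_apply, sub_self, zero_smul, add_zero, det_one, mul_one, ← hdet,
        mul_inv_cancel₀ ht.1]

end BlockGroups

/-! ### Symplectic idempotents in the algebra of a flag -/

section Symplectic

variable {l : Type} [Fintype l] [DecidableEq l]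

/-- The adjoint of a matrix with respect to the standard symplectic form. -/
def sympAdj (a : Matrix (l ⊕ l) (l ⊕ l) ℂ) : Matrix (l ⊕ l) (l ⊕ l) ℂ :=
  -(J l ℂ * aᵀ * J l ℂ)

/-- The standard symplectic form. -/
def sympForm (u v : l ⊕ l → ℂ) : ℂ := u ⬝ᵥ J l ℂ *ᵥ v

@[simp] theorem sympAdj_zero : sympAdj (0 : Matrix (l ⊕ l) (l ⊕ l) ℂ) = 0 := by simp [sympAdj]

@[simp] theorem sympAdj_one : sympAdj (1 : Matrix (l ⊕ l) (l ⊕ l) ℂ) = 1 := by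
  simp [sympAdj, J_squared]

theorem sympAdj_add (a b : Matrix (l ⊕ l) (l ⊕ l) ℂ) :
    sympAdj (a + b) = sympAdj a + sympAdj b := by
  simp only [sympAdj, transpose_add]; noncomm_ring

theorem sympAdj_neg (a : Matrix (l ⊕ l) (l ⊕ l) ℂ) : sympAdj (-a) = -sympAdj a := by
  simp [sympAdj]

theorem sympAdj_sub (a b : Matrix (l ⊕ l) (l ⊕ l) ℂ) :
    sympAdj (a - b) = sympAdj a - sympAdj b := by
  rw [sub_eq_add_neg, sympAdj_add, sympAdj_neg, ← sub_eq_add_neg]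

theorem sympAdj_smul (c : ℂ) (a : Matrix (l ⊕ l) (l ⊕ l) ℂ) :
    sympAdj (c • a) = c • sympAdj a := by
  simp [sympAdj]

theorem sympAdj_mul (a b : Matrix (l ⊕ l) (l ⊕ l) ℂ) :
    sympAdj (a * b) = sympAdj b * sympAdj a := by
  have h : J l ℂ * bᵀ * J l ℂ * (J l ℂ * aᵀ * J l ℂ) =
      J l ℂ * bᵀ * (J l ℂ * J l ℂ) * aᵀ * J l ℂ := by noncomm_ring
  rw [sympAdj, sympAdj, sympAdj, neg_mul_neg, h, J_squared, transpose_mul]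
  noncomm_ring

theorem sympAdj_sympAdj (a : Matrix (l ⊕ l) (l ⊕ l) ℂ) : sympAdj (sympAdj a) = a := by
  have h : sympAdj (sympAdj a) = (J l ℂ * J l ℂ) * a * (J l ℂ * J l ℂ) := by
    simp only [sympAdj, transpose_neg, transpose_mul, transpose_transpose, J_transpose]
    noncomm_ring
  rw [h, J_squared]
  simp

theorem sympAdj_pow (a : Matrix (l ⊕ l) (l ⊕ l) ℂ) (k : ℕ) : sympAdj (a ^ k) = sympAdj a ^ k := by
  induction k with
  | zero => simp
  | succ k ih => rw [pow_succ, sympAdj_mul, ih, ← pow_succ']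

theorem sympAdj_aeval {a : Matrix (l ⊕ l) (l ⊕ l) ℂ} (ha : sympAdj a = a) (f : Polynomial ℂ) :
    sympAdj (Polynomial.aeval a f) = Polynomial.aeval a f := by
  induction f using Polynomial.induction_on' with
  | add p q hp hq => rw [map_add, sympAdj_add, hp, hq]
  | monomial k c =>
    rw [Polynomial.aeval_monomial, ← Algebra.smul_def, sympAdj_smul, sympAdj_pow, ha]

theorem mem_symplecticGroup_iff {a : Matrix (l ⊕ l) (l ⊕ l) ℂ} :
    a ∈ symplecticGroup l ℂ ↔ sympAdj a * a = 1 := by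
  rw [SymplecticGroup.mem_iff']
  have h : sympAdj a * a = -(J l ℂ * (aᵀ * J l ℂ * a)) := by rw [sympAdj]; noncomm_ring
  rw [h]
  constructor
  · intro h'
    rw [h', J_squared, neg_neg]
  · intro h'
    have := congrArg (fun x => J l ℂ * x) h'
    simpa [← Matrix.mul_assoc, J_squared] using this

theorem sympForm_mulVec_left (a : Matrix (l ⊕ l) (l ⊕ l) ℂ) (u v : l ⊕ l → ℂ) :
    sympForm (a *ᵥ u) v = sympForm u (sympAdj a *ᵥ v) := by
  have h : J l ℂ * sympAdj a = aᵀ * J l ℂ := by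
    rw [sympAdj, mul_neg, ← Matrix.mul_assoc, ← Matrix.mul_assoc, J_squared]; simp
  rw [sympForm, sympForm, mulVec_mulVec, h, ← mulVec_mulVec, dotProduct_comm, dotProduct_mulVec,
    ← mulVec_transpose, dotProduct_comm]

theorem sympForm_swap (u v : l ⊕ l → ℂ) : sympForm u v = -sympForm v u := by
  rw [sympForm, sympForm, dotProduct_mulVec, ← mulVec_transpose, J_transpose, neg_mulVec,
    neg_dotProduct, dotProduct_comm]

@[simp] theorem sympForm_self (u : l ⊕ l → ℂ) : sympForm u u = 0 := by
  have := sympForm_swap u u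
  exact self_eq_neg.1 this

theorem sympForm_add_left (u u' v : l ⊕ l → ℂ) :
    sympForm (u + u') v = sympForm u v + sympForm u' v := add_dotProduct _ _ _

theorem sympForm_sub_left (u u' v : l ⊕ l → ℂ) :
    sympForm (u - u') v = sympForm u v - sympForm u' v := sub_dotProduct _ _ _

theorem sympForm_smul_left (c : ℂ) (u v : l ⊕ l → ℂ) :
    sympForm (c • u) v = c * sympForm u v := smul_dotProduct _ _ _

theorem sympForm_add_right (u v v' : l ⊕ l → ℂ) :
    sympForm u (v + v') = sympForm u v + sympForm u v' := by
  rw [sympForm, mulVec_add, dotProduct_add]; rfl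

theorem sympForm_sub_right (u v v' : l ⊕ l → ℂ) :
    sympForm u (v - v') = sympForm u v - sympForm u v' := by
  rw [sympForm, mulVec_sub, dotProduct_sub]; rfl

theorem sympForm_smul_right (c : ℂ) (u v : l ⊕ l → ℂ) :
    sympForm u (c • v) = c * sympForm u v := by
  rw [sympForm, mulVec_smul, dotProduct_smul]; rfl

theorem exists_sympForm_eq (y : l ⊕ l → ℂ) : ∃ z, ∀ x, sympForm x z = y ⬝ᵥ x := by
  refine ⟨-(J l ℂ *ᵥ y), fun x => ?_⟩
  rw [sympForm, mulVec_neg, mulVec_mulVec, J_squared, neg_mulVec, neg_neg, one_mulVec,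
    dotProduct_comm]

theorem sympForm_nondegenerate {v : l ⊕ l → ℂ} (h : ∀ w, sympForm v w = 0) : v = 0 := by
  have h1 : ∀ y, y ⬝ᵥ v = 0 := fun y => by
    obtain ⟨z, hz⟩ := exists_sympForm_eq y
    rw [← hz, h]
  ext i
  simpa using h1 (Pi.single i 1)

/-- The rank one operator `x ↦ ω(x, w) v`. -/
def sympRankOne (v w : l ⊕ l → ℂ) : Matrix (l ⊕ l) (l ⊕ l) ℂ := vecMulVec v (J l ℂ *ᵥ w)

theorem sympRankOne_mulVec (v w x : l ⊕ l → ℂ) : sympRankOne v w *ᵥ x = sympForm x w • v := by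
  rw [sympRankOne, rankOne_mulVec, dotProduct_comm]; rfl

theorem ext_mulVec {a b : Matrix (l ⊕ l) (l ⊕ l) ℂ} (h : ∀ x, a *ᵥ x = b *ᵥ x) : a = b :=
  Matrix.ext_of_mulVec_single fun _ => h _

theorem sympAdj_eq_of_forall {a b : Matrix (l ⊕ l) (l ⊕ l) ℂ}
    (h : ∀ u v, sympForm (a *ᵥ u) v = sympForm u (b *ᵥ v)) : sympAdj a = b := by
  refine ext_mulVec fun v => sub_eq_zero.1 (sympForm_nondegenerate fun u => ?_)
  rw [sympForm_swap, sympForm_sub_right, ← sympForm_mulVec_left, h, sub_self, neg_zero]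

theorem sympAdj_sympRankOne (v w : l ⊕ l → ℂ) :
    sympAdj (sympRankOne v w) = -sympRankOne w v := by
  refine sympAdj_eq_of_forall fun x y => ?_
  rw [neg_mulVec, sympRankOne_mulVec, sympRankOne_mulVec, sympForm_smul_left, ← neg_smul,
    sympForm_smul_right, ← sympForm_swap, mul_comm]

/-- A symplectic plane `⟨v, w⟩` inside the image of `p`, spanned by vectors which are as low as
possible in the flag, so that the projections to the two lines preserve the flag. The second vector
can be chosen so that one of the two lines is orthogonal to a given vector `z`. -/
theorem exists_symplectic_pair {F : ℕ → Submodule ℂ (l ⊕ l → ℂ)} {N : ℕ} (hF : Monotone F)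
    (hN : F N = ⊤) {p : Matrix (l ⊕ l) (l ⊕ l) ℂ} (hpF : p ∈ flagAlg F) (hps : sympAdj p = p)
    (hpp : p * p = p) (hp0 : p ≠ 0) (z : l ⊕ l → ℂ) :
    ∃ v w, p *ᵥ v = v ∧ p *ᵥ w = w ∧ sympForm v w = 1 ∧ sympRankOne v w ∈ flagAlg F ∧
      sympRankOne w v ∈ flagAlg F ∧ (sympForm z v = 0 ∨ sympForm z w = 0) := by
  have hpx : ∀ x, p *ᵥ (p *ᵥ x) = p *ᵥ x := fun x => by rw [mulVec_mulVec, hpp]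
  have hpω : ∀ x y, sympForm (p *ᵥ x) y = sympForm x (p *ᵥ y) := fun x y => by
    rw [sympForm_mulVec_left, hps]
  have hex : ∃ k, ∃ u ∈ F k, p *ᵥ u ≠ 0 := by
    by_contra hcon
    push Not at hcon
    exact hp0 (ext_mulVec fun x => by rw [hcon N x (by rw [hN]; trivial), zero_mulVec])
  classical
  obtain ⟨u₀, hu₀, hv0⟩ := Nat.find_spec hex
  have hkmin : ∀ j, j < Nat.find hex → ∀ x ∈ F j, p *ᵥ x = 0 := fun j hj x hx => by
    by_contra h
    exact Nat.find_min hex hj ⟨x, hx, h⟩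
  set k := Nat.find hex
  set v := p *ᵥ u₀ with hv
  have hpv : p *ᵥ v = v := hpx u₀
  have hvF : v ∈ F k := hpF k _ hu₀
  have hex' : ∃ m, ∃ w ∈ F m, sympForm v (p *ᵥ w) ≠ 0 := by
    by_contra hcon
    push Not at hcon
    refine hv0 (sympForm_nondegenerate fun w => ?_)
    rw [← hcon N w (by rw [hN]; trivial), ← hpω, hpv]
  obtain ⟨w₀, hw₀, hvw⟩ := Nat.find_spec hex'
  have hmmin : ∀ j, j < Nat.find hex' → ∀ x ∈ F j, sympForm v (p *ᵥ x) = 0 := fun j hj x hx => by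
    by_contra h
    exact Nat.find_min hex' hj ⟨x, hx, h⟩
  set m := Nat.find hex'
  have hkm : k ≤ m := by
    by_contra h
    refine hvw ?_
    rw [hkmin m (not_le.1 h) w₀ hw₀, sympForm, mulVec_zero, dotProduct_zero]
  -- any vector of `F m` fixed by `p` completes the pair
  have key : ∀ w ∈ F m, p *ᵥ w = w → sympRankOne v w ∈ flagAlg F ∧ sympRankOne w v ∈ flagAlg F := by
    intro w hw hpw
    constructor
    · intro j x hx
      rw [sympRankOne_mulVec]
      rcases lt_or_ge j k with hj | hj
      · rw [← hpw, ← hpω, hkmin j hj x hx, sympForm, zero_dotProduct, zero_smul]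
        exact zero_mem _
      · exact Submodule.smul_mem _ _ (hF hj hvF)
    · intro j x hx
      rw [sympRankOne_mulVec]
      rcases lt_or_ge j m with hj | hj
      · rw [← hpv, ← hpω, sympForm_swap, hmmin j hj x hx, neg_zero, zero_smul]
        exact zero_mem _
      · exact Submodule.smul_mem _ _ (hF hj hw)
  set w₁ := (sympForm v (p *ᵥ w₀))⁻¹ • p *ᵥ w₀ with hw₁
  have hw₁F : w₁ ∈ F m := Submodule.smul_mem _ _ (hpF m _ hw₀)
  have hpw₁ : p *ᵥ w₁ = w₁ := by rw [hw₁, mulVec_smul, hpx]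
  have hvw₁ : sympForm v w₁ = 1 := by rw [hw₁, sympForm_smul_right, inv_mul_cancel₀ hvw]
  clear_value w₁
  by_cases hzv : sympForm z v = 0
  · exact ⟨v, w₁, hpv, hpw₁, hvw₁, (key w₁ hw₁F hpw₁).1, (key w₁ hw₁F hpw₁).2, Or.inl hzv⟩
  · set w := w₁ + (-(sympForm z w₁) / sympForm z v) • v with hw
    have hwF : w ∈ F m := Submodule.add_mem _ hw₁F (Submodule.smul_mem _ _ (hF hkm hvF))
    have hpw : p *ᵥ w = w := by rw [hw, mulVec_add, mulVec_smul, hpw₁, hpv]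
    refine ⟨v, w, hpv, hpw, ?_, (key w hwF hpw).1, (key w hwF hpw).2, Or.inr ?_⟩
    · rw [hw, sympForm_add_right, sympForm_smul_right, sympForm_self, hvw₁, mul_zero, add_zero]
    · rw [hw, sympForm_add_right, sympForm_smul_right, div_mul_cancel₀ _ hzv, add_neg_cancel]

/-- A selfadjoint idempotent `p` preserving a flag is the square of an element of the symplectic Lie
algebra which preserves the flag and acts on the image of `p`; moreover a given vector `p z` can be
made an eigenvector. It generates a one-dimensional torus in the symplectic group. -/
theorem exists_sympAdj_eq_neg {F : ℕ → Submodule ℂ (l ⊕ l → ℂ)} {N : ℕ} (hF : Monotone F)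
    (hN : F N = ⊤) (z : l ⊕ l → ℂ) {p : Matrix (l ⊕ l) (l ⊕ l) ℂ} (hpF : p ∈ flagAlg F)
    (hps : sympAdj p = p) (hpp : p * p = p) :
    ∃ X ∈ flagAlg F, sympAdj X = -X ∧ X * X = p ∧ p * X = X ∧ X * p = X ∧
      X *ᵥ z = -(p *ᵥ z) := by
  induction hr : p.rank using Nat.strong_induction_on generalizing p with
  | _ r ih =>
  by_cases hp0 : p = 0
  · subst hp0
    exact ⟨0, zero_mem _, by simp, by simp, by simp, by simp, by simp⟩
  obtain ⟨v, w, hpv, hpw, hvw, hF₁, hF₂, hz⟩ := exists_symplectic_pair hF hN hpF hps hpp hp0 z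
  have hwv : sympForm w v = -1 := by rw [sympForm_swap, hvw]
  set e := sympRankOne v w with he
  set e' := -sympRankOne w v with he'
  have hee' : sympAdj e = e' := sympAdj_sympRankOne v w
  have hee'' : sympAdj e' = e := by rw [← hee', sympAdj_sympAdj]
  have hex : ∀ x, e *ᵥ x = sympForm x w • v := fun x => sympRankOne_mulVec v w x
  have hex' : ∀ x, e' *ᵥ x = -sympForm x v • w := fun x => by
    rw [he', neg_mulVec, sympRankOne_mulVec, neg_smul]
  have h₁ : e * e = e := ext_mulVec fun x => by
    rw [← mulVec_mulVec, hex x, mulVec_smul, hex v, hvw, one_smul]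
  have h₂ : e' * e' = e' := by rw [← hee', ← sympAdj_mul, h₁]
  have h₃ : e * e' = 0 := ext_mulVec fun x => by
    rw [← mulVec_mulVec, hex' x, mulVec_smul, hex w, sympForm_self, zero_smul, smul_zero,
      zero_mulVec]
  have h₄ : e' * e = 0 := ext_mulVec fun x => by
    rw [← mulVec_mulVec, hex x, mulVec_smul, hex' v, sympForm_self, neg_zero, zero_smul, smul_zero,
      zero_mulVec]
  have h₅ : p * e = e := ext_mulVec fun x => by
    rw [← mulVec_mulVec, hex x, mulVec_smul, hpv]
  have h₆ : p * e' = e' := ext_mulVec fun x => by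
    rw [← mulVec_mulVec, hex' x, mulVec_smul, hpw]
  have h₇ : e * p = e := by
    rw [← hee'', ← hps, ← sympAdj_mul, h₆]
  have h₈ : e' * p = e' := by
    rw [← hee', ← hps, ← sympAdj_mul, h₅]
  have hq0 : e + e' ≠ 0 := by
    intro h
    have h9 : e * (e + e') = 0 := by rw [h, mul_zero]
    rw [mul_add, h₁, h₃, add_zero] at h9
    have h10 := hex v
    rw [h9, hvw, one_smul, zero_mulVec] at h10
    rw [← h10, sympForm, zero_dotProduct] at hvw
    exact zero_ne_one hvw
  have hqq : (e + e') * (e + e') = e + e' := by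
    rw [mul_add, add_mul, add_mul, h₁, h₂, h₃, h₄]; simp
  have hpq : p * (e + e') = e + e' := by rw [mul_add, h₅, h₆]
  have hqp : (e + e') * p = e + e' := by rw [add_mul, h₇, h₈]
  have heF' : e' ∈ flagAlg F := neg_mem hF₂
  obtain ⟨X, hXF, hXs, hXX, hpX, hXp, hXz⟩ := ih _ (hr ▸ rank_sub_lt hpq hqp hqq hq0)
    (p := p - (e + e')) (sub_mem hpF (add_mem hF₁ heF'))
    (by rw [sympAdj_sub, sympAdj_add, hps, hee', hee'', add_comm e'])
    (by rw [sub_mul, mul_sub, mul_sub, hpp, hpq, hqp, hqq, sub_self, sub_zero]) rfl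
  -- the two signs are distinguished by the eigenvector condition
  obtain ⟨X₀, hX₀F, hX₀s, hX₀X₀, hqX₀, hX₀q, hX₀z⟩ : ∃ X₀ ∈ flagAlg F, sympAdj X₀ = -X₀ ∧
      X₀ * X₀ = e + e' ∧ (e + e') * X₀ = X₀ ∧ X₀ * (e + e') = X₀ ∧
      X₀ *ᵥ z = -((e + e') *ᵥ z) := by
    rcases hz with hz | hz
    · refine ⟨e' - e, sub_mem heF' hF₁, ?_, ?_, ?_, ?_, ?_⟩
      · rw [sympAdj_sub, hee', hee'', neg_sub]
      · rw [sub_mul, mul_sub, mul_sub, h₁, h₂, h₃, h₄, sub_zero, zero_sub, sub_neg_eq_add,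
          add_comm]
      · rw [add_mul, mul_sub, mul_sub, h₁, h₂, h₃, h₄, sub_zero, zero_sub]; abel
      · rw [sub_mul, mul_add, mul_add, h₁, h₂, h₃, h₄]; simp
      · rw [sub_mulVec, add_mulVec, hex', hz]; simp
    · refine ⟨e - e', sub_mem hF₁ heF', ?_, ?_, ?_, ?_, ?_⟩
      · rw [sympAdj_sub, hee', hee'', neg_sub]
      · rw [sub_mul, mul_sub, mul_sub, h₁, h₂, h₃, h₄, sub_zero, zero_sub, sub_neg_eq_add]
      · rw [add_mul, mul_sub, mul_sub, h₁, h₂, h₃, h₄, sub_zero, zero_sub]; abel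
      · rw [sub_mul, mul_add, mul_add, h₁, h₂, h₃, h₄]; simp
      · rw [sub_mulVec, add_mulVec, hex, hz]; simp
  have hXq : X * (e + e') = 0 := by
    rw [← hXp, Matrix.mul_assoc, sub_mul, hpq, hqq, sub_self, mul_zero]
  have hqX : (e + e') * X = 0 := by
    rw [← hpX, ← Matrix.mul_assoc, mul_sub, hqp, hqq, sub_self, zero_mul]
  have hXX₀ : X * X₀ = 0 := by rw [← hqX₀, ← Matrix.mul_assoc, hXq, zero_mul]
  have hX₀X : X₀ * X = 0 := by rw [← hX₀q, Matrix.mul_assoc, hqX, mul_zero]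
  have hpX₀ : p * X₀ = X₀ := by rw [← hqX₀, ← Matrix.mul_assoc, hpq]
  have hX₀p : X₀ * p = X₀ := by rw [← hX₀q, Matrix.mul_assoc, hqp]
  refine ⟨X + X₀, add_mem hXF hX₀F, ?_, ?_, ?_, ?_, ?_⟩
  · rw [sympAdj_add, hXs, hX₀s, neg_add]
  · rw [mul_add, add_mul, add_mul, hXX, hXX₀, hX₀X, hX₀X₀]; abel
  · rw [mul_add, hpX₀]
    rw [sub_mul, hqX, sub_zero] at hpX
    rw [hpX]
  · rw [add_mul, hX₀p]
    rw [mul_sub, hXq, sub_zero] at hXp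
    rw [hXp]
  · rw [add_mulVec, hXz, hX₀z, sub_mulVec]; abel

end Symplectic

/-! ### Symplectic stabilizers of flags are connected -/

section SymplecticConnected

variable {l : Type} [Fintype l] [DecidableEq l]

/-- The one-parameter group generated by `X`, where `X * X = p` is idempotent and `X = p * X * p`:
`s` acts on the `±1`-eigenspaces of `X` as `s` and `s⁻¹`, and trivially on the kernel of `p`. -/
noncomputable def sympTorus (p X : Matrix (l ⊕ l) (l ⊕ l) ℂ) (s : ℂ) :
    Matrix (l ⊕ l) (l ⊕ l) ℂ :=
  1 - p + ((s + s⁻¹) / 2) • p + ((s - s⁻¹) / 2) • X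

omit [Fintype l] in
@[simp] theorem sympTorus_one (p X : Matrix (l ⊕ l) (l ⊕ l) ℂ) : sympTorus p X 1 = 1 := by
  simp [sympTorus]

omit [Fintype l] in
theorem sympTorus_neg_one (p X : Matrix (l ⊕ l) (l ⊕ l) ℂ) :
    sympTorus p X (-1) = 1 - (2 : ℂ) • p := by
  have h : ((-1 + (-1)⁻¹) / 2 : ℂ) = -1 := by norm_num
  have h' : ((-1 - (-1)⁻¹) / 2 : ℂ) = 0 := by norm_num
  rw [sympTorus, h, h', zero_smul, add_zero, two_smul, neg_one_smul]
  abel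

theorem sympTorus_mem {𝔅 : Subalgebra ℂ (Matrix (l ⊕ l) (l ⊕ l) ℂ)}
    {p X : Matrix (l ⊕ l) (l ⊕ l) ℂ} (hp : p ∈ 𝔅) (hX : X ∈ 𝔅) (s : ℂ) : sympTorus p X s ∈ 𝔅 :=
  𝔅.add_mem (𝔅.add_mem (𝔅.sub_mem 𝔅.one_mem hp) (𝔅.smul_mem hp _)) (𝔅.smul_mem hX _)

theorem sympAdj_sympTorus {p X : Matrix (l ⊕ l) (l ⊕ l) ℂ} (hp : sympAdj p = p)
    (hX : sympAdj X = -X) (s : ℂ) : sympAdj (sympTorus p X s) = sympTorus p X s⁻¹ := by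
  have h : (s⁻¹ - s) / 2 = -((s - s⁻¹) / 2) := by ring
  simp only [sympTorus, sympAdj_add, sympAdj_sub, sympAdj_smul, sympAdj_one, hp, hX, inv_inv]
  rw [add_comm s⁻¹ s, h, neg_smul, smul_neg]

theorem sympTorus_mem_symplecticGroup {p X : Matrix (l ⊕ l) (l ⊕ l) ℂ} (hp : sympAdj p = p)
    (hX : sympAdj X = -X) (hpp : p * p = p) (hXX : X * X = p) (hpX : p * X = X) (hXp : X * p = X)
    {s : ℂ} (hs : s ≠ 0) : sympTorus p X s ∈ symplecticGroup l ℂ := by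
  rw [mem_symplecticGroup_iff, sympAdj_sympTorus hp hX]
  simp only [sympTorus, inv_inv, add_mul, mul_add, sub_mul, mul_sub, one_mul, mul_one,
    smul_mul_assoc, mul_smul_comm, hpp, hXX, hpX, hXp, sub_self, zero_add]
  match_scalars <;> field_simp <;> ring

theorem sympTorus_mulVec {p X : Matrix (l ⊕ l) (l ⊕ l) ℂ} {z : l ⊕ l → ℂ}
    (hXz : X *ᵥ z = -(p *ᵥ z)) (s : ℂ) :
    sympTorus p X s *ᵥ z = z + (s⁻¹ - 1) • (p *ᵥ z) := by
  simp only [sympTorus, add_mulVec, sub_mulVec, one_mulVec, smul_mulVec, hXz]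
  module

omit [Fintype l] in
theorem matMem_sympTorus {D : Set ℂ} {f : ℂ → ℂ} (hf : f ∈ regOn D) (h0 : ∀ t ∈ D, f t ≠ 0)
    (p X : Matrix (l ⊕ l) (l ⊕ l) ℂ) : MatMem (regOn D) fun t => sympTorus p X (f t) := by
  have hi := inv_mem_regOn hf h0
  have h1 : (fun t => (f t + (f t)⁻¹) / 2) ∈ regOn D := by
    have := (regOn D).smul_mem ((regOn D).add_mem hf hi) (2 : ℂ)⁻¹
    convert this using 1
    ext t
    simp [div_eq_inv_mul]
  have h2 : (fun t => (f t - (f t)⁻¹) / 2) ∈ regOn D := by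
    have := (regOn D).smul_mem ((regOn D).sub_mem hf hi) (2 : ℂ)⁻¹
    convert this using 1
    ext t
    simp [div_eq_inv_mul]
  exact ((MatMem.const (1 - p)).add (MatMem.smul_const h1 p)).add (MatMem.smul_const h2 X)

theorem mul_mem_symplecticGroup {a b : Matrix (l ⊕ l) (l ⊕ l) ℂ} (ha : a ∈ symplecticGroup l ℂ)
    (hb : b ∈ symplecticGroup l ℂ) : a * b ∈ symplecticGroup l ℂ :=
  Submonoid.mul_mem _ ha hb

/-- The Cayley transform of an element of the symplectic Lie algebra is symplectic. -/
theorem cayley_mem_symplecticGroup {a : Matrix (l ⊕ l) (l ⊕ l) ℂ} (ha : sympAdj a = -a)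
    (h : (1 + a).det ≠ 0) : (1 - a) * (1 + a)⁻¹ ∈ symplecticGroup l ℂ := by
  have hP : (1 + a) * (1 + a)⁻¹ = 1 := mul_nonsing_inv _ h.isUnit
  have h1 : sympAdj (1 - a) = 1 + a := by rw [sympAdj_sub, sympAdj_one, ha, sub_neg_eq_add]
  have h2 : sympAdj (1 + a) = 1 - a := by rw [sympAdj_add, sympAdj_one, ha, ← sub_eq_add_neg]
  rw [mem_symplecticGroup_iff, sympAdj_mul, h1]
  have h3 : sympAdj (1 + a)⁻¹ * (1 + a) * ((1 - a) * (1 + a)⁻¹) =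
      sympAdj (1 + a)⁻¹ * (1 - a) * ((1 + a) * (1 + a)⁻¹) := by
    have : (1 + a) * (1 - a) = (1 - a) * (1 + a) := by noncomm_ring
    rw [Matrix.mul_assoc, ← Matrix.mul_assoc (1 + a), this]
    simp only [Matrix.mul_assoc]
  rw [h3, hP, mul_one, ← h2, ← sympAdj_mul, hP, sympAdj_one]

/-- The inverse Cayley transform of a symplectic matrix. -/
theorem sympAdj_cayley {g : Matrix (l ⊕ l) (l ⊕ l) ℂ} (hg : g ∈ symplecticGroup l ℂ)
    (h : (1 + g).det ≠ 0) : sympAdj ((1 - g) * (1 + g)⁻¹) = -((1 - g) * (1 + g)⁻¹) := by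
  have hg1 : sympAdj g * g = 1 := mem_symplecticGroup_iff.1 hg
  have hg2 : g * sympAdj g = 1 := mul_eq_one_comm.1 hg1
  have hP : (1 + g) * (1 + g)⁻¹ = 1 := mul_nonsing_inv _ h.isUnit
  have hP' : (1 + g)⁻¹ * (1 + g) = 1 := nonsing_inv_mul _ h.isUnit
  have h1 : sympAdj (1 + g)⁻¹ * (1 + sympAdj g) = 1 := by
    rw [← sympAdj_one, ← sympAdj_add, sympAdj_one, ← sympAdj_mul, hP, sympAdj_one]
  have h2 : sympAdj (1 + g)⁻¹ = (1 + g)⁻¹ * g := by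
    have h3 : (1 + sympAdj g) * ((1 + g)⁻¹ * g) = 1 := by
      have h4 : 1 + sympAdj g = sympAdj g * (1 + g) := by rw [mul_add, mul_one, hg1, add_comm]
      rw [h4, Matrix.mul_assoc, ← Matrix.mul_assoc (1 + g), hP, one_mul, hg1]
    exact left_inv_eq_right_inv h1 h3
  have h5 : (1 + g)⁻¹ * (1 - g) = (1 - g) * (1 + g)⁻¹ := by
    have h6 : (1 - g) * (1 + g) = (1 + g) * (1 - g) := by noncomm_ring
    calc (1 + g)⁻¹ * (1 - g) = (1 + g)⁻¹ * ((1 - g) * (1 + g)) * (1 + g)⁻¹ := by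
          simp only [Matrix.mul_assoc, hP, mul_one]
      _ = _ := by rw [h6, ← Matrix.mul_assoc, hP', one_mul]
  rw [sympAdj_mul, h2, sympAdj_sub, sympAdj_one, Matrix.mul_assoc, mul_sub, mul_one, hg2, ← h5,
    ← mul_neg, neg_sub]

/-- The symplectic stabilizer of a flag is connected, and so is its subgroup that fixes the
functional `ω(·, z)` on a member of the flag. The part of `g` on which the eigenvalue is `-1` is
removed by a one-parameter group; on the rest the Cayley transform linearizes the group. -/
theorem joinedToOne_symplectic {F : ℕ → Submodule ℂ (l ⊕ l → ℂ)} {N : ℕ} (hF : Monotone F)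
    (hN : F N = ⊤) (r : ℕ) (z : l ⊕ l → ℂ) {g : SL (l ⊕ l)} (hg : g.1 ∈ symplecticGroup l ℂ)
    (hgF : g.1 ∈ flagAlg F) (hgz : ∀ u ∈ F r, sympForm (g.1 *ᵥ u) z = sympForm u z) :
    JoinedToOne {h : SL (l ⊕ l) | h.1 ∈ symplecticGroup l ℂ ∧ h.1 ∈ flagAlg F ∧
      ∀ u ∈ F r, sympForm (h.1 *ᵥ u) z = sympForm u z} g := by
  set a := g.1 with ha
  set b := sympAdj a with hb
  have hba : b * a = 1 := mem_symplecticGroup_iff.1 hg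
  have hab : a * b = 1 := mul_eq_one_comm.1 hba
  have hbF : b ∈ flagAlg F := by
    have : a⁻¹ = b := inv_eq_left_inv hba
    rw [← this]
    exact inv_mem_subalgebra _ hgF (by rw [ha, g.2]; exact one_ne_zero)
  have hbz : ∀ u ∈ F r, sympForm (b *ᵥ u) z = sympForm u z := fun u hu => by
    rw [← hgz _ (hbF r u hu), mulVec_mulVec, hab, one_mulVec]
  -- the eigenvalue `-1` of `a` corresponds to the eigenvalue `-2` of the selfadjoint `y = a + a⁻¹`
  set y := a + b with hy
  have hyF : y ∈ flagAlg F := add_mem hgF hbF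
  have hys : sympAdj y = y := by rw [hy, sympAdj_add, hb, sympAdj_sympAdj, add_comm]
  obtain ⟨f, w, k, hk, hdvd, hfw⟩ := exists_spectral_polynomial (y.charpoly_monic.ne_zero) (-2)
  have hχ : Polynomial.aeval y y.charpoly = 0 := aeval_self_charpoly y
  set p := Polynomial.aeval y f with hp
  have hpp : p * p = p := aeval_spectral_idem hχ hdvd hfw
  have hps : sympAdj p = p := sympAdj_aeval hys f
  have hpy : p ∈ Algebra.adjoin ℂ {y} := Polynomial.aeval_mem_adjoin_singleton ℂ y
  have hpF : p ∈ flagAlg F := Algebra.adjoin_le (Set.singleton_subset_iff.2 hyF) hpy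
  -- `y + 2` is nilpotent on the image of `p` and invertible on its kernel
  have h2y : Polynomial.aeval y (Polynomial.X - Polynomial.C (-2 : ℂ)) = y + (2 : ℂ) • 1 := by
    simp [Algebra.smul_def]
  have hnil : (y + (2 : ℂ) • 1) ^ k * p = 0 := by
    obtain ⟨s, hs⟩ := hdvd
    rw [← h2y, ← map_pow, hp, ← map_mul, hs, map_mul, hχ, zero_mul]
  have hinv : 1 - p = Polynomial.aeval y w * (y + (2 : ℂ) • 1) ^ k := by
    have := congrArg (Polynomial.aeval y) hfw
    rwa [map_sub, map_one, map_mul, map_pow, h2y] at this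
  have hay : a * y = y * a := by rw [hy, mul_add, add_mul, hab, hba]
  have hap : a * p = p * a := by
    have : Algebra.adjoin ℂ {y} ≤ Subalgebra.centralizer ℂ {a} :=
      Algebra.adjoin_le (Set.singleton_subset_iff.2
        (Subalgebra.mem_centralizer_iff ℂ |>.2 fun x hx => by rw [Set.mem_singleton_iff.1 hx, hay]))
    exact (Subalgebra.mem_centralizer_iff ℂ).1 (this hpy) a rfl
  -- on `F r` the functional `ω(·, z)` is multiplied by `4` under `y + 2`, which is nilpotent on the
  -- image of `p`
  have hpz : ∀ u ∈ F r, sympForm (p *ᵥ u) z = 0 := by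
    have h4 : ∀ j, ∀ u ∈ F r, sympForm ((y + (2 : ℂ) • 1) ^ j *ᵥ u) z = 4 ^ j * sympForm u z := by
      intro j
      induction j with
      | zero => intro u _; simp
      | succ j ih =>
        intro u hu
        have hu' : (y + (2 : ℂ) • 1) *ᵥ u ∈ F r :=
          (flagAlg F).add_mem hyF ((flagAlg F).smul_mem (flagAlg F).one_mem 2) r u hu
        rw [pow_succ, ← mulVec_mulVec, ih _ hu', add_mulVec, hy, add_mulVec, smul_mulVec,
          one_mulVec, sympForm_add_left, sympForm_add_left, sympForm_smul_left, hgz u hu, hbz u hu]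
        ring
    intro u hu
    have := h4 k _ (hpF r u hu)
    rw [mulVec_mulVec, hnil, zero_mulVec, sympForm, zero_dotProduct] at this
    exact (mul_eq_zero.1 this.symm).resolve_left (pow_ne_zero k (by norm_num : (4 : ℂ) ≠ 0))
  obtain ⟨X, hXF, hXs, hXX, hpX, hXp, hXz⟩ := exists_sympAdj_eq_neg hF hN z hpF hps hpp
  -- every element of the one-parameter group satisfies the conditions
  have hTz : ∀ s, ∀ u ∈ F r, sympForm (sympTorus p X s *ᵥ u) z = sympForm u z := by
    intro s u hu
    rw [sympForm_mulVec_left, sympAdj_sympTorus hps hXs, sympTorus_mulVec hXz, inv_inv,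
      sympForm_add_right, sympForm_smul_right, ← hps, ← sympForm_mulVec_left, hpz u hu, mul_zero,
      add_zero]
  set q := 1 - (2 : ℂ) • p with hq
  have hqT : q = sympTorus p X (-1) := (sympTorus_neg_one p X).symm
  have hqq : q * q = 1 := by
    rw [hq, sub_mul, mul_sub, mul_sub, one_mul, mul_one, smul_mul_smul_comm, hpp, one_mul]
    module
  have hpq : p * q = -p := by
    rw [hq, mul_sub, mul_one, mul_smul_comm, hpp, two_smul]; abel
  set g' := a * q with hg'
  have hg'S : g' ∈ symplecticGroup l ℂ := mul_mem_symplecticGroup hg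
    (hqT ▸ sympTorus_mem_symplecticGroup hps hXs hpp hXX hpX hXp (by norm_num))
  have hqF : q ∈ flagAlg F := hqT ▸ sympTorus_mem hpF hXF _
  have hg'F : g' ∈ flagAlg F := mul_mem hgF hqF
  have hg'z : ∀ u ∈ F r, sympForm (g' *ᵥ u) z = sympForm u z := fun u hu => by
    rw [hg', ← mulVec_mulVec, hgz _ (hqF r u hu), hqT, hTz _ u hu]
  -- changing the sign of `a` on the image of `p` has removed the eigenvalue `-1`
  have hdet : (1 + g').det ≠ 0 := by
    intro h0
    obtain ⟨x, hx0, hx⟩ := exists_mulVec_eq_zero_iff.2 h0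
    refine hx0 ?_
    rw [add_mulVec, one_mulVec] at hx
    have hapx : a *ᵥ (p *ᵥ x) = p *ᵥ x := by
      have := congrArg (p *ᵥ ·) hx
      simp only [mulVec_add, mulVec_zero] at this
      rw [hg', mulVec_mulVec, ← Matrix.mul_assoc, ← hap, Matrix.mul_assoc, hpq, mul_neg,
        neg_mulVec, ← mulVec_mulVec] at this
      exact (eq_of_sub_eq_zero (by rw [sub_eq_add_neg]; exact this)).symm
    have hbpx : b *ᵥ (p *ᵥ x) = p *ᵥ x := by
      conv_lhs => rw [← hapx]
      rw [mulVec_mulVec, hba, one_mulVec]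
    have hpx : p *ᵥ x = 0 := by
      have h4 : ∀ j, (y + (2 : ℂ) • 1) ^ j *ᵥ (p *ᵥ x) = (4 : ℂ) ^ j • (p *ᵥ x) := by
        intro j
        induction j with
        | zero => simp
        | succ j ih =>
          rw [pow_succ', ← mulVec_mulVec, ih, mulVec_smul, hy, add_mulVec, add_mulVec, hapx, hbpx,
            smul_mulVec, one_mulVec]
          module
      have := h4 k
      rw [mulVec_mulVec, hnil, zero_mulVec] at this
      exact (smul_eq_zero.1 this.symm).resolve_left (pow_ne_zero k (by norm_num : (4 : ℂ) ≠ 0))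
    have hqx : q *ᵥ x = x := by rw [hq, sub_mulVec, smul_mulVec, hpx]; simp
    have hax : a *ᵥ x = -x := by
      rw [hg', ← mulVec_mulVec, hqx] at hx
      exact eq_neg_of_add_eq_zero_right hx
    have hbx : b *ᵥ x = -x := by
      have : b *ᵥ (a *ᵥ x) = x := by rw [mulVec_mulVec, hba, one_mulVec]
      rw [hax, mulVec_neg] at this
      rw [← this, neg_neg, this]
    have hyx : (y + (2 : ℂ) • 1) *ᵥ x = 0 := by
      rw [hy, add_mulVec, add_mulVec, hax, hbx, smul_mulVec, one_mulVec]
      module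
    have h1 : (1 - p) *ᵥ x = 0 := by
      obtain ⟨j, rfl⟩ := Nat.exists_eq_succ_of_ne_zero hk
      rw [hinv, pow_succ, ← mulVec_mulVec, ← mulVec_mulVec, hyx, mulVec_zero, mulVec_zero]
    rwa [sub_mulVec, one_mulVec, hpx, sub_zero] at h1
  set c := (1 - g') * (1 + g')⁻¹ with hc
  have hcs : sympAdj c = -c := sympAdj_cayley hg'S hdet
  have hiF : (1 + g')⁻¹ ∈ flagAlg F :=
    inv_mem_subalgebra _ ((flagAlg F).add_mem (flagAlg F).one_mem hg'F) hdet
  have hcF : c ∈ flagAlg F :=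
    (flagAlg F).mul_mem ((flagAlg F).sub_mem (flagAlg F).one_mem hg'F) hiF
  have hcz : ∀ u ∈ F r, sympForm (c *ᵥ u) z = 0 := fun u hu => by
    rw [hc, ← mulVec_mulVec, sub_mulVec, one_mulVec, sympForm_sub_left, hg'z _ (hiF r u hu),
      sub_self]
  have hinv1 : (1 + g') * (1 + g')⁻¹ = 1 := mul_nonsing_inv _ hdet.isUnit
  have h1c : 1 + c = (2 : ℂ) • (1 + g')⁻¹ := by
    calc 1 + c = (1 + g' + (1 - g')) * (1 + g')⁻¹ := by rw [add_mul, hinv1]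
      _ = _ := by rw [add_add_sub_cancel, one_add_one_eq_two, two_mul, two_smul]
  have h1c' : 1 - c = (2 : ℂ) • (g' * (1 + g')⁻¹) := by
    calc 1 - c = (1 + g' - (1 - g')) * (1 + g')⁻¹ := by rw [sub_mul, hinv1]
      _ = _ := by rw [add_sub_sub_cancel, add_mul, two_smul]
  have h1cdet : (1 + c).det ≠ 0 := by
    rw [h1c, det_smul]
    exact mul_ne_zero (pow_ne_zero _ two_ne_zero) (right_ne_zero_of_mul_eq_one
      (a := (1 + g').det) (by rw [← det_mul, hinv1, det_one]))
  have hcay1 : (1 - c) * (1 + c)⁻¹ = g' := by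
    have : 1 - c = g' * (1 + c) := by rw [h1c, h1c', mul_smul_comm]
    rw [this, Matrix.mul_assoc, mul_nonsing_inv _ h1cdet.isUnit, mul_one]
  set D : Set ℂ := {t | (segment (1 + c) t).det ≠ 0 ∧ 1 - 2 * t ≠ 0} with hD
  have hseg : ∀ t, segment (1 + c) t = 1 + t • c := fun t => by rw [segment, add_sub_cancel_left]
  have hfD : (fun t : ℂ => 1 - 2 * t) ∈ regOn D :=
    (regOn D).sub_mem (regOn D).one_mem ((regOn D).smul_mem id_mem_regOn (2 : ℂ))
  have hDfin : Dᶜ.Finite := by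
    rw [hD, Set.ofPred_and, Set.compl_inter]
    refine (finite_det_segment_eq_zero _).union ((Set.finite_singleton (2⁻¹ : ℂ)).subset ?_)
    intro t ht
    simp only [Set.mem_compl_iff, Set.mem_ofPred_eq, not_not] at ht
    rw [Set.mem_singleton_iff]
    linear_combination (-1 / 2 : ℂ) * ht
  have hmem : ∀ t ∈ D, (1 - t • c) * (1 + t • c)⁻¹ * sympTorus p X (1 - 2 * t) ∈
      symplecticGroup l ℂ := fun t ht => by
    refine mul_mem_symplecticGroup (cayley_mem_symplecticGroup ?_ (hseg t ▸ ht.1))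
      (sympTorus_mem_symplecticGroup hps hXs hpp hXX hpX hXp ht.2)
    rw [sympAdj_smul, hcs, smul_neg]
  -- the Cayley parameter runs from `0` to `1` while the torus parameter runs from `1` to `-1`
  refine JoinedToOne.of_curve hDfin
    (M := fun t => (1 - t • c) * (1 + t • c)⁻¹ * sympTorus p X (1 - 2 * t)) ?_
    (fun t ht => SymplecticGroup.det_eq_one (hmem t ht)) ?_ (s := 0) (t := 1) ?_ ?_ ?_ ?_
  · refine (((MatMem.const 1).sub (MatMem.smul_const id_mem_regOn c)).mul
      (MatMem.inv ((MatMem.const 1).add (MatMem.smul_const id_mem_regOn c)) ?_)).mul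
      (matMem_sympTorus hfD (fun t ht => ht.2) p X)
    refine inv_mem_regOn ((MatMem.const 1).add (MatMem.smul_const id_mem_regOn c)).det ?_
    exact fun t ht => hseg t ▸ ht.1
  · intro t ht h hh
    have htd : (1 + t • c).det ≠ 0 := hseg t ▸ ht.1
    have hPF : (1 + t • c)⁻¹ ∈ flagAlg F := inv_mem_subalgebra _
      ((flagAlg F).add_mem (flagAlg F).one_mem ((flagAlg F).smul_mem hcF t)) htd
    have hTF : sympTorus p X (1 - 2 * t) ∈ flagAlg F := sympTorus_mem hpF hXF _
    refine ⟨hh ▸ hmem t ht, ?_, fun u hu => ?_⟩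
    · rw [hh]
      exact (flagAlg F).mul_mem ((flagAlg F).mul_mem ((flagAlg F).sub_mem (flagAlg F).one_mem
        ((flagAlg F).smul_mem hcF t)) hPF) hTF
    · rw [hh, ← mulVec_mulVec, ← hTz (1 - 2 * t) u hu]
      have hv := hTF r u hu
      generalize sympTorus p X (1 - 2 * t) *ᵥ u = v at hv
      have hx := hPF r v hv
      have hvx : v = (1 + t • c) *ᵥ ((1 + t • c)⁻¹ *ᵥ v) := by
        rw [mulVec_mulVec, mul_nonsing_inv _ htd.isUnit, one_mulVec]
      conv_rhs => rw [hvx]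
      rw [← mulVec_mulVec, sub_mulVec, add_mulVec, smul_mulVec, one_mulVec, sympForm_sub_left,
        sympForm_add_left, sympForm_smul_left, hcz _ hx, mul_zero, sub_zero, add_zero]
  · simp [hD]
  · simp
  · refine ⟨?_, by norm_num⟩
    rw [segment_one]
    exact h1cdet
  · have : (1 - 2 * 1 : ℂ) = -1 := by norm_num
    rw [one_smul, hcay1, this, ← hqT, hg', Matrix.mul_assoc, hqq, mul_one]

end SymplecticConnected

/-! ### The symplectic groups in even and odd dimension -/

theorem JoinedToOne.map {ι κ : Type} [Fintype ι] [DecidableEq ι] [Fintype κ] [DecidableEq κ]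
    {φ : SL ι →* SL κ} (hφ : @Continuous _ _ (zariski ι) (zariski κ) φ) {S : Set (SL ι)}
    {T : Set (SL κ)} (hST : ∀ g ∈ S, φ g ∈ T) {x : SL ι} (hx : JoinedToOne S x) :
    JoinedToOne T (φ x) := by
  obtain ⟨C, hCS, hC, h1, hxC⟩ := hx
  refine ⟨φ '' C, ?_, hC.image hφ, ⟨1, h1, map_one φ⟩, ⟨x, hxC, rfl⟩⟩
  rintro _ ⟨g, hg, rfl⟩
  exact hST g (hCS hg)

section SymplecticSubgroups

variable {n : ℕ}

theorem embedOdd_coe (g : SL (Fin n ⊕ Fin n)) : (embedOdd n g).1 = fromBlocks g.1 0 0 1 := rfl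

theorem mem_SpOdd {g : SL (OddIdx n)} :
    g ∈ SpOdd n ↔ ∃ A ∈ symplecticGroup (Fin n) ℂ, g.1 = fromBlocks A 0 0 1 := by
  constructor
  · rintro ⟨a, ha, rfl⟩
    exact ⟨a.1, ha, embedOdd_coe a⟩
  · rintro ⟨A, hA, h⟩
    exact ⟨⟨A, SymplecticGroup.det_eq_one hA⟩, hA, Subtype.ext h.symm⟩

theorem mem_SpTorus {g : SL (OddIdx n)} :
    g ∈ SpTorus n ↔ ∃ A ∈ symplecticGroup (Fin n) ℂ, ∃ t : ℂ, t ≠ 0 ∧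
      g.1 = fromBlocks (t • A) 0 0 (t⁻¹ ^ (2 * n) • 1) := by
  constructor
  · rintro ⟨⟨a, t⟩, rfl⟩
    refine ⟨a.1.1, a.2, t, t.ne_zero, ?_⟩
    rw [← Units.val_inv_eq_inv_val]
    rfl
  · rintro ⟨A, hA, t, ht, h⟩
    refine ⟨(⟨⟨A, SymplecticGroup.det_eq_one hA⟩, hA⟩, Units.mk0 t ht), Subtype.ext ?_⟩
    rw [h]
    rfl

theorem SpOdd_le_SpTorus : SpOdd n ≤ SpTorus n := fun g hg => by
  obtain ⟨A, hA, h⟩ := mem_SpOdd.1 hg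
  exact mem_SpTorus.2 ⟨A, hA, 1, one_ne_zero, by simpa using h⟩

theorem isClosedSubgroup_Sp (n : ℕ) : IsClosedSubgroup (Sp n) := by
  have : (Sp n : Set (SL (Fin n ⊕ Fin n))) =
      {g | g.1 * J (Fin n) ℂ * g.1ᵀ = (fun _ => J (Fin n) ℂ) g} := by
    ext g
    exact SymplecticGroup.mem_iff
  rw [IsClosedSubgroup, this]
  exact zClosed_matEq ((matMem_coe.mul (MatMem.const _)).mul fun i j => matMem_coe j i)
    (MatMem.const _)

theorem isClosedSubgroup_SpOdd (n : ℕ) : IsClosedSubgroup (SpOdd n) := by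
  have : (SpOdd n : Set (SL (OddIdx n))) =
      {g | g.1 ∈ Subalgebra.toSubmodule (blockAlg (Fin n ⊕ Fin n) (Fin 1))} ∩
      ({g | g.1.toBlocks₁₁ * J (Fin n) ℂ * (g.1.toBlocks₁₁)ᵀ = (fun _ => J (Fin n) ℂ) g} ∩
      {g | g.1.toBlocks₂₂ = (fun _ => 1) g}) := by
    ext g
    simp only [SetLike.mem_coe, Set.mem_inter_iff, Set.mem_ofPred_eq,
      Subalgebra.mem_toSubmodule, mem_blockAlg, mem_SpOdd]
    constructor
    · rintro ⟨A, hA, h⟩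
      refine ⟨⟨A, 1, h⟩, ?_, ?_⟩
      · rw [h, toBlocks_fromBlocks₁₁]
        exact SymplecticGroup.mem_iff.1 hA
      · rw [h, toBlocks_fromBlocks₂₂]
    · rintro ⟨⟨A, D, h⟩, hA, hD⟩
      rw [h, toBlocks_fromBlocks₁₁] at hA
      rw [h, toBlocks_fromBlocks₂₂] at hD
      exact ⟨A, SymplecticGroup.mem_iff.2 hA, by rw [h, hD]⟩
  rw [IsClosedSubgroup, this]
  exact zClosed_inter (zClosed_mem_submodule _) (zClosed_inter
    (zClosed_matEq ((matMem_toBlocks₁₁.mul (MatMem.const _)).mul fun i j => matMem_toBlocks₁₁ j i)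
      (MatMem.const _)) (zClosed_matEq matMem_toBlocks₂₂ (MatMem.const _)))

/-- The similitudes `B * J * Bᵀ = μ • J` are the matrices for which the entries of `B * J * Bᵀ` are
proportional to those of `J`; such a `B` is `√μ` times a symplectic matrix. -/
theorem isClosedSubgroup_SpTorus (n : ℕ) : IsClosedSubgroup (SpTorus n) := by
  set K : SL (OddIdx n) → Matrix (Fin n ⊕ Fin n) (Fin n ⊕ Fin n) ℂ :=
    fun g => g.1.toBlocks₁₁ * J (Fin n) ℂ * (g.1.toBlocks₁₁)ᵀ with hK
  have hKmem : MatMem (polyFun (OddIdx n)) K :=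
    (matMem_toBlocks₁₁.mul (MatMem.const _)).mul fun i j => matMem_toBlocks₁₁ j i
  have : (SpTorus n : Set (SL (OddIdx n))) =
      {g | g.1 ∈ Subalgebra.toSubmodule (blockAlg (Fin n ⊕ Fin n) (Fin 1))} ∩
      {g | ∀ a b : (Fin n ⊕ Fin n) × (Fin n ⊕ Fin n),
        J (Fin n) ℂ b.1 b.2 * K g a.1 a.2 - J (Fin n) ℂ a.1 a.2 * K g b.1 b.2 = 0} := by
    ext g
    simp only [SetLike.mem_coe, Set.mem_inter_iff, Set.mem_ofPred_eq,
      Subalgebra.mem_toSubmodule, mem_blockAlg, mem_SpTorus]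
    constructor
    · rintro ⟨A, hA, t, ht, h⟩
      refine ⟨⟨_, _, h⟩, fun a b => ?_⟩
      have : K g = (t * t) • J (Fin n) ℂ := by
        rw [hK]
        simp only
        rw [h, toBlocks_fromBlocks₁₁, transpose_smul, smul_mul_assoc, smul_mul_assoc,
          mul_smul_comm, SymplecticGroup.mem_iff.1 hA, smul_smul]
      rw [this]
      simp only [Matrix.smul_apply, smul_eq_mul]
      ring
    · rintro ⟨⟨B, E, h⟩, hprop⟩
      have hdet : B.det * E.det = 1 := by rw [← det_fromBlocks_zero₂₁ B 0 E, ← h, g.2]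
      have hE : E = E.det • 1 := by
        ext i j
        rw [Subsingleton.elim i 0, Subsingleton.elim j 0]
        simp
      rcases Nat.eq_zero_or_pos n with rfl | hn
      · rw [det_isEmpty, one_mul] at hdet
        refine ⟨1, one_mem _, 1, one_ne_zero, ?_⟩
        rw [h, hE, hdet, Subsingleton.elim B ((1 : ℂ) • 1)]
        simp
      have hKB : K g = B * J (Fin n) ℂ * Bᵀ := by rw [hK]; simp only; rw [h, toBlocks_fromBlocks₁₁]
      have : Nonempty (Fin n) := ⟨⟨0, hn⟩⟩
      set μ := K g (Sum.inr ⟨0, hn⟩) (Sum.inl ⟨0, hn⟩) with hμ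
      have hprop' : B * J (Fin n) ℂ * Bᵀ = μ • J (Fin n) ℂ := by
        rw [← hKB]
        ext i j
        have := hprop (i, j) (Sum.inr ⟨0, hn⟩, Sum.inl ⟨0, hn⟩)
        simp only [J, fromBlocks_apply₂₁, one_apply_eq, one_mul] at this
        rw [Matrix.smul_apply, smul_eq_mul, mul_comm]
        exact sub_eq_zero.1 this
      have hBdet : B.det ≠ 0 := left_ne_zero_of_mul_eq_one hdet
      have hμ0 : μ ≠ 0 := by
        intro h0
        rw [h0, zero_smul] at hprop'
        have := congrArg det hprop'
        rw [det_mul, det_mul, det_transpose, det_zero] at this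
        exact mul_ne_zero (mul_ne_zero hBdet (isUnit_det_J (Fin n) ℂ).ne_zero) hBdet this
      obtain ⟨t, ht⟩ := IsAlgClosed.exists_pow_nat_eq μ (n := 2) two_pos
      have ht0 : t ≠ 0 := by
        rintro rfl
        exact hμ0 (by rw [← ht]; simp)
      have hA : t⁻¹ • B ∈ symplecticGroup (Fin n) ℂ := by
        rw [SymplecticGroup.mem_iff, transpose_smul, smul_mul_assoc, smul_mul_assoc,
          mul_smul_comm, smul_smul, hprop', smul_smul, ← ht]
        have : t⁻¹ * t⁻¹ * t ^ 2 = 1 := by field_simp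
        rw [this, one_smul]
      refine ⟨t⁻¹ • B, hA, t, ht0, ?_⟩
      have hd : t⁻¹ ^ (2 * n) * B.det = 1 := by
        rw [← SymplecticGroup.det_eq_one hA, det_smul, Fintype.card_sum, Fintype.card_fin, two_mul]
      have hEd : E.det = t⁻¹ ^ (2 * n) :=
        mul_left_cancel₀ hBdet (by rw [hdet, mul_comm, hd])
      rw [h, hE, hEd, smul_smul, mul_inv_cancel₀ ht0, one_smul]
  rw [IsClosedSubgroup, this]
  refine zClosed_inter (zClosed_mem_submodule _) (zClosed_forall fun a => zClosed_forall fun b =>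
    zClosed_eq (f := fun g => J (Fin n) ℂ b.1 b.2 * K g a.1 a.2 - J (Fin n) ℂ a.1 a.2 * K g b.1 b.2)
      ?_ 0)
  exact (polyFun _).sub_mem ((polyFun _).smul_mem (hKmem a.1 a.2) _)
    ((polyFun _).smul_mem (hKmem b.1 b.2) _)

theorem isParabolicallyConnected_Sp (n : ℕ) : IsParabolicallyConnected (Sp n) := by
  refine isParabolicallyConnected_of_flags fun F N hmono _ hN x hx => ?_
  refine (joinedToOne_symplectic hmono hN 0 0 hx.2 hx.1 fun u _ => by simp [sympForm]).mono ?_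
  rintro h ⟨hS, hF, -⟩
  exact ⟨hF, hS⟩

/-- The projection of a flag of `ℂ^(2n) ⊕ ℂ` to `ℂ^(2n)`. -/
def projFlag (F : ℕ → Submodule ℂ (OddIdx n → ℂ)) (k : ℕ) :
    Submodule ℂ (Fin n ⊕ Fin n → ℂ) :=
  (F k).map (LinearMap.funLeft ℂ ℂ Sum.inl)

theorem mem_projFlag {F : ℕ → Submodule ℂ (OddIdx n → ℂ)} {k : ℕ} {x : Fin n ⊕ Fin n → ℂ} :
    x ∈ projFlag F k ↔ ∃ s : ℂ, Sum.elim x (fun _ => s) ∈ F k := by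
  constructor
  · rintro ⟨y, hy, rfl⟩
    refine ⟨y (Sum.inr 0), ?_⟩
    have : (Sum.elim (LinearMap.funLeft ℂ ℂ Sum.inl y) fun _ => y (Sum.inr 0)) = y := by
      ext (i | i)
      · rfl
      · rw [Subsingleton.elim i 0]; rfl
    rwa [this]
  · rintro ⟨s, hs⟩
    exact ⟨_, hs, by ext i; rfl⟩

theorem monotone_projFlag {F : ℕ → Submodule ℂ (OddIdx n → ℂ)} (hF : Monotone F) :
    Monotone (projFlag F) := fun _ _ h => Submodule.map_mono (hF h)

theorem projFlag_eq_top {F : ℕ → Submodule ℂ (OddIdx n → ℂ)} {N : ℕ} (hN : F N = ⊤) :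
    projFlag F N = ⊤ :=
  eq_top_iff.2 fun x _ => mem_projFlag.2 ⟨0, by rw [hN]; trivial⟩

/-- A flag of `ℂ^(2n) ⊕ ℂ` consists, below the first member that contains the second summand, of
graphs of a functional `ω(·, z)`, and from there on of direct sums. Its stabilizer among the
matrices `diag(A, c)` is described by the projected flag and this functional. -/
theorem exists_diag_mem_flagAlg_iff {F : ℕ → Submodule ℂ (OddIdx n → ℂ)} {N : ℕ}
    (hF : Monotone F) (h0 : F 0 = ⊥) (hN : F N = ⊤) :
    ∃ (r : ℕ) (z : Fin n ⊕ Fin n → ℂ), ∀ (A : Matrix (Fin n ⊕ Fin n) (Fin n ⊕ Fin n) ℂ) (c : ℂ),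
      fromBlocks A 0 0 (c • 1) ∈ flagAlg F ↔ A ∈ flagAlg (projFlag F) ∧
        ∀ x ∈ projFlag F r, sympForm (A *ᵥ x) z = c * sympForm x z := by
  set l : OddIdx n → ℂ := Sum.elim 0 (fun _ => 1) with hl
  have hex : ∃ k, l ∈ F k := ⟨N, by rw [hN]; trivial⟩
  classical
  have hspec : l ∈ F (Nat.find hex) := Nat.find_spec hex
  have hmin : ∀ j < Nat.find hex, l ∉ F j := fun j hj => Nat.find_min hex hj
  set k₀ := Nat.find hex
  have hk₀ : k₀ ≠ 0 := by
    intro h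
    rw [h, h0, Submodule.mem_bot] at hspec
    simpa [hl] using congrFun hspec (Sum.inr 0)
  obtain ⟨y, hyF, hyl⟩ := exists_dotProduct_functional (hmin (k₀ - 1) (by omega))
  obtain ⟨z, hz⟩ := exists_sympForm_eq (-(y ∘ Sum.inl))
  -- on the member of index `k₀ - 1` the last coordinate is the functional `ω(·, z)`
  have hgraph : ∀ (x : Fin n ⊕ Fin n → ℂ) (s : ℂ), Sum.elim x (fun _ => s) ∈ F (k₀ - 1) →
      s = sympForm x z := by
    intro x s hx
    have h1 := hyF _ hx
    have h2 : y (Sum.inr 0) = 1 := by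
      rw [← hyl, hl]
      simp [dotProduct]
    rw [hz, neg_dotProduct]
    simp only [dotProduct, Fintype.sum_sum_type, Sum.elim_inl, Sum.elim_inr,
      Finset.univ_unique, Fin.default_eq_zero, Finset.sum_singleton, h2, one_mul] at h1
    simp only [dotProduct, Fintype.sum_sum_type, Function.comp_apply]
    linear_combination h1
  have hmul : ∀ (A : Matrix (Fin n ⊕ Fin n) (Fin n ⊕ Fin n) ℂ) (c : ℂ) (x : Fin n ⊕ Fin n → ℂ)
      (s : ℂ), fromBlocks A 0 0 (c • (1 : Matrix (Fin 1) (Fin 1) ℂ)) *ᵥ Sum.elim x (fun _ => s) =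
        Sum.elim (A *ᵥ x) (fun _ => c * s) := by
    intro A c x s
    rw [fromBlocks_mulVec]
    simp only [Sum.elim_comp_inl, Sum.elim_comp_inr, zero_mulVec, add_zero, zero_add, smul_mulVec,
      one_mulVec]
    rfl
  refine ⟨k₀ - 1, z, fun A c => ⟨fun h => ⟨fun k x hx => ?_, fun x hx => ?_⟩, fun h k u hu => ?_⟩⟩
  · obtain ⟨s, hs⟩ := mem_projFlag.1 hx
    have := h k _ hs
    rw [hmul] at this
    exact mem_projFlag.2 ⟨_, this⟩
  · obtain ⟨s, hs⟩ := mem_projFlag.1 hx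
    have := h _ _ hs
    rw [hmul] at this
    rw [← hgraph _ _ this, ← hgraph _ _ hs]
  · obtain ⟨x, s, rfl⟩ : ∃ x s, u = Sum.elim x (fun _ => s) :=
      ⟨u ∘ Sum.inl, u (Sum.inr 0), by
        ext (i | i)
        · rfl
        · rw [Subsingleton.elim i 0]; rfl⟩
    rw [hmul]
    obtain ⟨s', hs'⟩ := mem_projFlag.1 (h.1 k x (mem_projFlag.2 ⟨s, hu⟩))
    rcases lt_or_ge k k₀ with hk | hk
    · have hle : F k ≤ F (k₀ - 1) := hF (by omega)
      have h1 := hgraph _ _ (hle hs')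
      rw [h.2 x (mem_projFlag.2 ⟨s, hle hu⟩), ← hgraph _ _ (hle hu)] at h1
      rwa [← h1]
    · have : Sum.elim (A *ᵥ x) (fun _ => c * s) =
          Sum.elim (A *ᵥ x) (fun _ => s') + (c * s - s') • l := by
        ext (i | i) <;> simp [hl]
      rw [this]
      exact (F k).add_mem hs' ((F k).smul_mem _ (hF hk hspec))

theorem joinedToOne_SpOdd {F : ℕ → Submodule ℂ (OddIdx n → ℂ)} {N : ℕ}
    (hF : Monotone F) (h0 : F 0 = ⊥) (hN : F N = ⊤) {x : SL (OddIdx n)}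
    (hx : x ∈ algGroup (flagAlg F) ⊓ SpOdd n) :
    JoinedToOne ((algGroup (flagAlg F) ⊓ SpOdd n : Subgroup _) : Set (SL (OddIdx n))) x := by
  obtain ⟨r, z, hiff⟩ := exists_diag_mem_flagAlg_iff hF h0 hN
  obtain ⟨a, ha, rfl⟩ := hx.2
  have hiff' : ∀ A : SL (Fin n ⊕ Fin n), embedOdd n A ∈ algGroup (flagAlg F) ↔
      A.1 ∈ flagAlg (projFlag F) ∧
        ∀ x ∈ projFlag F r, sympForm (A.1 *ᵥ x) z = sympForm x z := fun A => by
    have := hiff A.1 1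
    simp only [one_smul, one_mul] at this
    exact this
  have hcont : @Continuous _ _ (zariski _) (zariski _) (embedOdd n) :=
    zContinuous (MatMem.fromBlocks matMem_coe (MatMem.const 1))
  obtain ⟨haF, haz⟩ := (hiff' a).1 hx.1
  refine (joinedToOne_symplectic (monotone_projFlag hF) (projFlag_eq_top hN) r z ha haF haz).map
    hcont ?_
  rintro g ⟨hgS, hgF, hgz⟩
  exact ⟨(hiff' g).2 ⟨hgF, hgz⟩, ⟨g, hgS, rfl⟩⟩

theorem isParabolicallyConnected_SpOdd (n : ℕ) : IsParabolicallyConnected (SpOdd n) :=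
  isParabolicallyConnected_of_flags fun _ _ hmono h0 hN _ hx => joinedToOne_SpOdd hmono h0 hN hx

/-- The one-parameter group that scales the functional attached to the flag lifts the torus factor
to the stabilizer of the flag. -/
theorem exists_joinedToOne_SpTorus {F : ℕ → Submodule ℂ (OddIdx n → ℂ)} {N : ℕ}
    (hF : Monotone F) (h0 : F 0 = ⊥) (hN : F N = ⊤) {t : ℂ} (ht : t ≠ 0) :
    ∃ T ∈ symplecticGroup (Fin n) ℂ, ∃ g : SL (OddIdx n),
      g.1 = fromBlocks (t • T) 0 0 (t⁻¹ ^ (2 * n) • 1) ∧ g ∈ algGroup (flagAlg F) ∧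
      JoinedToOne ((algGroup (flagAlg F) ⊓ SpTorus n : Subgroup _) : Set (SL (OddIdx n))) g := by
  obtain ⟨r, z, hiff⟩ := exists_diag_mem_flagAlg_iff hF h0 hN
  obtain ⟨X, hXF, hXs, hXX, hpX, hXp, hXz⟩ := exists_sympAdj_eq_neg (monotone_projFlag hF)
    (projFlag_eq_top hN) z (flagAlg (projFlag F)).one_mem sympAdj_one (one_mul 1)
  have hTS : ∀ τ : ℂ, τ ≠ 0 → sympTorus 1 X (τ⁻¹ ^ (2 * n + 1)) ∈ symplecticGroup (Fin n) ℂ :=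
    fun τ hτ => sympTorus_mem_symplecticGroup sympAdj_one hXs (one_mul 1) hXX hpX hXp
      (pow_ne_zero _ (inv_ne_zero hτ))
  have hMF : ∀ τ : ℂ, τ ≠ 0 → fromBlocks (τ • sympTorus 1 X (τ⁻¹ ^ (2 * n + 1))) 0 0
      (τ⁻¹ ^ (2 * n) • (1 : Matrix (Fin 1) (Fin 1) ℂ)) ∈ flagAlg F := fun τ hτ => by
    refine (hiff _ _).2 ⟨Subalgebra.smul_mem _
      (sympTorus_mem (flagAlg (projFlag F)).one_mem hXF _) _, fun u _ => ?_⟩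
    rw [smul_mulVec, sympForm_smul_left, sympForm_mulVec_left, sympAdj_sympTorus sympAdj_one hXs,
      sympTorus_mulVec hXz, inv_inv, one_mulVec, sympForm_add_right, sympForm_smul_right]
    have : τ * τ⁻¹ ^ (2 * n + 1) = τ⁻¹ ^ (2 * n) := by
      rw [pow_succ, mul_comm, mul_assoc, inv_mul_cancel₀ hτ, mul_one]
    linear_combination sympForm u z * this
  have hdet : ∀ τ : ℂ, τ ≠ 0 → (fromBlocks (τ • sympTorus 1 X (τ⁻¹ ^ (2 * n + 1))) 0 0
      (τ⁻¹ ^ (2 * n) • (1 : Matrix (Fin 1) (Fin 1) ℂ))).det = 1 := fun τ hτ => by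
    rw [det_fromBlocks_zero₂₁, det_smul, det_smul, SymplecticGroup.det_eq_one (hTS τ hτ), det_one,
      Fintype.card_sum, Fintype.card_fin, Fintype.card_fin, mul_one, mul_one, pow_one, ← two_mul,
      ← mul_pow, mul_inv_cancel₀ hτ, one_pow]
  have hmem : ∀ τ : ℂ, τ ≠ 0 → ∀ g : SL (OddIdx n), g.1 = fromBlocks
      (τ • sympTorus 1 X (τ⁻¹ ^ (2 * n + 1))) 0 0 (τ⁻¹ ^ (2 * n) • 1) →
      g ∈ algGroup (flagAlg F) ∧ g ∈ SpTorus n := fun τ hτ g hg =>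
    ⟨mem_algGroup.2 (hg ▸ hMF τ hτ), mem_SpTorus.2 ⟨_, hTS τ hτ, τ, hτ, hg⟩⟩
  have hid : (fun τ : ℂ => τ) ∈ regOn ({0}ᶜ : Set ℂ) := id_mem_regOn
  have hinv : (fun τ : ℂ => τ⁻¹) ∈ regOn ({0}ᶜ : Set ℂ) := inv_mem_regOn hid fun τ hτ => hτ
  have hpow : ∀ k : ℕ, (fun τ : ℂ => τ⁻¹ ^ k) ∈ regOn ({0}ᶜ : Set ℂ) :=
    fun k => (regOn ({0}ᶜ : Set ℂ)).pow_mem hinv k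
  refine ⟨_, hTS t ht, ⟨_, hdet t ht⟩, rfl, (hmem t ht _ rfl).1, ?_⟩
  refine JoinedToOne.of_curve (D := {0}ᶜ) (by simp) (MatMem.fromBlocks (MatMem.smul hid
    (matMem_sympTorus (hpow _) (fun τ hτ => pow_ne_zero _ (inv_ne_zero hτ)) 1 X))
    (MatMem.smul_const (hpow (2 * n)) 1)) hdet hmem (s := 1) (t := t) one_ne_zero ?_ ht rfl
  simp

theorem isParabolicallyConnected_SpTorus (n : ℕ) : IsParabolicallyConnected (SpTorus n) := by
  refine isParabolicallyConnected_of_flags fun F N hmono h0 hN x hx => ?_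
  obtain ⟨A, hA, t, ht, hxA⟩ := mem_SpTorus.1 hx.2
  obtain ⟨T, hTS, g, hgT, hgF, hgj⟩ := exists_joinedToOne_SpTorus hmono h0 hN ht
  have hT : T * sympAdj T = 1 := mul_eq_one_comm.1 (mem_symplecticGroup_iff.1 hTS)
  have hB : sympAdj T * A ∈ symplecticGroup (Fin n) ℂ := by
    refine mul_mem_symplecticGroup ?_ hA
    rw [mem_symplecticGroup_iff, sympAdj_sympAdj, hT]
  set h : SL (OddIdx n) := embedOdd n ⟨_, SymplecticGroup.det_eq_one hB⟩ with hh
  have hh1 : h.1 = fromBlocks (sympAdj T * A) 0 0 1 := rfl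
  have hhO : h ∈ SpOdd n := mem_SpOdd.2 ⟨_, hB, hh1⟩
  clear_value h
  have hx' : x = g * h := by
    refine Subtype.ext ?_
    change x.1 = g.1 * h.1
    rw [hgT, hh1, hxA, fromBlocks_multiply, smul_mul_assoc,
      ← Matrix.mul_assoc, hT, one_mul]
    simp
  have hhF : h ∈ algGroup (flagAlg F) := by
    have : h = g⁻¹ * x := by rw [hx', inv_mul_cancel_left]
    rw [this]
    exact mul_mem (inv_mem hgF) hx.1
  rw [hx']
  refine hgj.mul ((joinedToOne_SpOdd hmono h0 hN ⟨hhF, hhO⟩).mono ?_)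
  rintro y ⟨hy, hy'⟩
  exact ⟨hy, SpOdd_le_SpTorus hy'⟩

end SymplecticSubgroups

/-! ### Subgroups that are not parabolically connected -/

section NotConnected

variable {ι : Type} [Fintype ι] [DecidableEq ι]

theorem not_isParabolicallyConnected {P H : Subgroup (SL ι)} (hP : IsParabolic P) {f : SL ι → ℂ}
    (hf : f ∈ polyFun ι) (hfin : ∀ g ∈ P, g ∈ H → f g = 1 ∨ f g = -1) (h1 : f 1 = 1) {x : SL ι}
    (hxP : x ∈ P) (hxH : x ∈ H) (hx : f x = -1) : ¬ IsParabolicallyConnected H := by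
  intro h
  have hfin' : (f '' ((P ⊓ H : Subgroup (SL ι)) : Set (SL ι))).Finite := by
    refine (Set.toFinite ({1, -1} : Set ℂ)).subset ?_
    rintro _ ⟨g, hg, rfl⟩
    exact hfin g hg.1 hg.2
  have := ZPreconnected.constant (h P hP).2 hf hfin' (x := x) (y := 1) ⟨hxP, hxH⟩ (one_mem _)
  rw [hx, h1] at this
  norm_num at this

/-- The stabilizer of a member of a translated coordinate flag is parabolic. -/
theorem isParabolic_stabilizer {N : ℕ} (b : ι ≃ Fin N) (q : SL ι) (k : ℕ) :
    IsParabolic (algGroup (flagAlg fun _ : Unit => (coordFlag b k).map (mulVecLin q.1))) := by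
  refine ⟨isClosedSubgroup_algGroup _, conjTri b q, isBorel_conjTri b q, fun g hg => ?_⟩
  rw [mem_algGroup]
  exact fun _ => (mem_conjTri_iff_flag b).1 hg k

theorem isClosedSubgroup_SO (n : ℕ) : IsClosedSubgroup (SO n) := by
  have : (SO n : Set (SL (Fin n))) =
      {g : SL (Fin n) | g.1ᵀ * g.1 = (fun _ => 1) g} := rfl
  rw [IsClosedSubgroup, this]
  exact zClosed_matEq (MatMem.mul (fun i j => matMem_coe j i) matMem_coe) (MatMem.const _)

/-- In `SO(n)` the stabilizer of a nonisotropic line acts on it by a sign, and both signs occur. -/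
theorem not_isParabolicallyConnected_SO {n : ℕ} (hn : 2 ≤ n) :
    ¬ IsParabolicallyConnected (SO n) := by
  obtain ⟨m, rfl⟩ := Nat.exists_eq_add_of_le' hn
  have hW : ∀ x : Fin (m + 2) → ℂ, x ∈ (coordFlag (Equiv.refl (Fin (m + 2))) 1).map
      (mulVecLin (1 : SL (Fin (m + 2))).1) ↔ ∀ i : Fin (m + 2), i ≠ 0 → x i = 0 := by
    intro x
    have h1 : (1 : SL (Fin (m + 2))).1 = 1 := rfl
    rw [h1, mulVecLin_one, Submodule.map_id]
    refine forall_congr' fun i => ?_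
    have : 1 ≤ ((Equiv.refl (Fin (m + 2)) i : Fin (m + 2)) : ℕ) ↔ i ≠ 0 := by
      rw [Nat.one_le_iff_ne_zero, Ne, Ne, Fin.ext_iff]; rfl
    rw [this]
  set d : Fin (m + 2) → ℂ := Fin.cons (-1) (Fin.cons (-1) fun _ => 1) with hd
  have hdet : (diagonal d).det = 1 := by
    rw [det_diagonal, Fin.prod_univ_succ, Fin.prod_univ_succ]
    simp [hd]
  refine not_isParabolicallyConnected (isParabolic_stabilizer (Equiv.refl _) 1 1)
    (f := fun g => g.1 0 0) (matMem_coe 0 0) (fun g hgP hgO => ?_) (by simp)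
    (x := ⟨diagonal d, hdet⟩) ?_ ?_ (by simp [hd])
  · have hg0 : ∀ i : Fin (m + 2), i ≠ 0 → g.1 i 0 = 0 := by
      intro i hi
      have := (hW _).1 (hgP () (Pi.single 0 1) ((hW _).2 fun j hj => by simp [hj])) i hi
      simpa using this
    have h1 : g.1ᵀ * g.1 = 1 := hgO
    have h2 := congrFun (congrFun h1 0) 0
    rw [mul_apply, Finset.sum_eq_single 0 (fun i _ hi => by rw [hg0 i hi, mul_zero]) (by simp),
      transpose_apply, one_apply_eq] at h2
    exact mul_self_eq_one_iff.1 h2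
  · refine mem_algGroup.2 fun _ x hx => (hW _).2 fun i hi => ?_
    rw [mulVec_diagonal, (hW x).1 hx i hi, mul_zero]
  · change (diagonal d)ᵀ * diagonal d = 1
    rw [diagonal_transpose, diagonal_mul_diagonal, ← diagonal_one]
    congr 1
    ext i
    refine Fin.cases ?_ (fun i => Fin.cases ?_ (fun i => ?_) i) i <;> simp [hd]

/-- The stabilizer of the diagonal `{(x, x)}` in `S(GL(n) × GL(n))` consists of the matrices
`diag(A, A)` with `det A = ±1`, and both signs occur. -/
theorem not_isParabolicallyConnected_SGLxGL {n : ℕ} (hn : 1 ≤ n) :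
    ¬ IsParabolicallyConnected (SGLxGL n n) := by
  obtain ⟨m, rfl⟩ := Nat.exists_eq_add_of_le' hn
  set q : SL (Fin (m + 1) ⊕ Fin (m + 1)) := ⟨fromBlocks 1 0 1 1, by simp⟩ with hq
  have hq1 : q.1 = fromBlocks 1 0 1 1 := rfl
  have hW : ∀ x : Fin (m + 1) ⊕ Fin (m + 1) → ℂ, x ∈ (coordFlag finSumFinEquiv (m + 1)).map
      (mulVecLin q.1) ↔ x ∘ Sum.inl = x ∘ Sum.inr := by
    intro x
    constructor
    · rintro ⟨y, hy, rfl⟩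
      have hyr : y ∘ Sum.inr = 0 := by
        ext i
        exact hy (Sum.inr i) (by simp)
      rw [mulVecLin_apply, hq1, fromBlocks_mulVec, hyr]
      ext i
      simp
    · intro h
      refine ⟨Sum.elim (x ∘ Sum.inl) 0, ?_, ?_⟩
      · rintro (i | i) hi
        · exact absurd i.is_lt (not_lt.2 hi)
        · rfl
      · rw [mulVecLin_apply, hq1, fromBlocks_mulVec]
        ext (i | i)
        · simp
        · simpa using congrFun h i
  have hP : ∀ (g : SL (Fin (m + 1) ⊕ Fin (m + 1))) (A D : Matrix (Fin (m + 1)) (Fin (m + 1)) ℂ),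
      g.1 = fromBlocks A 0 0 D → (g ∈ algGroup (flagAlg fun _ : Unit =>
        (coordFlag finSumFinEquiv (m + 1)).map (mulVecLin q.1)) ↔ A = D) := by
    intro g A D hg
    rw [mem_algGroup, mem_flagAlg, hg]
    constructor
    · intro h
      refine Matrix.ext_of_mulVec_single fun i => ?_
      have := (hW _).1 (h () (Sum.elim (Pi.single i 1) (Pi.single i 1)) ((hW _).2 (by simp)))
      simpa only [fromBlocks_mulVec, Sum.elim_comp_inl, Sum.elim_comp_inr, zero_mulVec, add_zero,
        zero_add] using this
    · rintro rfl _ x hx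
      refine (hW _).2 ?_
      rw [fromBlocks_mulVec, (hW x).1 hx]
      simp
  set d : Fin (m + 1) → ℂ := Fin.cons (-1) fun _ => 1 with hd
  have hdet : (diagonal d).det = -1 := by
    rw [det_diagonal, Fin.prod_univ_succ]
    simp [hd]
  refine not_isParabolicallyConnected (isParabolic_stabilizer finSumFinEquiv q (m + 1))
    (f := fun g => g.1.toBlocks₁₁.det) matMem_toBlocks₁₁.det (fun g hgP hgS => ?_) ?_
    (x := ⟨fromBlocks (diagonal d) 0 0 (diagonal d), by
      rw [det_fromBlocks_zero₂₁, hdet]; norm_num⟩) ((hP _ _ _ rfl).2 rfl)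
    (mem_SGLxGL.2 ⟨_, _, rfl⟩) (by simp only [toBlocks_fromBlocks₁₁]; exact hdet)
  · obtain ⟨A, D, hg⟩ := mem_SGLxGL.1 hgS
    obtain rfl := (hP g A D hg).1 hgP
    have := g.2
    rw [hg, det_fromBlocks_zero₂₁] at this
    simp only [hg, toBlocks_fromBlocks₁₁]
    exact mul_self_eq_one_iff.1 this
  · change (1 : Matrix (Fin (m + 1) ⊕ Fin (m + 1)) (Fin (m + 1) ⊕ Fin (m + 1)) ℂ).toBlocks₁₁.det = 1
    rw [← fromBlocks_one, toBlocks_fromBlocks₁₁, det_one]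

end NotConnected

end ParabolicConn

theorem mainTheorem1 :
    (∀ m n : ℕ, ParabolicConn.IsClosedSubgroup (ParabolicConn.SLxSL m n) ∧
      ParabolicConn.IsParabolicallyConnected (ParabolicConn.SLxSL m n)) ∧
    (∀ m n : ℕ, m ≠ n → ParabolicConn.IsClosedSubgroup (ParabolicConn.SGLxGL m n) ∧
      ParabolicConn.IsParabolicallyConnected (ParabolicConn.SGLxGL m n)) ∧
    (∀ n : ℕ, ParabolicConn.IsClosedSubgroup (ParabolicConn.Sp n) ∧
      ParabolicConn.IsParabolicallyConnected (ParabolicConn.Sp n)) ∧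
    (∀ n : ℕ, ParabolicConn.IsClosedSubgroup (ParabolicConn.SpOdd n) ∧
      ParabolicConn.IsParabolicallyConnected (ParabolicConn.SpOdd n)) ∧
    (∀ n : ℕ, ParabolicConn.IsClosedSubgroup (ParabolicConn.SpTorus n) ∧
      ParabolicConn.IsParabolicallyConnected (ParabolicConn.SpTorus n)) ∧
    (∀ n : ℕ, 2 ≤ n → ParabolicConn.IsClosedSubgroup (ParabolicConn.SO n) ∧
      ¬ ParabolicConn.IsParabolicallyConnected (ParabolicConn.SO n)) ∧
    (∀ n : ℕ, 1 ≤ n → ParabolicConn.IsClosedSubgroup (ParabolicConn.SGLxGL n n) ∧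
      ¬ ParabolicConn.IsParabolicallyConnected (ParabolicConn.SGLxGL n n)) ∧
    (∀ (ι : Type) [Fintype ι] [DecidableEq ι] (H : Subgroup (ParabolicConn.SL ι)),
      ParabolicConn.IsClosedSubgroup H →
      (ParabolicConn.IsParabolicallyConnected H ↔
        ∀ B : Subgroup (ParabolicConn.SL ι), ParabolicConn.IsBorel B →
          ParabolicConn.IsConnectedSubgroup (B ⊓ H))) := by
  refine ⟨fun m n => ⟨ParabolicConn.isClosedSubgroup_SLxSL m n,
      ParabolicConn.isParabolicallyConnected_SLxSL m n⟩,
    fun m n h => ⟨ParabolicConn.isClosedSubgroup_SGLxGL m n,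
      ParabolicConn.isParabolicallyConnected_SGLxGL h⟩,
    fun n => ⟨ParabolicConn.isClosedSubgroup_Sp n, ParabolicConn.isParabolicallyConnected_Sp n⟩,
    fun n => ⟨ParabolicConn.isClosedSubgroup_SpOdd n,
      ParabolicConn.isParabolicallyConnected_SpOdd n⟩,
    fun n => ⟨ParabolicConn.isClosedSubgroup_SpTorus n,
      ParabolicConn.isParabolicallyConnected_SpTorus n⟩,
    fun n h => ⟨ParabolicConn.isClosedSubgroup_SO n,
      ParabolicConn.not_isParabolicallyConnected_SO h⟩,
    fun n h => ⟨ParabolicConn.isClosedSubgroup_SGLxGL n n,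
      ParabolicConn.not_isParabolicallyConnected_SGLxGL h⟩,
    fun ι _ _ H _ => ParabolicConn.isParabolicallyConnected_iff H⟩
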